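/- For $k,h,\ell\in\mathbb{N}$ let $\mathrm{TdMwMtd}(k,h,\ell)$ be the class of all finite simple graphs that are, up to a renaming of the vertices, the value of an algebraic expression built from: the empty graph $\circ$; the single-vertex graph $\bullet$; the $t$-ary disjoint union and the $t$-ary join ($t\ge 2$); the increments $\mathrm{Inc}_{x,E_x}$, which add a new vertex $x$ and a set $E_x$ of edges between $x$ and present vertices; and the substitutions $\mathrm{Subst}_H(G_1,\dots,G_t)$ of graphs $G_1,\dots,G_t$ for the vertices of a $t$-vertex pattern graph $H$, where $|V(H)|\le h$, or $H$ has tree-depth at most $\ell$ and is given by a tree-depth expression (an expression over $\circ$, disjoint unions and increments in which increments have nesting depth at most $\ell$). At most $k$ increments may lie on any root-to-leaf path of the expression tree. An expression is reduced if no argument of a union, join or substitution is the empty graph, every pattern has at least two vertices, and the given tree-depth expressions of patterns are reduced as well. Work on a word RAM with uninitialised memory whose words hold the numbers of the input and all numbers that are polynomial in its length, and let $\omega$ be a real number such that two $t\times t$ matrices of natural numbers can be multiplied in time $O(t^{\omega})$ on this machine (for words that hold all numbers polynomial in $t$ and in the entries). Theorem. There is an algorithm that, given an algebraic expression which shows that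 an undirected graph $G$ with $n$ vertices and $m$ edges lies in $\mathrm{TdMwMtd}(k,h,\ell)$, for any $k,h,\ell\in\mathbb{N}$, computes the number of triangles of $G$. If the expression is reduced, the running time is $$O\bigl(\max(h,1)^{\omega-1}\,n+(k+\ell)\,m+1\bigr);$$ if it is an arbitrary expression of encoding length $L$, the running time is $$O\bigl(\max(h,1)^{\omega-1}\,n+(k+\ell)\,m+L+1\bigr).$$ The algorithm and the constants in the $O$-notation do not depend on $k,h,\ell$, on $G$ or on the expression. -/

import Mathlib

/-! ### A word RAM with unit-cost steps -/

/-- A memory state: registers and arrays of natural numbers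
(every program names only finitely many of them). `mem a i` is the `i`-th cell of array `a`. -/
structure RamState where
  reg : ℕ → ℕ
  mem : ℕ → ℕ → ℕ

/-- Every cell of the state holds a word, that is, a number at most `B`. -/
def RamState.Fits (B : ℕ) (s : RamState) : Prop :=
  (∀ x, s.reg x ≤ B) ∧ ∀ a i, s.mem a i ≤ B

/-- Arithmetic terms: literals, registers, array look-ups, and the four operations of `ℕ`
(truncated subtraction, integer division). -/
inductive RamTerm where
  | lit (c : ℕ)
  | reg (x : ℕ)
  | mem (a : ℕ) (i : RamTerm)
  | add (p q : RamTerm)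
  | sub (p q : RamTerm)
  | mul (p q : RamTerm)
  | div (p q : RamTerm)

/-- The value of a term in a state. -/
def RamTerm.val (s : RamState) : RamTerm → ℕ
  | .lit c => c
  | .reg x => s.reg x
  | .mem a i => s.mem a (i.val s)
  | .add p q => p.val s + q.val s
  | .sub p q => p.val s - q.val s
  | .mul p q => p.val s * q.val s
  | .div p q => p.val s / q.val s

/-- No number that occurs in the evaluation of the term exceeds `B`. -/
def RamTerm.Fits (B : ℕ) (s : RamState) : RamTerm → Prop
  | .lit c => c ≤ B
  | .reg x => s.reg x ≤ B
  | .mem a i => i.Fits B s ∧ s.mem a (i.val s) ≤ B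
  | .add p q => p.Fits B s ∧ q.Fits B s ∧ p.val s + q.val s ≤ B
  | .sub p q => p.Fits B s ∧ q.Fits B s
  | .mul p q => p.Fits B s ∧ q.Fits B s ∧ p.val s * q.val s ≤ B
  | .div p q => p.Fits B s ∧ q.Fits B s

/-- The number of elementary operations in a term. -/
def RamTerm.cost : RamTerm → ℕ
  | .lit _ => 1
  | .reg _ => 1
  | .mem _ i => i.cost + 1
  | .add p q => p.cost + q.cost + 1
  | .sub p q => p.cost + q.cost + 1
  | .mul p q => p.cost + q.cost + 1
  | .div p q => p.cost + q.cost + 1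

/-- Programs: `set x e` is `x := e`, `store a i e` is `a[i] := e`, `cond e p q` runs `p` if
`e ≠ 0` and `q` otherwise, `loop e p` repeats `p` as long as `e ≠ 0`. -/
inductive RamProg where
  | skip
  | set (x : ℕ) (e : RamTerm)
  | store (a : ℕ) (i e : RamTerm)
  | seq (p q : RamProg)
  | cond (e : RamTerm) (p q : RamProg)
  | loop (e : RamTerm) (p : RamProg)

/-- `p.Runs B s T s'`: with words bounded by `B`, the program `p` started in `s` halts in `s'`
after `T` elementary steps. A computation in which a number above `B` arises has no run. -/
inductive RamProg.Runs (B : ℕ) : RamProg → RamState → ℕ → RamState → Prop where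
  | skip (s : RamState) : Runs B .skip s 1 s
  | set (x : ℕ) (e : RamTerm) (s : RamState) (he : e.Fits B s) :
      Runs B (.set x e) s (e.cost + 1) ⟨Function.update s.reg x (e.val s), s.mem⟩
  | store (a : ℕ) (i e : RamTerm) (s : RamState) (hi : i.Fits B s) (he : e.Fits B s) :
      Runs B (.store a i e) s (i.cost + e.cost + 1)
        ⟨s.reg, Function.update s.mem a (Function.update (s.mem a) (i.val s) (e.val s))⟩
  | seq (p q : RamProg) (s₁ s₂ s₃ : RamState) (T₁ T₂ : ℕ) (hp : Runs B p s₁ T₁ s₂)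
      (hq : Runs B q s₂ T₂ s₃) : Runs B (.seq p q) s₁ (T₁ + T₂) s₃
  | cond_pos (e : RamTerm) (p q : RamProg) (s s₁ : RamState) (T : ℕ) (hf : e.Fits B s)
      (he : e.val s ≠ 0) (hp : Runs B p s T s₁) : Runs B (.cond e p q) s (e.cost + 1 + T) s₁
  | cond_neg (e : RamTerm) (p q : RamProg) (s s₁ : RamState) (T : ℕ) (hf : e.Fits B s)
      (he : e.val s = 0) (hq : Runs B q s T s₁) : Runs B (.cond e p q) s (e.cost + 1 + T) s₁
  | loop_stop (e : RamTerm) (p : RamProg) (s : RamState) (hf : e.Fits B s)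
      (he : e.val s = 0) : Runs B (.loop e p) s (e.cost + 1) s
  | loop_step (e : RamTerm) (p : RamProg) (s₁ s₂ s₃ : RamState) (T₁ T₂ : ℕ)
      (hf : e.Fits B s₁) (he : e.val s₁ ≠ 0) (hp : Runs B p s₁ T₁ s₂)
      (hl : Runs B (.loop e p) s₂ T₂ s₃) : Runs B (.loop e p) s₁ (e.cost + 1 + T₁ + T₂) s₃

/-- The state holds the list `w` as input: its length in register `0`, its entries in array `0`.
The rest of the memory is arbitrary. -/
def RamState.HoldsInput (s : RamState) (w : List ℕ) : Prop :=
  s.reg 0 = w.length ∧ ∀ (i : ℕ) (hi : i < w.length), s.mem 0 i = w[i]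

/-- Two `t × t` matrices can be multiplied in time `O(t ^ ω)` on the word RAM: one program
multiplies all matrices with natural entries, where a word holds any fixed power of the
numbers of the input. The factors stand row by row in the arrays `0` and `1`, the product in
array `2`; the other memory cells hold arbitrary words at the start. -/
def IsMatMulExponent (ω : ℝ) : Prop :=
  ∃ (P : RamProg) (c : ℕ) (C : ℝ),
    ∀ (t M : ℕ) (X Y : Matrix (Fin t) (Fin t) ℕ), (∀ i j, X i j ≤ M ∧ Y i j ≤ M) →
    ∀ (B : ℕ) (s : RamState), (t + M + 2) ^ c ≤ B → s.Fits B → s.reg 0 = t →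
      (∀ i j : Fin t, s.mem 0 (i * t + j) = X i j ∧ s.mem 1 (i * t + j) = Y i j) →
      ∃ (T : ℕ) (s' : RamState), P.Runs B s T s' ∧
        (∀ i j : Fin t, s'.mem 2 (i * t + j) = (X * Y) i j) ∧
        (T : ℝ) ≤ C * ((t : ℝ) ^ ω + 1)

/-! ### Algebraic expressions for graphs -/

/-- Algebraic expressions whose vertices are named by natural numbers.
* `empty`, `single v`: the empty graph and the graph with the single vertex `v`;
* `union t args`, `join t args`: the `t`-ary disjoint union and join;
* `inc x N e`: adds the vertex `x` with the edges `{x, v}`, `v ∈ N`;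
* `substSmall t E args`: substitution into the pattern with vertices `0, …, t - 1` and edge
  list `E`, an operation of the family restricted by the number of pattern vertices;
* `substTd t H args`: substitution into the pattern with vertices `0, …, t - 1` that is given by
  its tree-depth expression `H`, an operation of the family restricted by tree-depth. -/
inductive GExpr where
  | empty
  | single (v : ℕ)
  | union (t : ℕ) (args : Fin t → GExpr)
  | join (t : ℕ) (args : Fin t → GExpr)
  | inc (x : ℕ) (N : List ℕ) (e : GExpr)
  | substSmall (t : ℕ) (E : List (Fin t × Fin t)) (args : Fin t → GExpr)
  | substTd (t : ℕ) (H : GExpr) (args : Fin t → GExpr)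

namespace GExpr

/-- The vertex set of the value of an expression. -/
def verts : GExpr → Finset ℕ
  | empty => ∅
  | single v => {v}
  | union _ args => Finset.univ.biUnion fun i => (args i).verts
  | join _ args => Finset.univ.biUnion fun i => (args i).verts
  | inc x _ e => insert x e.verts
  | substSmall _ _ args => Finset.univ.biUnion fun i => (args i).verts
  | substTd _ _ args => Finset.univ.biUnion fun i => (args i).verts

/-- All edges between `V i` and `V j` for the edges `{i, j}` of the pattern `H`. -/
def crossEdges {t : ℕ} (H : SimpleGraph (Fin t)) (V : Fin t → Finset ℕ) : SimpleGraph ℕ :=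
  SimpleGraph.fromRel fun u v => ∃ i j, H.Adj i j ∧ u ∈ V i ∧ v ∈ V j

/-- The edges of the value of an expression (as a graph on all of `ℕ`). -/
def edges : GExpr → SimpleGraph ℕ
  | empty => ⊥
  | single _ => ⊥
  | union _ args => ⨆ i, (args i).edges
  | join _ args => (⨆ i, (args i).edges) ⊔ crossEdges ⊤ fun i => (args i).verts
  | inc x N e => e.edges ⊔ SimpleGraph.fromRel fun u v => u = x ∧ v ∈ N
  | substSmall _ E args => (⨆ i, (args i).edges) ⊔
      crossEdges (SimpleGraph.fromRel fun i j => (i, j) ∈ E) fun i => (args i).verts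
  | substTd _ H args => (⨆ i, (args i).edges) ⊔
      crossEdges (H.edges.comap Fin.val) fun i => (args i).verts

/-- The graph that an expression evaluates to. -/
def val (e : GExpr) : SimpleGraph (e.verts : Set ℕ) := e.edges.induce (e.verts : Set ℕ)

/-- The expression uses only the operations of tree-depth expressions: the empty graph, unions
and vertex increments. -/
def IsTd : GExpr → Prop
  | empty => True
  | union _ args => ∀ i, (args i).IsTd
  | inc _ _ e => e.IsTd
  | single _ => False
  | join _ _ => False
  | substSmall _ _ _ => False
  | substTd _ _ _ => False

/-- The operations are applied to legal arguments: unions and joins have at least two arguments,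
the arguments of an operation are vertex-disjoint, an increment adds a new vertex and edges to
present vertices, every edge is listed once, and a pattern that is given by an expression is
given by a tree-depth expression. -/
def WellFormed : GExpr → Prop
  | empty => True
  | single _ => True
  | union t args => 2 ≤ t ∧ (∀ i, (args i).WellFormed) ∧
      ∀ i j, i ≠ j → Disjoint (args i).verts (args j).verts
  | join t args => 2 ≤ t ∧ (∀ i, (args i).WellFormed) ∧
      ∀ i j, i ≠ j → Disjoint (args i).verts (args j).verts
  | inc x N e => e.WellFormed ∧ x ∉ e.verts ∧ N.Nodup ∧ ∀ v ∈ N, v ∈ e.verts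
  | substSmall _ E args => (E.Nodup ∧ ∀ p ∈ E, p.1 < p.2) ∧ (∀ i, (args i).WellFormed) ∧
      ∀ i j, i ≠ j → Disjoint (args i).verts (args j).verts
  | substTd t H args => (H.WellFormed ∧ H.IsTd ∧ H.verts = Finset.range t) ∧
      (∀ i, (args i).WellFormed) ∧
      ∀ i j, i ≠ j → Disjoint (args i).verts (args j).verts

/-- The nesting depth of the increments: the largest number of increments on a root-to-leaf path
of the expression tree. (A pattern belongs to the label of a tree node.) -/
def incDepth : GExpr → ℕ
  | empty => 0
  | single _ => 0
  | union _ args => Finset.univ.sup fun i => (args i).incDepth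
  | join _ args => Finset.univ.sup fun i => (args i).incDepth
  | inc _ _ e => e.incDepth + 1
  | substSmall _ _ args => Finset.univ.sup fun i => (args i).incDepth
  | substTd _ _ args => Finset.univ.sup fun i => (args i).incDepth

/-- Every pattern graph has at most `h` vertices or is given by a tree-depth expression whose
increments have nesting depth at most `l`. -/
def PatternsBounded (h l : ℕ) : GExpr → Prop
  | empty => True
  | single _ => True
  | union _ args => ∀ i, (args i).PatternsBounded h l
  | join _ args => ∀ i, (args i).PatternsBounded h l
  | inc _ _ e => e.PatternsBounded h l
  | substSmall t _ args => t ≤ h ∧ ∀ i, (args i).PatternsBounded h l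
  | substTd _ H args => H.incDepth ≤ l ∧ ∀ i, (args i).PatternsBounded h l

/-- `e` is an expression that shows that `G` belongs to the class `TdMwMtd(k, h, l)`; the value
of `e` may be followed by a renaming of the vertices. -/
def IsTdMwMtdExprOf (e : GExpr) (k h l : ℕ) {V : Type*} (G : SimpleGraph V) : Prop :=
  e.WellFormed ∧ e.incDepth ≤ k ∧ e.PatternsBounded h l ∧ Nonempty (e.val ≃g G)

/-- The expression has no redundant operations: no argument of a union, join or substitution is
the empty graph, and patterns have at least two vertices; the same holds in the given tree-depth
expressions of the patterns. -/
def Reduced : GExpr → Prop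
  | empty => True
  | single _ => True
  | union _ args => ∀ i, (args i).Reduced ∧ (args i).verts.Nonempty
  | join _ args => ∀ i, (args i).Reduced ∧ (args i).verts.Nonempty
  | inc _ _ e => e.Reduced
  | substSmall t _ args => 2 ≤ t ∧ ∀ i, (args i).Reduced ∧ (args i).verts.Nonempty
  | substTd t H args => 2 ≤ t ∧ H.Reduced ∧ ∀ i, (args i).Reduced ∧ (args i).verts.Nonempty

/-- The expression as a sequence of numbers, in postfix order: the arguments of an operation
precede the operation; a number in `0, …, 6` tells which operation it is, and its labels
follow, each list preceded by its length. -/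
def code : GExpr → List ℕ
  | empty => [0]
  | single v => [1, v]
  | union t args => (List.ofFn fun i => (args i).code).flatten ++ [2, t]
  | join t args => (List.ofFn fun i => (args i).code).flatten ++ [3, t]
  | inc x N e => e.code ++ [4, x, N.length] ++ N
  | substSmall t E args => (List.ofFn fun i => (args i).code).flatten ++ [5, t, E.length] ++
      E.flatMap fun p => [(p.1 : ℕ), (p.2 : ℕ)]
  | substTd t H args => (List.ofFn fun i => (args i).code).flatten ++
      [6, t, H.code.length] ++ H.code

end GExpr

/-! The code of the expression is evaluated from left to right with a stack that keeps, for every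
operand, only its numbers of vertices and edges. If a graph consists of blocks that are joined
according to a pattern, each of its triangles lies in one block, or consists of an edge of one block
and a vertex of an adjacent block, or meets three blocks that form a triangle of the pattern
(`triSum_blocks`). The second kind is a sum over pattern edges of products of stored numbers; the
third is the number of pattern triangles weighted by the block sizes. A join obtains both by adding
one block at a time (`joinTri`). A pattern given by an edge list needs one matrix product, indexed
by its nonempty blocks (`pairTri`). A pattern given by a tree-depth expression is itself evaluated:
each increment scans the edges of its operand and adds the weights of those with both ends among the
new neighbours (`GExpr.wt`). Increments of the main expression do the same, so the edges of the
graph must be listed explicitly (`GExpr.el`). Correctness is proved with sums over ordered triples,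
where every triangle occurs six times (`GExpr.six_mul_tr`, `six_mul_card_cliqueFinset`).

The time splits into four parts. An edge is scanned only by increments above it, at most `k` of
them, which gives `k * m`. Pattern edges at empty blocks are dropped; each remaining one stands for
at least one edge of the graph created by this substitution, and is scanned at most `l` times, which
gives `l * m` (`GExpr.IsTd.pct_le`, `GExpr.length_fel_le`). A product for `r` nonempty arguments
costs about `r ^ ω ≤ h ^ (ω - 1) * r`, and the numbers `r ≥ 2` add up to at most `2 * n`
(`GExpr.branching_le`). The rest is linear in the code length, which for reduced expressions has a
bound of the same form (`GExpr.Reduced.length_code_le`).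

Listing the edges costs about `m`, which is too much if `k = l = 0`. Hence the evaluation is run
with a flag `f`. With `f = 0` no edges are listed and the triangles of increments are ignored; if no
increment is met, the result is already correct (`GExpr.tr_eq_of_not_hasInc`). Otherwise `k ≥ 1`, so
a second evaluation with `f = 1` may spend a multiple of `m`.

Programs without loops are executed symbolically (`RamProg.Ok.does`), simple loops have invariants
over a list, and the two interpreter loops are followed by induction on the expression
(`RamProg.evaluatesPattern`, `RamProg.evaluates`). Memory is uninitialised, so mark cells are
trusted only for vertices that were cleared before. -/

/-! ### Execution of programs -/

namespace RamTerm

/-- The arithmetic side conditions of `RamTerm.Fits`; the others hold in a state that fits. -/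
def Safe (B : ℕ) (s : RamState) : RamTerm → Prop
  | .lit c => c ≤ B
  | .reg _ => True
  | .mem _ i => i.Safe B s
  | .add p q => p.Safe B s ∧ q.Safe B s ∧ p.val s + q.val s ≤ B
  | .sub p q => p.Safe B s ∧ q.Safe B s
  | .mul p q => p.Safe B s ∧ q.Safe B s ∧ p.val s * q.val s ≤ B
  | .div p q => p.Safe B s ∧ q.Safe B s

theorem Safe.fits {B : ℕ} {s : RamState} (hs : s.Fits B) {e : RamTerm} (he : e.Safe B s) :
    e.Fits B s := by
  induction e with
  | lit c => exact he
  | reg x => exact hs.1 x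
  | mem a i ih => exact ⟨ih he, hs.2 _ _⟩
  | add p q hp hq => exact ⟨hp he.1, hq he.2.1, he.2.2⟩
  | sub p q hp hq => exact ⟨hp he.1, hq he.2⟩
  | mul p q hp hq => exact ⟨hp he.1, hq he.2.1, he.2.2⟩
  | div p q hp hq => exact ⟨hp he.1, hq he.2⟩

theorem Fits.val_le {B : ℕ} {s : RamState} {e : RamTerm} (he : e.Fits B s) : e.val s ≤ B := by
  induction e with
  | lit c => exact he
  | reg x => exact he
  | mem a i ih => exact he.2
  | add p q hp hq => exact he.2.2
  | sub p q hp hq => exact (Nat.sub_le _ _).trans (hp he.1)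
  | mul p q hp hq => exact he.2.2
  | div p q hp hq => exact (Nat.div_le_self _ _).trans (hp he.1)

end RamTerm

namespace RamProg

/-- The program contains an assignment to the register `r`. -/
def WritesReg (r : ℕ) : RamProg → Prop
  | .skip => False
  | .set x _ => r = x
  | .store _ _ _ => False
  | .seq p q => p.WritesReg r ∨ q.WritesReg r
  | .cond _ p q => p.WritesReg r ∨ q.WritesReg r
  | .loop _ p => p.WritesReg r

/-- The program contains an assignment to a cell of the array `a`. -/
def WritesMem (a : ℕ) : RamProg → Prop
  | .skip => False
  | .set _ _ => False
  | .store b _ _ => a = b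
  | .seq p q => p.WritesMem a ∨ q.WritesMem a
  | .cond _ p q => p.WritesMem a ∨ q.WritesMem a
  | .loop _ p => p.WritesMem a

/-- The states differ only in places to which the program assigns. -/
def Frame (p : RamProg) (s s' : RamState) : Prop :=
  (∀ r, ¬ p.WritesReg r → s'.reg r = s.reg r) ∧ ∀ a, ¬ p.WritesMem a → s'.mem a = s.mem a

theorem Frame.refl (p : RamProg) (s : RamState) : p.Frame s s := ⟨fun _ _ => rfl, fun _ _ => rfl⟩

theorem Frame.trans {p : RamProg} {s₁ s₂ s₃ : RamState} (h : p.Frame s₁ s₂) (h' : p.Frame s₂ s₃) :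
    p.Frame s₁ s₃ :=
  ⟨fun r hr => (h'.1 r hr).trans (h.1 r hr), fun a ha => (h'.2 a ha).trans (h.2 a ha)⟩

namespace Runs

variable {B T : ℕ} {p : RamProg} {s s' : RamState}

/-- Every assigned value is the value of a term that fits, so no separate word invariant has to be
carried through the correctness proofs. -/
theorem fits (h : p.Runs B s T s') : s.Fits B → s'.Fits B := by
  induction h with
  | skip s => exact id
  | set x e s he =>
    intro hs
    refine ⟨fun y => ?_, hs.2⟩
    by_cases hy : y = x
    · subst hy; simpa using he.val_le
    · simpa [hy] using hs.1 y
  | store a i e s hi he =>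
    intro hs
    refine ⟨hs.1, fun b j => ?_⟩
    by_cases hb : b = a
    · subst hb
      by_cases hj : j = i.val s
      · subst hj; simpa using he.val_le
      · simpa [hj] using hs.2 b j
    · simpa [hb] using hs.2 b j
  | seq p q s₁ s₂ s₃ T₁ T₂ _ _ ih₁ ih₂ => exact fun h => ih₂ (ih₁ h)
  | cond_pos e p q s s₁ T _ _ _ ih => exact ih
  | cond_neg e p q s s₁ T _ _ _ ih => exact ih
  | loop_stop e p s _ _ => exact id
  | loop_step e p s₁ s₂ s₃ T₁ T₂ _ _ _ _ ih₁ ih₂ => exact fun h => ih₂ (ih₁ h)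

/-- The assigned places are read off from the program text. This lets `simp` decide for concrete
programs which registers and arrays survive, and loop invariants need to mention only what changes.
-/
theorem frame (h : p.Runs B s T s') : p.Frame s s' := by
  induction h with
  | skip s => exact Frame.refl _ _
  | set x e s he =>
    exact ⟨fun r hr => by simp [Function.update_of_ne (show r ≠ x from hr)], fun _ _ => rfl⟩
  | store a i e s hi he =>
    exact ⟨fun _ _ => rfl, fun b hb => by simp [Function.update_of_ne (show b ≠ a from hb)]⟩
  | seq p q s₁ s₂ s₃ T₁ T₂ _ _ ih₁ ih₂ =>
    simp only [Frame, WritesReg, WritesMem, not_or] at *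
    exact ⟨fun r hr => (ih₂.1 r hr.2).trans (ih₁.1 r hr.1),
      fun a ha => (ih₂.2 a ha.2).trans (ih₁.2 a ha.1)⟩
  | cond_pos e p q s s₁ T _ _ _ ih =>
    simp only [Frame, WritesReg, WritesMem, not_or] at *
    exact ⟨fun r hr => ih.1 r hr.1, fun a ha => ih.2 a ha.1⟩
  | cond_neg e p q s s₁ T _ _ _ ih =>
    simp only [Frame, WritesReg, WritesMem, not_or] at *
    exact ⟨fun r hr => ih.1 r hr.2, fun a ha => ih.2 a ha.2⟩
  | loop_stop e p s _ _ => exact Frame.refl _ _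
  | loop_step e p s₁ s₂ s₃ T₁ T₂ _ _ _ _ ih₁ ih₂ => exact Frame.trans (p := p) ih₁ ih₂

/-- A run changes at most as many cells as it has steps. -/
theorem exists_changed (h : p.Runs B s T s') (a : ℕ) :
    ∃ F : Finset ℕ, F.card ≤ T ∧ ∀ i ∉ F, s'.mem a i = s.mem a i := by
  classical
  induction h with
  | skip s => exact ⟨∅, by simp⟩
  | set x e s he => exact ⟨∅, by simp⟩
  | store b i e s hi he =>
    refine ⟨{i.val s}, by simp, fun j hj => ?_⟩
    by_cases hb : a = b
    · subst hb; simp_all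
    · simp [hb]
  | seq p q s₁ s₂ s₃ T₁ T₂ _ _ ih₁ ih₂ =>
    obtain ⟨F, hF, h₁⟩ := ih₁
    obtain ⟨F', hF', h₂⟩ := ih₂
    refine ⟨F ∪ F', (Finset.card_union_le _ _).trans (by omega), fun i hi => ?_⟩
    simp only [Finset.mem_union, not_or] at hi
    rw [h₂ i hi.2, h₁ i hi.1]
  | cond_pos e p q s s₁ T _ _ _ ih =>
    obtain ⟨F, hF, h₁⟩ := ih
    exact ⟨F, by omega, h₁⟩
  | cond_neg e p q s s₁ T _ _ _ ih =>
    obtain ⟨F, hF, h₁⟩ := ih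
    exact ⟨F, by omega, h₁⟩
  | loop_stop e p s _ _ => exact ⟨∅, by simp⟩
  | loop_step e p s₁ s₂ s₃ T₁ T₂ _ _ _ _ ih₁ ih₂ =>
    obtain ⟨F, hF, h₁⟩ := ih₁
    obtain ⟨F', hF', h₂⟩ := ih₂
    refine ⟨F ∪ F', (Finset.card_union_le _ _).trans (by omega), fun i hi => ?_⟩
    simp only [Finset.mem_union, not_or] at hi
    rw [h₂ i hi.2, h₁ i hi.1]

end Runs

/-- The program halts within `T` steps in a state with property `Q`. -/
def Does (B : ℕ) (p : RamProg) (s : RamState) (T : ℕ) (Q : RamState → Prop) : Prop :=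
  ∃ (T' : ℕ) (s' : RamState), p.Runs B s T' s' ∧ T' ≤ T ∧ Q s'

/-- The final state of a program without loops. -/
def exec : RamProg → RamState → RamState
  | .skip, s => s
  | .set x e, s => ⟨Function.update s.reg x (e.val s), s.mem⟩
  | .store a i e, s =>
    ⟨s.reg, Function.update s.mem a (Function.update (s.mem a) (i.val s) (e.val s))⟩
  | .seq p q, s => q.exec (p.exec s)
  | .cond e p q, s => if e.val s = 0 then q.exec s else p.exec s
  | .loop _ _, s => s

/-- The program has no loops and its computation does not overflow. -/
def Ok (B : ℕ) : RamProg → RamState → Prop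
  | .skip, _ => True
  | .set _ e, s => e.Safe B s
  | .store _ i e, s => i.Safe B s ∧ e.Safe B s
  | .seq p q, s => p.Ok B s ∧ q.Ok B (p.exec s)
  | .cond e p q, s => e.Safe B s ∧ (e.val s ≠ 0 → p.Ok B s) ∧ (e.val s = 0 → q.Ok B s)
  | .loop _ _, _ => False

/-- An upper bound for the number of steps of a program without loops. -/
def time : RamProg → ℕ
  | .skip => 1
  | .set _ e => e.cost + 1
  | .store _ i e => i.cost + e.cost + 1
  | .seq p q => p.time + q.time
  | .cond e p q => e.cost + 1 + (p.time + q.time)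
  | .loop _ _ => 0

section Rules

variable {B : ℕ} {p q : RamProg} {s : RamState}

/-- The step count is only an upper bound, because `time` charges both branches of a conditional and
thereby becomes a number independent of the state. -/
theorem Ok.runs {s : RamState} (hs : s.Fits B) (h : p.Ok B s) :
    ∃ T ≤ p.time, p.Runs B s T (p.exec s) := by
  induction p generalizing s with
  | skip => exact ⟨1, le_rfl, .skip _⟩
  | set x e => exact ⟨_, le_rfl, .set _ _ _ (RamTerm.Safe.fits hs h)⟩
  | store a i e =>
    exact ⟨_, le_rfl, .store _ _ _ _ (RamTerm.Safe.fits hs h.1) (RamTerm.Safe.fits hs h.2)⟩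
  | seq p q hp hq =>
    obtain ⟨T₁, h₁, r₁⟩ := hp hs h.1
    obtain ⟨T₂, h₂, r₂⟩ := hq (r₁.fits hs) h.2
    exact ⟨T₁ + T₂, Nat.add_le_add h₁ h₂, .seq _ _ _ _ _ _ _ r₁ r₂⟩
  | cond e p q hp hq =>
    have he := RamTerm.Safe.fits hs h.1
    by_cases h0 : e.val s = 0
    · obtain ⟨T₁, h₁, r₁⟩ := hq hs (h.2.2 h0)
      refine ⟨e.cost + 1 + T₁, by simp only [time]; omega, ?_⟩
      simp only [exec, h0, if_true]
      exact .cond_neg _ _ _ _ _ _ he h0 r₁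
    · obtain ⟨T₁, h₁, r₁⟩ := hp hs (h.2.1 h0)
      refine ⟨e.cost + 1 + T₁, by simp only [time]; omega, ?_⟩
      simp only [exec, h0, if_false]
      exact .cond_pos _ _ _ _ _ _ he h0 r₁
  | loop e p => exact h.elim

theorem Ok.does (hs : s.Fits B) (h : p.Ok B s) {T : ℕ} (hT : p.time ≤ T) {Q : RamState → Prop}
    (hQ : Q (p.exec s)) : p.Does B s T Q := by
  obtain ⟨T', hT', hr⟩ := h.runs hs
  exact ⟨T', _, hr, hT'.trans hT, hQ⟩

theorem Does.mono {T T' : ℕ} {Q Q' : RamState → Prop} (h : p.Does B s T Q) (hT : T ≤ T')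
    (hQ : ∀ s', Q s' → Q' s') : p.Does B s T' Q' := by
  obtain ⟨T₁, s', hr, h₁, h₂⟩ := h
  exact ⟨T₁, s', hr, h₁.trans hT, hQ _ h₂⟩

/-- The final state of a run fits, and agrees with the first one outside of the assigned places. -/
theorem Does.strong {T : ℕ} {Q : RamState → Prop} (h : p.Does B s T Q) (hs : s.Fits B) :
    p.Does B s T (fun s' => s'.Fits B ∧ p.Frame s s' ∧ Q s') := by
  obtain ⟨T₁, s', hr, h₁, h₂⟩ := h
  exact ⟨T₁, s', hr, h₁, hr.fits hs, hr.frame, h₂⟩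

theorem Does.seq (hs : s.Fits B) {T₁ T₂ T : ℕ} {Q R : RamState → Prop} (hp : p.Does B s T₁ Q)
    (hq : ∀ s', s'.Fits B → p.Frame s s' → Q s' → q.Does B s' T₂ R) (hT : T₁ + T₂ ≤ T) :
    (RamProg.seq p q).Does B s T R := by
  obtain ⟨T', s', hr, h₁, h₂⟩ := hp
  obtain ⟨T'', s'', hr', h₁', h₂'⟩ := hq s' (hr.fits hs) hr.frame h₂
  exact ⟨T' + T'', s'', .seq _ _ _ _ _ _ _ hr hr', by omega, h₂'⟩

theorem Does.cond_pos (hs : s.Fits B) {e : RamTerm} (he : e.Safe B s) (h : e.val s ≠ 0) {T T' : ℕ}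
    {Q : RamState → Prop} (hp : p.Does B s T Q) (hT : e.cost + 1 + T ≤ T') :
    (RamProg.cond e p q).Does B s T' Q := by
  obtain ⟨T₁, s', hr, h₁, h₂⟩ := hp
  exact ⟨_, s', .cond_pos _ _ _ _ _ _ (he.fits hs) h hr, by omega, h₂⟩

theorem Does.cond_neg (hs : s.Fits B) {e : RamTerm} (he : e.Safe B s) (h : e.val s = 0) {T T' : ℕ}
    {Q : RamState → Prop} (hq : q.Does B s T Q) (hT : e.cost + 1 + T ≤ T') :
    (RamProg.cond e p q).Does B s T' Q := by
  obtain ⟨T₁, s', hr, h₁, h₂⟩ := hq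
  exact ⟨_, s', .cond_neg _ _ _ _ _ _ (he.fits hs) h hr, by omega, h₂⟩

/-- A loop that runs through a list. `I done todo` is the invariant. -/
theorem Does.loop_list {α : Type*} {g : RamTerm} (I : List α → List α → RamState → Prop)
    (c : α → ℕ) (s₀ : RamState)
    (step : ∀ done a todo s, s.Fits B → p.Frame s₀ s → I done (a :: todo) s →
      g.Safe B s ∧ g.val s ≠ 0 ∧ p.Does B s (c a) (I (done ++ [a]) todo))
    (last : ∀ done s, s.Fits B → p.Frame s₀ s → I done [] s → g.Safe B s ∧ g.val s = 0)
    (hs₀ : s₀.Fits B) (l : List α) (h₀ : I [] l s₀) :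
    (RamProg.loop g p).Does B s₀ ((l.map fun a => c a + (g.cost + 1)).sum + (g.cost + 1))
      (I l []) := by
  have key : ∀ (l done : List α) (s : RamState), s.Fits B → p.Frame s₀ s → I done l s →
      (RamProg.loop g p).Does B s ((l.map fun a => c a + (g.cost + 1)).sum + (g.cost + 1))
        (I (done ++ l) []) := by
    intro l
    induction l with
    | nil =>
      intro done s hs hf h
      obtain ⟨h₁, h₂⟩ := last done s hs hf h
      exact ⟨_, s, Runs.loop_stop _ _ _ (h₁.fits hs) h₂, by simp, by simpa using h⟩
    | cons a l ih =>
      intro done s hs hf h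
      obtain ⟨h₁, h₂, T₁, s₁, hr, hT₁, h₃⟩ := step done a l s hs hf h
      obtain ⟨T₂, s₂, hr', hT₂, h₄⟩ := ih (done ++ [a]) s₁ (hr.fits hs) (hf.trans hr.frame) h₃
      refine ⟨_, s₂, .loop_step _ _ _ _ _ _ _ (h₁.fits hs) h₂ hr hr', ?_, by simpa using h₄⟩
      simp only [List.map_cons, List.sum_cons]
      omega
  simpa using key l [] s₀ hs₀ (Frame.refl _ _) h₀

/-- A loop that runs through a list, with rounds of bounded length. -/
theorem Does.loop_list_const {α : Type*} {g : RamTerm} (I : List α → List α → RamState → Prop)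
    (c k : ℕ) (hk : c + (g.cost + 1) ≤ k) (s₀ : RamState)
    (step : ∀ done a todo s, s.Fits B → p.Frame s₀ s → I done (a :: todo) s →
      g.Safe B s ∧ g.val s ≠ 0 ∧ p.Does B s c (I (done ++ [a]) todo))
    (last : ∀ done s, s.Fits B → p.Frame s₀ s → I done [] s → g.Safe B s ∧ g.val s = 0)
    (hs₀ : s₀.Fits B) (l : List α) (h₀ : I [] l s₀) :
    (RamProg.loop g p).Does B s₀ (k * l.length + k) (I l []) := by
  refine (Does.loop_list I (fun _ => c) s₀ step last hs₀ l h₀).mono ?_ fun _ h => h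
  rw [List.map_const', List.sum_replicate, smul_eq_mul, mul_comm]
  exact Nat.add_le_add (Nat.mul_le_mul_right _ hk) (by omega)

/-- A loop that runs backwards through a list. `I todo done` is the invariant. -/
theorem Does.loop_list_rev {α : Type*} {g : RamTerm} (I : List α → List α → RamState → Prop)
    (F : List α → ℕ) (s₀ : RamState)
    (step : ∀ todo a done s, s.Fits B → p.Frame s₀ s → I (todo ++ [a]) done s →
      g.Safe B s ∧ g.val s ≠ 0 ∧ ∃ c, c + (g.cost + 1) + F done ≤ F (a :: done) ∧
        p.Does B s c (I todo (a :: done)))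
    (last : ∀ done s, s.Fits B → p.Frame s₀ s → I [] done s → g.Safe B s ∧ g.val s = 0)
    (hs₀ : s₀.Fits B) (l : List α) (h₀ : I l [] s₀) :
    (RamProg.loop g p).Does B s₀ (F l + (g.cost + 1)) (I [] l) := by
  -- `F` is a potential of the processed part: each round is paid for by the increase of `F`, and
  -- the increases telescope.
  have key : ∀ (l done : List α) (s : RamState), s.Fits B → p.Frame s₀ s → I l done s →
      ∃ (T : ℕ) (s' : RamState), (RamProg.loop g p).Runs B s T s' ∧
        T + F done ≤ F (l ++ done) + (g.cost + 1) ∧ I [] (l ++ done) s' := by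
    intro l
    induction l using List.reverseRecOn with
    | nil =>
      intro done s hs hf h
      obtain ⟨h₁, h₂⟩ := last done s hs hf h
      exact ⟨_, s, Runs.loop_stop _ _ _ (h₁.fits hs) h₂, by simp; omega, by simpa using h⟩
    | append_singleton l a ih =>
      intro done s hs hf h
      obtain ⟨h₁, h₂, c, hc, T₁, s₁, hr, hT₁, h₃⟩ := step l a done s hs hf h
      obtain ⟨T₂, s₂, hr', hT₂, h₄⟩ := ih (a :: done) s₁ (hr.fits hs) (hf.trans hr.frame) h₃
      refine ⟨_, s₂, .loop_step _ _ _ _ _ _ _ (h₁.fits hs) h₂ hr hr', ?_, by simpa using h₄⟩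
      simp only [List.append_assoc, List.singleton_append]
      omega
  obtain ⟨T, s', hr, hT, hI⟩ := key l [] s₀ hs₀ (Frame.refl _ _) h₀
  exact ⟨T, s', hr, by simp at hT; omega, by simpa using hI⟩

/-- Some rounds of the loop `loop g p` lead from `s` to `s'` in `T` steps. -/
def Reach (B : ℕ) (g : RamTerm) (p : RamProg) (s : RamState) (T : ℕ) (s' : RamState) : Prop :=
  (∀ T₂ s₂, (RamProg.loop g p).Runs B s' T₂ s₂ → (RamProg.loop g p).Runs B s (T + T₂) s₂) ∧
    p.Frame s s'

theorem Reach.refl (B : ℕ) (g : RamTerm) (p : RamProg) (s : RamState) : Reach B g p s 0 s :=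
  ⟨fun T₂ s₂ h => by simpa using h, Frame.refl _ _⟩

/-- An interpreter loop handles one operation per round, so a subexpression occupies a segment of
its rounds rather than a whole loop. `Reach` describes a segment by its effect on all continuations,
and therefore segments compose. -/
theorem Reach.trans {g : RamTerm} {s₁ s₂ s₃ : RamState} {T₁ T₂ : ℕ} (h : Reach B g p s₁ T₁ s₂)
    (h' : Reach B g p s₂ T₂ s₃) : Reach B g p s₁ (T₁ + T₂) s₃ :=
  ⟨fun T s hr => by simpa [Nat.add_assoc] using h.1 _ _ (h'.1 _ _ hr), h.2.trans h'.2⟩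

theorem Does.reach {g : RamTerm} (hs : s.Fits B) (hg : g.Safe B s) (h0 : g.val s ≠ 0) {T : ℕ}
    {Q : RamState → Prop} (h : p.Does B s T Q) :
    ∃ T' s', Reach B g p s T' s' ∧ T' ≤ T + (g.cost + 1) ∧ s'.Fits B ∧ Q s' := by
  obtain ⟨T', s', hr, hT, hQ⟩ := h
  refine ⟨g.cost + 1 + T', s', ⟨fun T₂ s₂ h₂ => ?_, hr.frame⟩, by omega, hr.fits hs, hQ⟩
  exact .loop_step _ _ _ _ _ _ _ (hg.fits hs) h0 hr h₂

theorem Reach.does {g : RamTerm} {s' : RamState} {T T' : ℕ} (h : Reach B g p s T s')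
    (hs : s'.Fits B) (hg : g.Safe B s') (h0 : g.val s' = 0) {Q : RamState → Prop} (hQ : Q s')
    (hT : T + (g.cost + 1) ≤ T') : (RamProg.loop g p).Does B s T' Q :=
  ⟨_, s', h.1 _ _ (Runs.loop_stop _ _ _ (hg.fits hs) h0), hT, hQ⟩

end Rules

end RamProg

/-! ### Shifted programs -/

namespace RamTerm

/-- The term with all registers and arrays renumbered. -/
def shift (d : ℕ) : RamTerm → RamTerm
  | .lit c => .lit c
  | .reg x => .reg (d + x)
  | .mem a i => .mem (d + a) (i.shift d)
  | .add p q => .add (p.shift d) (q.shift d)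
  | .sub p q => .sub (p.shift d) (q.shift d)
  | .mul p q => .mul (p.shift d) (q.shift d)
  | .div p q => .div (p.shift d) (q.shift d)

end RamTerm

/-- The part of the state that a program shifted by `d` accesses. -/
def RamState.drop (d : ℕ) (s : RamState) : RamState :=
  ⟨fun x => s.reg (d + x), fun a => s.mem (d + a)⟩

namespace RamTerm

variable {d B : ℕ} {s : RamState} {e : RamTerm}

theorem val_shift : (e.shift d).val s = e.val (s.drop d) := by
  induction e <;> simp_all [shift, val, RamState.drop]

theorem fits_shift : (e.shift d).Fits B s ↔ e.Fits B (s.drop d) := by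
  induction e <;> simp_all [shift, Fits, val_shift] <;> simp [RamState.drop]

theorem cost_shift : (e.shift d).cost = e.cost := by
  induction e <;> simp_all [shift, cost]

end RamTerm

namespace RamProg

/-- The program with all registers and arrays renumbered. -/
def shift (d : ℕ) : RamProg → RamProg
  | .skip => .skip
  | .set x e => .set (d + x) (e.shift d)
  | .store a i e => .store (d + a) (i.shift d) (e.shift d)
  | .seq p q => .seq (p.shift d) (q.shift d)
  | .cond e p q => .cond (e.shift d) (p.shift d) (q.shift d)
  | .loop e p => .loop (e.shift d) (p.shift d)

theorem not_writesReg_shift {d r : ℕ} (h : r < d) (p : RamProg) : ¬ (p.shift d).WritesReg r := by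
  induction p <;> simp_all [shift, WritesReg]
  omega

theorem not_writesMem_shift {d a : ℕ} (h : a < d) (p : RamProg) : ¬ (p.shift d).WritesMem a := by
  induction p <;> simp_all [shift, WritesMem]
  omega

/-- The shifted program simulates the original one on the places from `d` on. Since it cannot assign
to smaller places, a foreign program can be called as a subroutine. -/
theorem Runs.shift {B T d : ℕ} {p : RamProg} {s t : RamState} (h : p.Runs B s T t) :
    ∀ s₀ : RamState, s₀.drop d = s → ∃ t₀ : RamState, t₀.drop d = t ∧
      (p.shift d).Runs B s₀ T t₀ := by
  induction h with
  | skip s => exact fun s₀ h => ⟨s₀, h, .skip _⟩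
  | set x e s he =>
    rintro s₀ rfl
    refine ⟨_, ?_, RamTerm.cost_shift (d := d) (e := e) ▸ Runs.set _ _ _ (RamTerm.fits_shift.2 he)⟩
    simp only [RamState.drop, RamTerm.val_shift, RamState.mk.injEq, and_true]
    funext y
    by_cases hy : y = x
    · subst hy; simp
    · simp [hy]
  | store a i e s hi he =>
    rintro s₀ rfl
    refine ⟨_, ?_, RamTerm.cost_shift (d := d) (e := e) ▸ RamTerm.cost_shift (d := d) (e := i) ▸
      Runs.store _ _ _ _ (RamTerm.fits_shift.2 hi) (RamTerm.fits_shift.2 he)⟩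
    simp only [RamState.drop, RamTerm.val_shift, RamState.mk.injEq, true_and]
    funext b
    by_cases hb : b = a
    · subst hb; simp
    · simp [hb]
  | seq p q s₁ s₂ s₃ T₁ T₂ _ _ ih₁ ih₂ =>
    intro s₀ h
    obtain ⟨t₀, h₁, r₁⟩ := ih₁ s₀ h
    obtain ⟨t₁, h₂, r₂⟩ := ih₂ t₀ h₁
    exact ⟨t₁, h₂, .seq _ _ _ _ _ _ _ r₁ r₂⟩
  | cond_pos e p q s s₁ T hf he _ ih =>
    rintro s₀ rfl
    obtain ⟨t₀, h₁, r₁⟩ := ih s₀ rfl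
    exact ⟨t₀, h₁, RamTerm.cost_shift (d := d) (e := e) ▸
      Runs.cond_pos _ _ _ _ _ _ (RamTerm.fits_shift.2 hf) (by rwa [RamTerm.val_shift]) r₁⟩
  | cond_neg e p q s s₁ T hf he _ ih =>
    rintro s₀ rfl
    obtain ⟨t₀, h₁, r₁⟩ := ih s₀ rfl
    exact ⟨t₀, h₁, RamTerm.cost_shift (d := d) (e := e) ▸
      Runs.cond_neg _ _ _ _ _ _ (RamTerm.fits_shift.2 hf) (by rwa [RamTerm.val_shift]) r₁⟩
  | loop_stop e p s hf he =>
    rintro s₀ rfl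
    exact ⟨s₀, rfl, RamTerm.cost_shift (d := d) (e := e) ▸
      Runs.loop_stop _ _ _ (RamTerm.fits_shift.2 hf) (by rwa [RamTerm.val_shift])⟩
  | loop_step e p s₁ s₂ s₃ T₁ T₂ hf he _ _ ih₁ ih₂ =>
    rintro s₀ rfl
    obtain ⟨t₀, h₁, r₁⟩ := ih₁ s₀ rfl
    obtain ⟨t₁, h₂, r₂⟩ := ih₂ t₀ h₁
    exact ⟨t₁, h₂, RamTerm.cost_shift (d := d) (e := e) ▸
      Runs.loop_step _ _ _ _ _ _ _ (RamTerm.fits_shift.2 hf) (by rwa [RamTerm.val_shift]) r₁ r₂⟩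

end RamProg

/-- Matrix multiplication takes at least quadratic time, as the product has to be written down. -/
theorem IsMatMulExponent.two_le {ω : ℝ} (h : IsMatMulExponent ω) : 2 ≤ ω := by
  obtain ⟨P, c, C, hP⟩ := h
  have key : ∀ t : ℕ, 1 ≤ t → (t : ℝ) ^ (2 : ℝ) ≤ C * ((t : ℝ) ^ ω + 1) := by
    intro t ht
    -- Both factors are all ones and the output array starts with zeros. All `t * t` entries of the
    -- product are positive, so all these cells must be changed, at most one per step.
    let s : RamState := ⟨fun x => if x = 0 then t else 0, fun a _ => if a = 2 then 0 else 1⟩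
    obtain ⟨T, s', hr, hZ, hT⟩ := hP t 1 (Matrix.of fun _ _ => 1) (Matrix.of fun _ _ => 1) (by simp)
      ((t + 1 + 2) ^ c + t + 1) s (by omega)
      ⟨fun x => by dsimp [s]; split <;> omega, fun a i => by dsimp [s]; split <;> omega⟩
      (by simp [s]) (by simp [s])
    obtain ⟨F, hF, hF'⟩ := hr.exists_changed 2
    have hsub : (Finset.univ : Finset (Fin t × Fin t)).image
        (fun p => (p.1 : ℕ) * t + p.2) ⊆ F := by
      intro x hx
      obtain ⟨⟨i, j⟩, -, rfl⟩ := Finset.mem_image.1 hx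
      by_contra hn
      have h₁ := hZ i j
      rw [hF' _ hn, Matrix.mul_apply] at h₁
      simp [s] at h₁
      omega
    have hcard := Finset.card_le_card hsub
    rw [Finset.card_image_of_injective, Finset.card_univ, Fintype.card_prod, Fintype.card_fin]
      at hcard
    · refine le_trans ?_ hT
      rw [Real.rpow_two, sq]
      exact_mod_cast hcard.trans hF
    · rintro ⟨i, j⟩ ⟨i', j'⟩ hij
      simp only at hij
      have hi : (i : ℕ) = i' := by
        have := congrArg (· / t) hij
        simpa [Nat.mul_comm _ t, Nat.mul_add_div ht, Nat.div_eq_of_lt j.2,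
          Nat.div_eq_of_lt j'.2] using this
      rw [hi] at hij
      ext
      · exact hi
      · simpa using hij
  by_contra hlt
  push Not at hlt
  -- With a nonnegative exponent, `t ^ ω' ≥ 1` absorbs the additive constant. The ratio `t ^ (2 -
  -- ω')` would then be bounded, although it tends to infinity.
  set ω' := max ω 0 with hω'
  have hω'2 : ω' < 2 := max_lt hlt (by norm_num)
  have hC : 0 ≤ C := by
    have := key 1 le_rfl
    simp at this
    linarith
  have h₂ : ∀ t : ℕ, 1 ≤ t → (t : ℝ) ^ (2 - ω') ≤ 2 * C := by
    intro t ht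
    have ht' : (1 : ℝ) ≤ t := by exact_mod_cast ht
    have hpos : (0 : ℝ) < (t : ℝ) ^ ω' := Real.rpow_pos_of_pos (by linarith) _
    rw [Real.rpow_sub (by linarith), div_le_iff₀ hpos]
    refine (key t ht).trans ?_
    have h₃ : (t : ℝ) ^ ω ≤ (t : ℝ) ^ ω' := Real.rpow_le_rpow_of_exponent_le ht' (le_max_left _ _)
    have h₄ : 1 ≤ (t : ℝ) ^ ω' := Real.one_le_rpow ht' (le_max_right _ _)
    nlinarith
  have h₃ := ((tendsto_rpow_atTop (show 0 < 2 - ω' by linarith)).comp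
    tendsto_natCast_atTop_atTop).eventually_gt_atTop (2 * C)
  obtain ⟨t, ht, ht'⟩ := (h₃.and (Filter.eventually_ge_atTop 1)).exists
  exact absurd (h₂ t ht') (not_le.2 ht)

/-! ### Vertex lists, edge lists and triangle numbers of expressions -/

/-- The edges of the join of the blocks. -/
def joinEdges : List (List ℕ) → List (ℕ × ℕ)
  | [] => []
  | a :: l => joinEdges l ++ a ×ˢ l.flatten

/-- The edges between the blocks whose numbers are listed in `P`. -/
def blockEdges (P : List (ℕ × ℕ)) (b : List (List ℕ)) : List (ℕ × ℕ) :=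
  P.flatMap fun p => b.getD p.1 [] ×ˢ b.getD p.2 []

/-- The number of edges of the join of graphs with the given numbers of vertices and edges. -/
def joinSize : List (ℕ × ℕ) → ℕ
  | [] => 0
  | a :: l => joinSize l + (a.2 + a.1 * (l.map Prod.fst).sum)

/-- The number of triangles of a join that are not triangles of the arguments. -/
def joinTri : List (ℕ × ℕ) → ℕ
  | [] => 0
  | a :: l => joinTri l + (a.2 * (l.map Prod.fst).sum + joinSize l * a.1)

/-- The number of triangles that meet exactly two blocks. -/
def crossTri (P : List (ℕ × ℕ)) (d : List (ℕ × ℕ)) : ℕ :=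
  (P.map fun p => (d.getD p.1 (0, 0)).2 * (d.getD p.2 (0, 0)).1 +
    (d.getD p.2 (0, 0)).2 * (d.getD p.1 (0, 0)).1).sum

/-- The symmetric adjacency matrix of an edge list. -/
def pairAdj (P : List (ℕ × ℕ)) (i j : ℕ) : ℕ := if (i, j) ∈ P ∨ (j, i) ∈ P then 1 else 0

/-- Three times the weighted number of triangles of an edge list on the vertices below `t`. -/
def pairTri (t : ℕ) (P : List (ℕ × ℕ)) (n : ℕ → ℕ) : ℕ :=
  (P.map fun p => n p.1 * n p.2 *
    ∑ k ∈ Finset.range t, pairAdj P p.1 k * n k * pairAdj P k p.2).sum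

namespace GExpr

/-- The vertices of an expression in the order of the code. -/
def vl : GExpr → List ℕ
  | empty => []
  | single v => [v]
  | union _ args => (List.ofFn fun i => (args i).vl).flatten
  | join _ args => (List.ofFn fun i => (args i).vl).flatten
  | inc x _ e => e.vl ++ [x]
  | substSmall _ _ args => (List.ofFn fun i => (args i).vl).flatten
  | substTd _ _ args => (List.ofFn fun i => (args i).vl).flatten

/-- The edges of an expression in the order of the code. -/
def el : GExpr → List (ℕ × ℕ)
  | empty => []
  | single _ => []
  | union _ args => (List.ofFn fun i => (args i).el).flatten
  | join _ args => (List.ofFn fun i => (args i).el).flatten ++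
      joinEdges (List.ofFn fun i => (args i).vl)
  | inc x N e => e.el ++ N.map fun v => (x, v)
  | substSmall _ E args => (List.ofFn fun i => (args i).el).flatten ++
      blockEdges (E.map fun p => ((p.1 : ℕ), (p.2 : ℕ))) (List.ofFn fun i => (args i).vl)
  | substTd _ H args => (List.ofFn fun i => (args i).el).flatten ++
      blockEdges H.el (List.ofFn fun i => (args i).vl)

/-- The weighted number of triangles of a tree-depth expression. -/
def wt (w : ℕ → ℕ) : GExpr → ℕ
  | union _ args => (List.ofFn fun i => (args i).wt w).sum
  | inc x N e => e.wt w +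
      (e.el.map fun p => if p.1 ∈ N ∧ p.2 ∈ N then w x * (w p.1 * w p.2) else 0).sum
  | _ => 0

/-- The numbers of vertices and edges. -/
def size (e : GExpr) : ℕ × ℕ := (e.vl.length, e.el.length)

/-- The numbers of vertices of the blocks. -/
def blockSize {t : ℕ} (args : Fin t → GExpr) (i : ℕ) : ℕ :=
  ((List.ofFn fun i => (args i).size).getD i (0, 0)).1

/-- The number of triangles, if `f = 1`; the triangles that arise from increments are omitted if
`f = 0`. -/
def tr (f : ℕ) : GExpr → ℕ
  | empty => 0
  | single _ => 0
  | union _ args => (List.ofFn fun i => (args i).tr f).sum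
  | join _ args => (List.ofFn fun i => (args i).tr f).sum +
      joinTri (List.ofFn fun i => (args i).size)
  | inc _ N e => e.tr f + f * (e.el.map fun p => if p.1 ∈ N ∧ p.2 ∈ N then 1 else 0).sum
  | substSmall t E args => (List.ofFn fun i => (args i).tr f).sum +
      (crossTri (E.map fun p => ((p.1 : ℕ), (p.2 : ℕ))) (List.ofFn fun i => (args i).size) +
      pairTri t (E.map fun p => ((p.1 : ℕ), (p.2 : ℕ))) (blockSize args) / 3)
  | substTd _ H args => (List.ofFn fun i => (args i).tr f).sum +
      (crossTri H.el (List.ofFn fun i => (args i).size) + H.wt (blockSize args))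

end GExpr

/-! ### Weighted sums over the edges and triangles of a graph -/

open Classical in
/-- The adjacency matrix of a graph. -/
noncomputable def ind {V : Type*} (G : SimpleGraph V) (u v : V) : ℕ := if G.Adj u v then 1 else 0

section ind

variable {V : Type*} (G : SimpleGraph V)

variable {G} in
theorem ind_congr {W : Type*} {G' : SimpleGraph W} {u v : V} {u' v' : W}
    (h : G.Adj u v ↔ G'.Adj u' v') : ind G u v = ind G' u' v' := by
  unfold ind
  by_cases h' : G.Adj u v
  · rw [if_pos h', if_pos (h.1 h')]
  · rw [if_neg h', if_neg fun h'' => h' (h.2 h'')]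

theorem ind_comm (u v : V) : ind G u v = ind G v u := ind_congr (G.adj_comm u v)

theorem ind_self (u : V) : ind G u u = 0 := by simp [ind]

theorem ind_mul_self (u v : V) : ind G u v * ind G u v = ind G u v := by
  unfold ind; split_ifs <;> rfl

theorem ind_le_one (u v : V) : ind G u v ≤ 1 := by unfold ind; split_ifs <;> simp

end ind

/-! ### Ordered edge and triangle sums. -/

section sums

variable {V : Type*} (w : V → ℕ) (A : V → V → ℕ)

/-- The weighted number of ordered edges. -/
def edgeSum (s : Finset V) : ℕ := ∑ u ∈ s, ∑ v ∈ s, A u v * (w u * w v)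

/-- The weighted number of ordered triangles. -/
def triSum (s : Finset V) : ℕ :=
  ∑ u ∈ s, ∑ v ∈ s, ∑ x ∈ s, A u v * A v x * A u x * (w u * w v * w x)

variable {w A}

theorem triSum_congr {A' : V → V → ℕ} {s : Finset V} (h : ∀ u ∈ s, ∀ v ∈ s, A u v = A' u v) :
    triSum w A s = triSum w A' s :=
  Finset.sum_congr rfl fun u hu => Finset.sum_congr rfl fun v hv => Finset.sum_congr rfl
    fun x hx => by rw [h u hu v hv, h v hv x hx, h u hu x hx]

theorem sum_mul_sum_mul_sum (r s t : Finset V) (f : V → ℕ) :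
    (∑ u ∈ r, f u) * (∑ v ∈ s, f v) * ∑ x ∈ t, f x =
      ∑ u ∈ r, ∑ v ∈ s, ∑ x ∈ t, f u * f v * f x := by
  rw [Finset.sum_mul_sum, Finset.sum_mul]
  refine Finset.sum_congr rfl fun u _ => ?_
  rw [Finset.sum_mul]
  exact Finset.sum_congr rfl fun v _ => Finset.mul_sum _ _ _

variable [DecidableEq V]

/-- The new vertex can stand in three positions of an ordered triangle; it cannot stand in two,
because `A x x = 0`. -/
theorem triSum_insert (hA : ∀ u v, A u v = A v u) {x : V} (hx : A x x = 0) {s : Finset V}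
    (h : x ∉ s) : triSum w A (insert x s) = triSum w A s +
      3 * ∑ u ∈ s, ∑ v ∈ s, A u v * (A x u * A x v * (w x * w u * w v)) := by
  simp only [triSum, Finset.sum_insert h, hx, Finset.sum_add_distrib, Finset.mul_sum, zero_mul,
    mul_zero, zero_add, Finset.sum_const_zero]
  simp only [← Finset.sum_add_distrib, ← Finset.mul_sum]
  have e₁ : ∀ u v, A x u * A u v * A x v * (w x * w u * w v) =
      A u v * (A x u * A x v * (w x * w u * w v)) := fun u v => by ring
  have e₂ : ∀ u v, A u x * A x v * A u v * (w u * w x * w v) =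
      A u v * (A x u * A x v * (w x * w u * w v)) := fun u v => by rw [hA u x]; ring
  have e₃ : ∀ u v, A u v * A v x * A u x * (w u * w v * w x) =
      A u v * (A x u * A x v * (w x * w u * w v)) := fun u v => by rw [hA u x, hA v x]; ring
  simp only [e₁, e₂, e₃, Finset.sum_add_distrib]
  ring

/-- A new vertex contributes each of its edges in both orders. The entries of `A` are arbitrary
numbers, since the lemma is applied to a weighted neighbourhood below. -/
theorem even_edgeSum (hA : ∀ u v, A u v = A v u) (hA' : ∀ x, A x x = 0) (s : Finset V) :
    2 ∣ edgeSum w A s := by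
  induction s using Finset.induction_on with
  | empty => simp [edgeSum]
  | insert x s h ih =>
    have : edgeSum w A (insert x s) = edgeSum w A s + 2 * ∑ u ∈ s, A x u * (w x * w u) := by
      simp only [edgeSum, Finset.sum_insert h, hA', Finset.sum_add_distrib, zero_mul, zero_add]
      have : ∀ u, A u x * (w u * w x) = A x u * (w x * w u) := fun u => by rw [hA]; ring
      simp only [this]
      ring
    rw [this]
    exact dvd_add ih (dvd_mul_right _ _)

/-- A new vertex adds three times an ordered edge sum, namely that of its neighbourhood, and this
sum is even. -/
theorem six_dvd_triSum (hA : ∀ u v, A u v = A v u) (hA' : ∀ x, A x x = 0) (s : Finset V) :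
    6 ∣ triSum w A s := by
  induction s using Finset.induction_on with
  | empty => simp [triSum]
  | insert x s h ih =>
    rw [triSum_insert hA (hA' x) h]
    refine dvd_add ih ?_
    have := even_edgeSum (w := w) (A := fun u v => A u v * (A x u * A x v * w x))
      (fun u v => by rw [hA u v]; ring) (by simp [hA']) s
    obtain ⟨k, hk⟩ := this
    refine ⟨k, ?_⟩
    have h₂ : edgeSum w (fun u v => A u v * (A x u * A x v * w x)) s =
        ∑ u ∈ s, ∑ v ∈ s, A u v * (A x u * A x v * (w x * w u * w v)) :=
      Finset.sum_congr rfl fun u _ => Finset.sum_congr rfl fun v _ => by ring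
    rw [← h₂, hk]
    ring

theorem sum_biUnion_fin {t : ℕ} {b : Fin t → Finset V}
    (hb : ∀ i j, i ≠ j → Disjoint (b i) (b j)) (f : V → ℕ) :
    ∑ u ∈ Finset.univ.biUnion b, f u = ∑ i, ∑ u ∈ b i, f u :=
  Finset.sum_biUnion fun i _ j _ hij => hb i j hij

/-- The ordered triangles of a graph that consists of blocks joined according to a pattern. -/
theorem triSum_blocks {t : ℕ} {b : Fin t → Finset V} (hb : ∀ i j, i ≠ j → Disjoint (b i) (b j))
    {A' : Fin t → V → V → ℕ} {h : Fin t → Fin t → ℕ} (hh : ∀ i j, h i j = h j i)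
    (h0 : ∀ i, h i i = 0) (h1 : ∀ i j, h i j * h i j = h i j)
    (hA : ∀ i j, ∀ u ∈ b i, ∀ v ∈ b j, A u v = if i = j then A' i u v else h i j) :
    triSum w A (Finset.univ.biUnion b) = ∑ i, triSum w (A' i) (b i) +
      3 * (∑ i, ∑ k, h i k * (edgeSum w (A' i) (b i) * ∑ v ∈ b k, w v)) +
      triSum (fun i => ∑ v ∈ b i, w v) h Finset.univ := by
  -- The contribution of an ordered triple of blocks. The summands stand for three equal blocks, for
  -- exactly two equal ones (three positions of the odd block), and for distinct blocks; `h i i = 0`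
  -- makes the unwanted ones vanish.
  have hF : ∀ i j k : Fin t, (∑ u ∈ b i, ∑ v ∈ b j, ∑ x ∈ b k,
      A u v * A v x * A u x * (w u * w v * w x)) =
      (if i = j then if j = k then triSum w (A' i) (b i) else 0 else 0) +
      (if i = j then h i k * (edgeSum w (A' i) (b i) * ∑ v ∈ b k, w v) else 0) +
      (if j = k then h j i * (edgeSum w (A' j) (b j) * ∑ v ∈ b i, w v) else 0) +
      (if i = k then h i j * (edgeSum w (A' i) (b i) * ∑ v ∈ b j, w v) else 0) +
      h i j * h j k * h i k * ((∑ v ∈ b i, w v) * (∑ v ∈ b j, w v) * (∑ v ∈ b k, w v)) := by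
    intro i j k
    have e : (∑ u ∈ b i, ∑ v ∈ b j, ∑ x ∈ b k, A u v * A v x * A u x * (w u * w v * w x)) =
        ∑ u ∈ b i, ∑ v ∈ b j, ∑ x ∈ b k, (if i = j then A' i u v else h i j) *
          (if j = k then A' j v x else h j k) * (if i = k then A' i u x else h i k) *
          (w u * w v * w x) :=
      Finset.sum_congr rfl fun u hu => Finset.sum_congr rfl fun v hv => Finset.sum_congr rfl
        fun x hx => by rw [hA i j u hu v hv, hA j k v hv x hx, hA i k u hu x hx]
    rw [e]
    by_cases hij : i = j
    · subst hij
      by_cases hik : i = k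
      · subst hik
        simp [h0, triSum]
      · simp only [if_true, if_neg hik, h0, edgeSum, zero_mul, add_zero, zero_add]
        rw [Finset.sum_mul, Finset.mul_sum]
        refine Finset.sum_congr rfl fun u _ => ?_
        rw [Finset.sum_mul, Finset.mul_sum]
        refine Finset.sum_congr rfl fun v _ => ?_
        rw [Finset.mul_sum, Finset.mul_sum]
        refine Finset.sum_congr rfl fun x _ => ?_
        -- Two of the three edges lead to the other block and have the same indicator, which is
        -- idempotent.
        calc _ = A' i u v * (h i k * h i k) * (w u * w v * w x) := by ring
          _ = _ := by rw [h1]; ring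
    · by_cases hjk : j = k
      · subst hjk
        simp only [if_true, if_neg hij, h0, edgeSum, zero_mul, mul_zero, add_zero, zero_add]
        rw [Finset.mul_sum, Finset.mul_sum]
        refine Finset.sum_congr rfl fun u _ => ?_
        simp only [Finset.mul_sum, Finset.sum_mul]
        refine Finset.sum_congr rfl fun v _ => Finset.sum_congr rfl fun x _ => ?_
        calc _ = A' j v x * (h i j * h i j) * (w u * w v * w x) := by ring
          _ = _ := by rw [h1, hh i j]; ring
      · by_cases hik : i = k
        · subst hik
          simp only [if_true, if_neg hij, if_neg hjk, h0, edgeSum, zero_mul, mul_zero, add_zero,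
            zero_add]
          rw [Finset.sum_mul, Finset.mul_sum]
          refine Finset.sum_congr rfl fun u _ => ?_
          rw [Finset.sum_mul, Finset.mul_sum, Finset.sum_comm]
          refine Finset.sum_congr rfl fun v _ => ?_
          simp only [Finset.mul_sum]
          refine Finset.sum_congr rfl fun x _ => ?_
          calc _ = A' i u v * (h i j * h i j) * (w u * w x * w v) := by rw [hh j i]; ring
            _ = _ := by rw [h1]; ring
        · simp only [if_neg hij, if_neg hjk, if_neg hik, zero_add]
          rw [sum_mul_sum_mul_sum]
          simp only [Finset.mul_sum]
  have e : triSum w A (Finset.univ.biUnion b) = ∑ i, ∑ j, ∑ k, ∑ u ∈ b i, ∑ v ∈ b j, ∑ x ∈ b k,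
      A u v * A v x * A u x * (w u * w v * w x) := by
    simp only [triSum, sum_biUnion_fin hb]
    refine Finset.sum_congr rfl fun i _ => ?_
    rw [Finset.sum_comm]
    refine Finset.sum_congr rfl fun j _ => ?_
    rw [Finset.sum_congr rfl fun u _ => Finset.sum_comm, Finset.sum_comm]
  rw [e]
  simp only [hF, Finset.sum_add_distrib]
  have e₁ : ∑ i : Fin t, ∑ j : Fin t, ∑ k : Fin t,
      (if i = j then if j = k then triSum w (A' i) (b i) else 0 else 0) =
      ∑ i, triSum w (A' i) (b i) := by
    refine Finset.sum_congr rfl fun i _ => ?_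
    rw [Finset.sum_comm]
    simp
  have e₂ : ∑ i : Fin t, ∑ j : Fin t, ∑ k : Fin t,
      (if i = j then h i k * (edgeSum w (A' i) (b i) * ∑ v ∈ b k, w v) else 0) =
      ∑ i, ∑ k, h i k * (edgeSum w (A' i) (b i) * ∑ v ∈ b k, w v) := by
    refine Finset.sum_congr rfl fun i _ => ?_
    rw [Finset.sum_comm]
    simp
  have e₃ : ∑ i : Fin t, ∑ j : Fin t, ∑ k : Fin t,
      (if j = k then h j i * (edgeSum w (A' j) (b j) * ∑ v ∈ b i, w v) else 0) =
      ∑ i, ∑ k, h i k * (edgeSum w (A' i) (b i) * ∑ v ∈ b k, w v) := by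
    rw [Finset.sum_comm]
    simp
  have e₄ : ∑ i : Fin t, ∑ j : Fin t, ∑ k : Fin t,
      (if i = k then h i j * (edgeSum w (A' i) (b i) * ∑ v ∈ b j, w v) else 0) =
      ∑ i, ∑ k, h i k * (edgeSum w (A' i) (b i) * ∑ v ∈ b k, w v) := by
    simp
  rw [e₁, e₂, e₃, e₄]
  simp only [triSum]
  ring

end sums

/-! ### The edge list of an expression -/

/-- The pairs of `l` have entries in `s` and list the edges of the graph with the adjacency
matrix `A`. -/
structure IsEdgeList (l : List (ℕ × ℕ)) (s : Finset ℕ) (A : ℕ → ℕ → ℕ) : Prop where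
  mem : ∀ p ∈ l, p.1 ∈ s ∧ p.2 ∈ s
  count : ∀ u ∈ s, ∀ v ∈ s, l.count (u, v) + l.count (v, u) = A u v

theorem sum_map_pairs {l : List (ℕ × ℕ)} {s : Finset ℕ} (hl : ∀ p ∈ l, p.1 ∈ s ∧ p.2 ∈ s)
    (φ : ℕ → ℕ → ℕ) :
    (l.map fun p => φ p.1 p.2).sum = ∑ u ∈ s, ∑ v ∈ s, l.count (u, v) * φ u v := by
  induction l with
  | nil => simp
  | cons p l ih =>
    have h₁ := hl p (by simp)
    rw [List.map_cons, List.sum_cons, ih fun q hq => hl q (by simp [hq])]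
    have : ∀ u v, (p :: l).count (u, v) * φ u v =
        (if p.1 = u then if p.2 = v then φ u v else 0 else 0) + l.count (u, v) * φ u v := by
      intro u v
      rw [List.count_cons]
      rcases p with ⟨a, b⟩
      simp only [beq_iff_eq, Prod.mk.injEq]
      split_ifs <;> simp_all
      ring
    simp only [this, Finset.sum_add_distrib]
    congr 1
    rw [Finset.sum_eq_single_of_mem p.1 h₁.1, Finset.sum_eq_single_of_mem p.2 h₁.2]
    · simp
    · intro b _ hb; simp [Ne.symm hb]
    · intro b _ hb; simp [Ne.symm hb]

/-- Counting both directions of the listed pairs turns a symmetric sum over the list into a sum over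
ordered pairs of vertices. This is the bridge from what the program adds up to `edgeSum` and
`triSum`. -/
theorem IsEdgeList.two_mul_sum {l : List (ℕ × ℕ)} {s : Finset ℕ} {A : ℕ → ℕ → ℕ}
    (h : IsEdgeList l s A) {φ : ℕ → ℕ → ℕ} (hφ : ∀ u v, φ u v = φ v u) :
    2 * (l.map fun p => φ p.1 p.2).sum = ∑ u ∈ s, ∑ v ∈ s, A u v * φ u v := by
  have e : ∑ u ∈ s, ∑ v ∈ s, A u v * φ u v =
      ∑ u ∈ s, ∑ v ∈ s, (l.count (u, v) * φ u v + l.count (v, u) * φ v u) :=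
    Finset.sum_congr rfl fun u hu => Finset.sum_congr rfl fun v hv => by
      rw [← h.count u hu v hv, hφ v u]; ring
  rw [e]
  simp only [Finset.sum_add_distrib]
  rw [Finset.sum_comm (f := fun u v => l.count (v, u) * φ v u), ← sum_map_pairs h.mem]
  ring

theorem IsEdgeList.two_mul_length {l : List (ℕ × ℕ)} {s : Finset ℕ} {A : ℕ → ℕ → ℕ}
    (h : IsEdgeList l s A) : 2 * l.length = edgeSum 1 A s := by
  have := h.two_mul_sum (φ := fun _ _ => 1) fun _ _ => rfl
  simpa [edgeSum] using this

theorem List.count_product (a b : List ℕ) (u v : ℕ) :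
    (a ×ˢ b).count (u, v) = a.count u * b.count v := by
  have h : ∀ x, (b.map fun y => (x, y)).count (u, v) = if x = u then b.count v else 0 := by
    intro x
    induction b with
    | nil => simp
    | cons y b ih' =>
      simp only [List.map_cons, List.count_cons, ih', beq_iff_eq, Prod.mk.injEq]
      split_ifs <;> simp_all
  induction a with
  | nil => simp
  | cons x a ih =>
    rw [List.product_cons, List.count_append, ih, h, List.count_cons]
    by_cases hx : x = u <;> simp [hx, Nat.add_mul, Nat.add_comm]

/-- Positions in different blocks are paired in exactly one direction; the third summand supplies
the pairs of positions within a block. -/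
theorem count_joinEdges (b : List (List ℕ)) (u v : ℕ) :
    (joinEdges b).count (u, v) + (joinEdges b).count (v, u) +
      (b.map fun a => a.count u * a.count v).sum = b.flatten.count u * b.flatten.count v := by
  induction b with
  | nil => simp [joinEdges]
  | cons a b ih =>
    simp only [joinEdges, List.count_append, List.count_product, List.map_cons, List.sum_cons,
      List.flatten_cons]
    linarith

theorem length_joinEdges (b : List (List ℕ)) (m : List ℕ) (h : m.length = b.length) :
    m.sum + (joinEdges b).length = joinSize ((b.map List.length).zip m) := by
  induction b generalizing m with
  | nil => simp_all [joinEdges, joinSize]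
  | cons a b ih =>
    cases m with
    | nil => simp at h
    | cons x m =>
      simp only [List.length_cons, Nat.add_right_cancel_iff] at h
      have := ih m h
      simp only [joinEdges, List.length_append, List.length_product, List.map_cons, List.zip_cons_cons,
        joinSize, List.sum_cons, List.length_flatten]
      rw [List.map_fst_zip (by simp [h])]
      omega

/-- The recursion from the right is brought into a symmetric form. The terms in the block sizes are
the second and third elementary symmetric polynomials, written in power sums; the rest counts an
edge of one block together with a vertex of another. The formula for `joinSize` is part of the
induction, because `joinTri` uses it. -/
theorem six_mul_joinTri (d : List (ℕ × ℕ)) :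
    2 * (joinSize d : ℤ) = 2 * (d.map fun a => (a.2 : ℤ)).sum + (d.map fun a => (a.1 : ℤ)).sum ^ 2
      - (d.map fun a => (a.1 : ℤ) ^ 2).sum ∧
    6 * (joinTri d : ℤ) = 6 * ((d.map fun a => (a.2 : ℤ)).sum * (d.map fun a => (a.1 : ℤ)).sum -
        (d.map fun a => (a.2 : ℤ) * a.1).sum) + (d.map fun a => (a.1 : ℤ)).sum ^ 3 -
      3 * (d.map fun a => (a.1 : ℤ)).sum * (d.map fun a => (a.1 : ℤ) ^ 2).sum +
      2 * (d.map fun a => (a.1 : ℤ) ^ 3).sum := by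
  induction d with
  | nil => simp [joinTri, joinSize]
  | cons a d ih =>
    obtain ⟨h₁, h₂⟩ := ih
    have e : ((d.map Prod.fst).sum : ℤ) = (d.map fun a => (a.1 : ℤ)).sum := by
      rw [Nat.cast_list_sum, List.map_map]; rfl
    simp only [joinTri, joinSize, List.map_cons, List.sum_cons, Nat.cast_add, Nat.cast_mul, e]
    constructor
    · linear_combination h₁
    · linear_combination h₂ + 3 * (a.1 : ℤ) * h₁

theorem sum_count_pairs (P : List (ℕ × ℕ)) (i j : ℕ) :
    (P.map fun p => (if p.1 = i then 1 else 0) * (if p.2 = j then 1 else 0)).sum =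
      P.count (i, j) := by
  induction P with
  | nil => simp
  | cons p P ih =>
    rw [List.map_cons, List.sum_cons, ih, List.count_cons]
    rcases p with ⟨a, b⟩
    simp only [beq_iff_eq, Prod.mk.injEq]
    split_ifs <;> simp_all
    omega

namespace GExpr

theorem mem_vl (e : GExpr) (v : ℕ) : v ∈ e.vl ↔ v ∈ e.verts := by
  induction e <;> simp_all [vl, verts, List.mem_flatten, List.mem_ofFn, or_comm]

theorem toFinset_vl (e : GExpr) : e.vl.toFinset = e.verts := by
  ext v; simp [mem_vl]

theorem nodup_flatten_ofFn {t : ℕ} {args : Fin t → GExpr} (h : ∀ i, (args i).vl.Nodup)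
    (hd : ∀ i j, i ≠ j → Disjoint (args i).verts (args j).verts) :
    (List.ofFn fun i => (args i).vl).flatten.Nodup := by
  rw [List.nodup_flatten]
  constructor
  · intro l hl
    obtain ⟨i, rfl⟩ := List.mem_ofFn.1 hl
    exact h i
  · rw [List.pairwise_ofFn]
    intro i j hij v hi hj
    exact Finset.disjoint_left.1 (hd i j hij.ne) ((mem_vl _ _).1 hi) ((mem_vl _ _).1 hj)

theorem WellFormed.nodup_vl {e : GExpr} (h : e.WellFormed) : e.vl.Nodup := by
  induction e with
  | empty => simp [vl]
  | single v => simp [vl]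
  | union t args ih => exact nodup_flatten_ofFn (fun i => ih i (h.2.1 i)) h.2.2
  | join t args ih => exact nodup_flatten_ofFn (fun i => ih i (h.2.1 i)) h.2.2
  | inc x N e ih =>
    rw [vl, List.nodup_append]
    refine ⟨ih h.1, by simp, fun a ha b hb => ?_⟩
    rw [mem_vl] at ha
    simp only [List.mem_singleton] at hb
    rintro rfl
    exact h.2.1 (hb ▸ ha)
  | substSmall t E args ih => exact nodup_flatten_ofFn (fun i => ih i (h.2.1 i)) h.2.2
  | substTd t H args _ ih => exact nodup_flatten_ofFn (fun i => ih i (h.2.1 i)) h.2.2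

theorem WellFormed.length_vl {e : GExpr} (h : e.WellFormed) : e.vl.length = e.verts.card := by
  rw [← toFinset_vl, List.toFinset_card_of_nodup h.nodup_vl]

/-- The union of the graphs `args i` with additional edges according to the pattern `Hp`. -/
def blockGraph {t : ℕ} (Hp : SimpleGraph (Fin t)) (args : Fin t → GExpr) : SimpleGraph ℕ :=
  (⨆ i, (args i).edges) ⊔ crossEdges Hp fun i => (args i).verts

section blocks

variable {t : ℕ} {Hp : SimpleGraph (Fin t)} {args : Fin t → GExpr}

theorem crossEdges_bot (b : Fin t → Finset ℕ) : crossEdges ⊥ b = ⊥ := by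
  ext u v; simp [crossEdges, SimpleGraph.fromRel_adj]

theorem blockGraph_bot : blockGraph ⊥ args = ⨆ i, (args i).edges := by
  rw [blockGraph, crossEdges_bot, sup_bot_eq]

theorem blockGraph_adj {u v : ℕ} : (blockGraph Hp args).Adj u v ↔
    (∃ i, (args i).edges.Adj u v) ∨ u ≠ v ∧ ∃ i j, Hp.Adj i j ∧ u ∈ (args i).verts ∧
      v ∈ (args j).verts := by
  rw [blockGraph, SimpleGraph.sup_adj, SimpleGraph.iSup_adj, crossEdges, SimpleGraph.fromRel_adj]
  refine or_congr_right (and_congr_right fun _ => ⟨?_, Or.inl⟩)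
  rintro (h | ⟨i, j, h, hi, hj⟩)
  · exact h
  · exact ⟨j, i, h.symm, hj, hi⟩

theorem blockGraph_adj_verts
    (hv : ∀ i u v, (args i).edges.Adj u v → u ∈ (args i).verts) {u v : ℕ}
    (h : (blockGraph Hp args).Adj u v) : u ∈ Finset.univ.biUnion fun i => (args i).verts := by
  rw [Finset.mem_biUnion]
  rcases blockGraph_adj.1 h with ⟨i, h⟩ | ⟨_, i, j, _, hi, _⟩
  · exact ⟨i, Finset.mem_univ _, hv _ _ _ h⟩
  · exact ⟨i, Finset.mem_univ _, hi⟩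

variable (hv : ∀ i u v, (args i).edges.Adj u v → u ∈ (args i).verts)
  (hd : ∀ i j, i ≠ j → Disjoint (args i).verts (args j).verts)

-- Blocks are disjoint and the edges of a block stay inside it, so the blocks `i` and `j` of two
-- vertices decide alone which kind of edge is possible.
include hv hd in
theorem ind_blockGraph (i j : Fin t) (u : ℕ) (hu : u ∈ (args i).verts) (v : ℕ)
    (hv' : v ∈ (args j).verts) : ind (blockGraph Hp args) u v =
      if i = j then ind (args i).edges u v else ind Hp i j := by
  have huniq : ∀ {w : ℕ} {a b : Fin t}, w ∈ (args a).verts → w ∈ (args b).verts → a = b :=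
    fun ha hb => by_contra fun hne => Finset.disjoint_left.1 (hd _ _ hne) ha hb
  have : (blockGraph Hp args).Adj u v ↔ if i = j then (args i).edges.Adj u v else Hp.Adj i j := by
    rw [blockGraph_adj]
    split_ifs with hij
    · subst hij
      constructor
      · rintro (⟨k, hk⟩ | ⟨_, a, b, hab, ha, hb⟩)
        · rwa [huniq hu (hv _ _ _ hk)]
        · rw [huniq ha hu, huniq hb hv'] at hab
          exact absurd rfl hab.ne
      · exact fun h => Or.inl ⟨i, h⟩
    · constructor
      · rintro (⟨k, hk⟩ | ⟨_, a, b, hab, ha, hb⟩)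
        · exact absurd ((huniq hu (hv _ _ _ hk)).trans (huniq hv' (hv _ _ _ hk.symm)).symm) hij
        · rwa [huniq ha hu, huniq hb hv'] at hab
      · refine fun h => Or.inr ⟨?_, i, j, h, hu, hv'⟩
        rintro rfl
        exact hij (huniq hu hv')
  unfold ind
  split_ifs <;> simp_all

end blocks

theorem WellFormed.adj_verts {e : GExpr} (h : e.WellFormed) {u v : ℕ} (ha : e.edges.Adj u v) :
    u ∈ e.verts := by
  induction e generalizing u v with
  | empty => simp [edges] at ha
  | single v => simp [edges] at ha
  | union t args ih =>
    rw [edges, ← blockGraph_bot] at ha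
    exact blockGraph_adj_verts (fun i u v => ih i (h.2.1 i)) ha
  | join t args ih => exact blockGraph_adj_verts (fun i u v => ih i (h.2.1 i)) ha
  | inc x N e ih =>
    rw [edges, SimpleGraph.sup_adj, SimpleGraph.fromRel_adj] at ha
    rw [verts, Finset.mem_insert]
    rcases ha with ha | ⟨_, ⟨rfl, _⟩ | ⟨rfl, hN⟩⟩
    · exact Or.inr (ih h.1 ha)
    · exact Or.inl rfl
    · exact Or.inr (h.2.2.2 _ hN)
  | substSmall t E args ih => exact blockGraph_adj_verts (fun i u v => ih i (h.2.1 i)) ha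
  | substTd t H args _ ih => exact blockGraph_adj_verts (fun i u v => ih i (h.2.1 i)) ha

end GExpr

/-! ### The edge lists of composed graphs. -/

namespace GExpr

section blocks

variable {t : ℕ} {Hp : SimpleGraph (Fin t)} {args : Fin t → GExpr}

theorem getD_ofFn {α : Type*} (f : Fin t → α) (d : α) (i : Fin t) :
    (List.ofFn f).getD i d = f i := by
  simp [List.getD]

theorem getD_ofFn_of_le {α : Type*} (f : Fin t → α) (d : α) {i : ℕ} (hi : t ≤ i) :
    (List.ofFn f).getD i d = d := by
  simp [List.getD, hi]

theorem verts_unique (hd : ∀ i j, i ≠ j → Disjoint (args i).verts (args j).verts)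
    {w : ℕ} {a b : Fin t} (ha : w ∈ (args a).verts) (hb : w ∈ (args b).verts) : a = b :=
  by_contra fun hne => Finset.disjoint_left.1 (hd _ _ hne) ha hb

variable (hw : ∀ i, (args i).WellFormed)
  (hd : ∀ i j, i ≠ j → Disjoint (args i).verts (args j).verts)

include hw in
theorem count_vl {u : ℕ} (k : Fin t) :
    (args k).vl.count u = if u ∈ (args k).verts then 1 else 0 := by
  rw [(hw k).nodup_vl.count]
  simp [mem_vl]

include hw hd in
theorem count_getD_vl {u : ℕ} {i : Fin t} (hu : u ∈ (args i).verts) (k : ℕ) :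
    ((List.ofFn fun i => (args i).vl).getD k []).count u = if k = i then 1 else 0 := by
  by_cases hk : k < t
  · have := getD_ofFn (fun i => (args i).vl) [] ⟨k, hk⟩
    simp only at this
    rw [this, count_vl hw]
    refine if_congr ⟨fun h => ?_, fun h => ?_⟩ rfl rfl
    · exact congrArg Fin.val (verts_unique hd h hu)
    · subst h; exact hu
  · rw [getD_ofFn_of_le _ _ (not_lt.1 hk)]
    have : k ≠ i := fun h => hk (h ▸ i.2)
    simp [this]

include hw hd in
theorem count_blockEdges (P : List (ℕ × ℕ)) {u v : ℕ} {i j : Fin t} (hu : u ∈ (args i).verts)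
    (hv : v ∈ (args j).verts) :
    (blockEdges P (List.ofFn fun i => (args i).vl)).count (u, v) = P.count ((i : ℕ), (j : ℕ)) := by
  rw [blockEdges, List.count_flatMap, ← sum_count_pairs]
  congr 1
  refine List.map_congr_left fun p _ => ?_
  rw [Function.comp_apply, List.count_product, count_getD_vl hw hd hu, count_getD_vl hw hd hv]

theorem mem_getD_vl {k u : ℕ} (h : u ∈ (List.ofFn fun i => (args i).vl).getD k []) :
    u ∈ Finset.univ.biUnion fun i => (args i).verts := by
  by_cases hk : k < t
  · have := getD_ofFn (fun i => (args i).vl) [] ⟨k, hk⟩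
    simp only at this
    rw [this, mem_vl] at h
    exact Finset.mem_biUnion.2 ⟨_, Finset.mem_univ _, h⟩
  · rw [getD_ofFn_of_le _ _ (not_lt.1 hk)] at h
    simp at h

theorem mem_blockEdges {P : List (ℕ × ℕ)} {p : ℕ × ℕ}
    (hp : p ∈ blockEdges P (List.ofFn fun i => (args i).vl)) :
    (p.1 ∈ Finset.univ.biUnion fun i => (args i).verts) ∧
      p.2 ∈ Finset.univ.biUnion fun i => (args i).verts := by
  rw [blockEdges, List.mem_flatMap] at hp
  obtain ⟨q, _, hq⟩ := hp
  obtain ⟨h₁, h₂⟩ := List.mem_product.1 hq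
  exact ⟨mem_getD_vl h₁, mem_getD_vl h₂⟩

theorem mem_joinEdges {b : List (List ℕ)} {p : ℕ × ℕ} (hp : p ∈ joinEdges b) :
    p.1 ∈ b.flatten ∧ p.2 ∈ b.flatten := by
  induction b with
  | nil => simp [joinEdges] at hp
  | cons a b ih =>
    rw [joinEdges, List.mem_append] at hp
    rw [List.flatten_cons, List.mem_append, List.mem_append]
    rcases hp with hp | hp
    · exact ⟨Or.inr (ih hp).1, Or.inr (ih hp).2⟩
    · obtain ⟨h₁, h₂⟩ := List.mem_product.1 hp
      exact ⟨Or.inl h₁, Or.inr h₂⟩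

theorem mem_flatten_vl {u : ℕ} : u ∈ (List.ofFn fun i => (args i).vl).flatten ↔
    u ∈ Finset.univ.biUnion fun i => (args i).verts := by
  simp [List.mem_flatten, List.mem_ofFn, mem_vl]

-- The common step for unions, joins and substitutions: `X` lists the edges between blocks. For `i =
-- j` the condition `hc` says that `X` has no pair inside a block, as `ind Hp i i = 0`.
include hw hd in
theorem isEdgeList_blocks
    (hel : ∀ i, IsEdgeList (args i).el (args i).verts (ind (args i).edges)) {X : List (ℕ × ℕ)}
    (hX : ∀ p ∈ X, (p.1 ∈ Finset.univ.biUnion fun i => (args i).verts) ∧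
      p.2 ∈ Finset.univ.biUnion fun i => (args i).verts)
    (hc : ∀ i j, ∀ u ∈ (args i).verts, ∀ v ∈ (args j).verts,
      X.count (u, v) + X.count (v, u) = ind Hp i j) :
    IsEdgeList ((List.ofFn fun i => (args i).el).flatten ++ X)
      (Finset.univ.biUnion fun i => (args i).verts) (ind (blockGraph Hp args)) := by
  constructor
  · intro p hp
    rcases List.mem_append.1 hp with hp | hp
    · rw [List.mem_flatten] at hp
      obtain ⟨l, hl, hp⟩ := hp
      obtain ⟨i, rfl⟩ := List.mem_ofFn.1 hl
      have := (hel i).mem p hp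
      exact ⟨Finset.mem_biUnion.2 ⟨i, Finset.mem_univ _, this.1⟩,
        Finset.mem_biUnion.2 ⟨i, Finset.mem_univ _, this.2⟩⟩
    · exact hX p hp
  · intro u hu v hv
    obtain ⟨i, _, hi⟩ := Finset.mem_biUnion.1 hu
    obtain ⟨j, _, hj⟩ := Finset.mem_biUnion.1 hv
    rw [ind_blockGraph (fun i u v => (hw i).adj_verts) hd i j u hi v hj, List.count_append,
      List.count_append]
    have key : ∀ {i j : Fin t} {u v : ℕ}, u ∈ (args i).verts → v ∈ (args j).verts →
        (List.ofFn fun i => (args i).el).flatten.count (u, v) =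
        if i = j then (args i).el.count (u, v) else 0 := by
      intro i j u v hi hj
      rw [List.count_flatten, List.map_ofFn, List.sum_ofFn]
      rw [Finset.sum_eq_single_of_mem i (Finset.mem_univ _)]
      · split_ifs with hij
        · rfl
        · refine List.count_eq_zero.2 fun h => hij ?_
          exact verts_unique hd ((hel i).mem _ h).2 hj
      · intro k _ hk
        refine List.count_eq_zero.2 fun h => hk ?_
        exact verts_unique hd ((hel k).mem _ h).1 hi
    rw [key hi hj, key hj hi]
    have h₁ := hc i j u hi v hj
    by_cases hij : i = j
    · subst hij
      have h₂ := (hel i).count u hi v hj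
      rw [ind_self] at h₁
      simp only [if_true]
      omega
    · simp only [if_neg hij, if_neg (Ne.symm hij)]
      omega

end blocks

/-- The increasing order of each pair rules out that an edge is listed in both directions, and
`Nodup` that it is listed twice. -/
theorem smallPattern_count {t : ℕ} {E : List (Fin t × Fin t)} (hE : E.Nodup ∧ ∀ p ∈ E, p.1 < p.2)
    (i j : Fin t) :
    (E.map fun p => ((p.1 : ℕ), (p.2 : ℕ))).count ((i : ℕ), (j : ℕ)) +
      (E.map fun p => ((p.1 : ℕ), (p.2 : ℕ))).count ((j : ℕ), (i : ℕ)) =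
      ind (SimpleGraph.fromRel fun i j => (i, j) ∈ E) i j := by
  have hinj : Function.Injective fun p : Fin t × Fin t => ((p.1 : ℕ), (p.2 : ℕ)) := by
    rintro ⟨a, b⟩ ⟨c, d⟩ h
    simpa [Fin.ext_iff] using h
  have h : ∀ i j : Fin t, (E.map fun p => ((p.1 : ℕ), (p.2 : ℕ))).count ((i : ℕ), (j : ℕ)) =
      if (i, j) ∈ E then 1 else 0 := by
    intro i j
    have := List.count_map_of_injective E _ hinj (i, j)
    simp only at this
    rw [this, hE.1.count]
  rw [h, h, ind]
  simp only [SimpleGraph.fromRel_adj]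
  by_cases h₁ : (i, j) ∈ E
  · have := hE.2 _ h₁
    have h₂ : (j, i) ∉ E := fun h' => absurd (hE.2 _ h') (by simpa using this.le)
    simp only at this
    simp [h₁, h₂, this.ne]
  · by_cases h₂ : (j, i) ∈ E
    · have := hE.2 _ h₂
      simp only at this
      simp [h₁, h₂, this.ne']
    · simp [h₁, h₂]

/-- For joins the list is measured against the product of all vertices (`count_joinEdges`). For
substitutions a pair inherits its multiplicity from the pattern edge between its blocks
(`count_blockEdges`). For increments no old pair contains the new vertex. -/
theorem WellFormed.isEdgeList {e : GExpr} (h : e.WellFormed) :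
    IsEdgeList e.el e.verts (ind e.edges) := by
  induction e with
  | empty => exact ⟨by simp [el], by simp [verts]⟩
  | single v => exact ⟨by simp [el], by simp [verts, el, ind, edges]⟩
  | union t args ih =>
    have := isEdgeList_blocks (Hp := ⊥) h.2.1 h.2.2 (fun i => ih i (h.2.1 i)) (X := [])
      (by simp) (by simp [ind])
    rw [blockGraph_bot, List.append_nil] at this
    exact this
  | join t args ih =>
    refine isEdgeList_blocks (Hp := ⊤) h.2.1 h.2.2 (fun i => ih i (h.2.1 i)) ?_ ?_
    · intro p hp
      have := mem_joinEdges hp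
      rwa [mem_flatten_vl, mem_flatten_vl] at this
    · intro i j u hu v hv
      have h₁ := count_joinEdges (List.ofFn fun i => (args i).vl) u v
      have h₂ := nodup_flatten_ofFn (fun i => (h.2.1 i).nodup_vl) h.2.2
      rw [List.count_eq_one_of_mem h₂ (mem_flatten_vl.2 (Finset.mem_biUnion.2 ⟨i, by simp, hu⟩)),
        List.count_eq_one_of_mem h₂ (mem_flatten_vl.2 (Finset.mem_biUnion.2 ⟨j, by simp, hv⟩)),
        List.map_ofFn, List.sum_ofFn] at h₁
      have h₃ : ∑ k, ((fun a : List ℕ => a.count u * a.count v) ∘ fun i => (args i).vl) k =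
          if i = j then 1 else 0 := by
        rw [Finset.sum_eq_single_of_mem i (Finset.mem_univ _)]
        · simp only [Function.comp_apply, count_vl h.2.1, hu, if_true, one_mul]
          refine if_congr ⟨fun h' => verts_unique h.2.2 h' hv, ?_⟩ rfl rfl
          rintro rfl
          exact hv
        · intro k _ hk
          have : u ∉ (args k).verts := fun h' => hk (verts_unique h.2.2 h' hu)
          simp [count_vl h.2.1, this]
      rw [h₃] at h₁
      by_cases hij : i = j <;> simp_all [ind]
  | inc x N e ih =>
    have ih := ih h.1
    obtain ⟨h₀, hx, hN, hN'⟩ := h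
    have hc : ∀ u v, (N.map fun v => (x, v)).count (u, v) = if u = x ∧ v ∈ N then 1 else 0 := by
      intro u v
      have : (N.map fun v => (x, v)).Nodup := hN.map fun a b hab => by simpa using hab
      rw [this.count]
      refine if_congr ?_ rfl rfl
      simp only [List.mem_map, Prod.mk.injEq]
      constructor
      · rintro ⟨a, ha, rfl, rfl⟩
        exact ⟨rfl, ha⟩
      · rintro ⟨rfl, ha⟩
        exact ⟨_, ha, rfl, rfl⟩
    constructor
    · intro p hp
      rw [el, List.mem_append] at hp
      rw [verts, Finset.mem_insert, Finset.mem_insert]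
      rcases hp with hp | hp
      · exact ⟨Or.inr (ih.mem p hp).1, Or.inr (ih.mem p hp).2⟩
      · obtain ⟨v, hv, rfl⟩ := List.mem_map.1 hp
        exact ⟨Or.inl rfl, Or.inr (hN' v hv)⟩
    · intro u hu v hv
      rw [el, List.count_append, List.count_append, hc, hc]
      have hxN : x ∉ N := fun h => hx (hN' x h)
      have h0 : ∀ v w, v = x ∨ w = x → e.el.count (v, w) = 0 := by
        intro v w hvw
        refine List.count_eq_zero.2 fun hm => hx ?_
        have := ih.mem _ hm
        rcases hvw with rfl | rfl
        · exact this.1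
        · exact this.2
      have hA : (inc x N e).edges.Adj u v ↔ e.edges.Adj u v ∨
          u ≠ v ∧ (u = x ∧ v ∈ N ∨ v = x ∧ u ∈ N) := by
        rw [edges, SimpleGraph.sup_adj, SimpleGraph.fromRel_adj]
      have hx' : ∀ w, ¬ e.edges.Adj x w := fun w hw => hx (h₀.adj_verts hw)
      rw [verts, Finset.mem_insert] at hu hv
      by_cases hux : u = x
      · subst hux
        rw [h0 _ _ (Or.inl rfl), h0 _ _ (Or.inr rfl)]
        by_cases hvN : v ∈ N
        · have : u ≠ v := fun h => hxN (h ▸ hvN)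
          have had : (inc u N e).edges.Adj u v := by rw [hA]; exact Or.inr ⟨this, Or.inl ⟨rfl, hvN⟩⟩
          simp [ind, had, hvN, hxN]
        · have had : ¬ (inc u N e).edges.Adj u v := by
            rw [hA]
            simp [hx', hvN, hxN]
          simp [ind, had, hvN, hxN]
      · by_cases hvx : v = x
        · subst hvx
          rw [h0 _ _ (Or.inl rfl), h0 _ _ (Or.inr rfl)]
          by_cases huN : u ∈ N
          · have had : (inc v N e).edges.Adj u v := by
              rw [hA]; exact Or.inr ⟨hux, Or.inr ⟨rfl, huN⟩⟩
            simp [ind, had, huN, hxN]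
          · have had : ¬ (inc v N e).edges.Adj u v := by
              rw [hA]
              simp only [huN, hxN, and_false, or_false]
              exact fun h => hx' u h.symm
            simp [ind, had, huN, hxN]
        · have hiff : (inc x N e).edges.Adj u v ↔ e.edges.Adj u v := by
            rw [hA]; simp [hux, hvx]
          have := ih.count u (hu.resolve_left hux) v (hv.resolve_left hvx)
          rw [ind_congr hiff]
          simp [hux, hvx, this]
  | substSmall t E args ih =>
    refine isEdgeList_blocks h.2.1 h.2.2 (fun i => ih i (h.2.1 i)) (fun p => mem_blockEdges) ?_
    intro i j u hu v hv
    rw [count_blockEdges h.2.1 h.2.2 _ hu hv, count_blockEdges h.2.1 h.2.2 _ hv hu,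
      smallPattern_count h.1]
  | substTd t H args ihH ih =>
    refine isEdgeList_blocks h.2.1 h.2.2 (fun i => ih i (h.2.1 i)) (fun p => mem_blockEdges) ?_
    intro i j u hu v hv
    rw [count_blockEdges h.2.1 h.2.2 _ hu hv, count_blockEdges h.2.1 h.2.2 _ hv hu,
      (ihH h.1.1).count _ (by simp [h.1.2.2]) _ (by simp [h.1.2.2])]
    exact ind_congr Iff.rfl

end GExpr

theorem sum_map_ofFn {α M : Type*} [AddCommMonoid M] {t : ℕ} (f : Fin t → α) (g : α → M) :
    ((List.ofFn f).map g).sum = ∑ i, g (f i) := by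
  rw [List.map_ofFn, List.sum_ofFn]; rfl

theorem triSum_range (n : ℕ → ℕ) (A : ℕ → ℕ → ℕ) (t : ℕ) :
    triSum n A (Finset.range t) =
      triSum (fun i : Fin t => n i) (fun i j => A i j) Finset.univ := by
  simp only [triSum, Finset.sum_range]

/-! ### Triangle numbers of composed graphs. -/

namespace GExpr

section blocks

variable {t : ℕ} {Hp : SimpleGraph (Fin t)} {args : Fin t → GExpr} {w : ℕ → ℕ}
  (hw : ∀ i, (args i).WellFormed)
  (hd : ∀ i j, i ≠ j → Disjoint (args i).verts (args j).verts)

theorem blockSize_eq (i : Fin t) : blockSize args i = (args i).vl.length := by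
  rw [blockSize, getD_ofFn]; rfl

theorem blockSize_of_le {i : ℕ} (hi : t ≤ i) : blockSize args i = 0 := by
  rw [blockSize, getD_ofFn_of_le _ _ hi]

-- The specialisation of `triSum_blocks` to weight 1. The factor 6 combines the three positions of
-- the vertex in the other block with the two orders of the edge.
include hw hd in
theorem triSum_blockGraph :
    triSum 1 (ind (blockGraph Hp args)) (Finset.univ.biUnion fun i => (args i).verts) =
      ∑ i, triSum 1 (ind (args i).edges) (args i).verts +
      6 * (∑ i, ∑ k, ind Hp i k * ((args i).el.length * (args k).vl.length)) +
      triSum (fun i : Fin t => (args i).vl.length) (ind Hp) Finset.univ := by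
  have h := triSum_blocks (w := 1) hd (ind_comm Hp) (ind_self Hp) (ind_mul_self Hp)
    (ind_blockGraph (Hp := Hp) (fun i u v => (hw i).adj_verts) hd)
  have hn : ∀ i, ∑ v ∈ (args i).verts, (1 : ℕ → ℕ) v = (args i).vl.length := by
    intro i; simp [(hw i).length_vl]
  simp only [hn, ← (hw _).isEdgeList.two_mul_length] at h
  rw [h, Finset.mul_sum, Finset.mul_sum]
  congr 2
  refine Finset.sum_congr rfl fun i _ => ?_
  rw [Finset.mul_sum, Finset.mul_sum]
  exact Finset.sum_congr rfl fun k _ => by ring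

/-- Each listed pattern edge contributes two products, one for either choice of the block that
contains the edge. These are the two ordered pairs of adjacent blocks on the right. -/
theorem crossTri_eq {P : List (ℕ × ℕ)} {A : ℕ → ℕ → ℕ} (hP : IsEdgeList P (Finset.range t) A)
    (hA : ∀ i j : Fin t, A i j = ind Hp i j) :
    crossTri P (List.ofFn fun i => (args i).size) =
      ∑ i, ∑ k, ind Hp i k * ((args i).el.length * (args k).vl.length) := by
  have h := hP.two_mul_sum (φ := fun i j =>
    ((List.ofFn fun i => (args i).size).getD i (0, 0)).2 *
      ((List.ofFn fun i => (args i).size).getD j (0, 0)).1 +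
    ((List.ofFn fun i => (args i).size).getD j (0, 0)).2 *
      ((List.ofFn fun i => (args i).size).getD i (0, 0)).1) fun u v => by ring
  rw [← crossTri, Finset.sum_range] at h
  simp only [Finset.sum_range, getD_ofFn, hA, mul_add, Finset.sum_add_distrib] at h
  rw [Finset.sum_comm (f := fun i j : Fin t => ind Hp i j * ((args j).size.2 * (args i).size.1))]
    at h
  simp only [ind_comm Hp _] at h
  have e : ∑ x : Fin t, ∑ y : Fin t, ind Hp x y * ((args x).size.2 * (args y).size.1) =
      ∑ i, ∑ k, ind Hp i k * ((args i).el.length * (args k).vl.length) := rfl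
  have e' : ∑ x : Fin t, ∑ y : Fin t, ind Hp y x * ((args x).size.2 * (args y).size.1) =
      ∑ i, ∑ k, ind Hp i k * ((args i).el.length * (args k).vl.length) := by
    rw [← e]
    exact Finset.sum_congr rfl fun x _ => Finset.sum_congr rfl fun y _ => by rw [ind_comm]
  omega

/-- A pattern triangle is found at each of its three edges. The division by 3 is exact, because
twice `pairTri` is an ordered triangle sum and hence divisible by 6. -/
theorem six_mul_pairTri {P : List (ℕ × ℕ)} {A : ℕ → ℕ → ℕ} (hP : IsEdgeList P (Finset.range t) A)
    (hA : ∀ i j : Fin t, A i j = ind Hp i j) (n : ℕ → ℕ) :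
    6 * (pairTri t P n / 3) = triSum (fun i : Fin t => n i) (ind Hp) Finset.univ := by
  have hadj : ∀ i ∈ Finset.range t, ∀ j ∈ Finset.range t, pairAdj P i j = A i j := by
    intro i hi j hj
    have h₁ := hP.count i hi j hj
    have h₂ : A i j ≤ 1 := by
      rw [Finset.mem_range] at hi hj
      rw [hA ⟨i, hi⟩ ⟨j, hj⟩]
      exact ind_le_one _ _ _
    unfold pairAdj
    split_ifs with h
    · have : 0 < P.count (i, j) + P.count (j, i) := by
        rcases h with h | h
        · exact Nat.add_pos_left (List.count_pos_iff.2 h) _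
        · exact Nat.add_pos_right _ (List.count_pos_iff.2 h)
      omega
    · push Not at h
      rw [List.count_eq_zero.2 h.1, List.count_eq_zero.2 h.2] at h₁
      exact h₁
  have hcomm : ∀ i j, pairAdj P i j = pairAdj P j i := fun i j => by
    unfold pairAdj; simp only [or_comm]
  have h := hP.two_mul_sum (φ := fun i j => n i * n j *
    ∑ k ∈ Finset.range t, pairAdj P i k * n k * pairAdj P k j) fun u v => by
      rw [mul_comm (n u)]
      congr 1
      refine Finset.sum_congr rfl fun k _ => ?_
      rw [hcomm u k, hcomm k v]; ring
  rw [← pairTri] at h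
  have h₂ : 2 * pairTri t P n = triSum n A (Finset.range t) := by
    rw [h, triSum]
    refine Finset.sum_congr rfl fun i hi => ?_
    simp only [Finset.mul_sum]
    rw [Finset.sum_comm]
    refine Finset.sum_congr rfl fun k hk => Finset.sum_congr rfl fun j hj => ?_
    rw [hadj i hi k hk, hadj k hk j hj]
    ring
  rw [triSum_range] at h₂
  rw [triSum_congr (A' := ind Hp) fun u _ v _ => hA u v] at h₂
  have h₃ := six_dvd_triSum (w := fun i : Fin t => n i) (ind_comm Hp) (ind_self Hp) Finset.univ
  omega

/-- The adjacency matrix of the complete pattern is `1 - [i = j]`. Expanding the products of these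
factors yields the power sums of `six_mul_joinTri`; the subtractions are the reason to work in `ℤ`.
-/
theorem joinTri_eq (n m : Fin t → ℕ) :
    6 * joinTri (List.ofFn fun i => (n i, m i)) =
      6 * (∑ i, ∑ k, ind (⊤ : SimpleGraph (Fin t)) i k * (m i * n k)) +
      triSum n (ind (⊤ : SimpleGraph (Fin t))) Finset.univ := by
  have h := (six_mul_joinTri (List.ofFn fun i => (n i, m i))).2
  have hi : ∀ i j : Fin t, (ind (⊤ : SimpleGraph (Fin t)) i j : ℤ) = 1 - if i = j then 1 else 0 := by
    intro i j
    by_cases h : i = j <;> simp [ind, h]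
  zify
  rw [h]
  simp only [sum_map_ofFn, triSum, Nat.cast_sum, Nat.cast_mul, hi]
  have e₁ : ∑ i, ∑ k, ((1 : ℤ) - if i = k then 1 else 0) * (m i * n k) =
      (∑ i, (m i : ℤ)) * ∑ k, (n k : ℤ) - ∑ i, (m i : ℤ) * n i := by
    simp only [sub_mul, one_mul, ite_mul, zero_mul, Finset.sum_sub_distrib, Finset.sum_ite_eq,
      Finset.mem_univ, if_true, Finset.sum_mul_sum]
  have e₂ : ∑ i, ∑ j, ∑ k, ((1 : ℤ) - if i = j then 1 else 0) * (1 - if j = k then 1 else 0) *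
      (1 - if i = k then 1 else 0) * (n i * n j * n k) =
      (∑ i, (n i : ℤ)) ^ 3 - 3 * (∑ i, (n i : ℤ)) * (∑ i, (n i : ℤ) ^ 2) +
        2 * ∑ i, (n i : ℤ) ^ 3 := by
    have e₃ : ∀ i j : Fin t, ∑ k, ((1 : ℤ) - if i = j then 1 else 0) *
        (1 - if j = k then 1 else 0) * (1 - if i = k then 1 else 0) * (n i * n j * n k) =
        n i * n j * (∑ k, (n k : ℤ)) - n i * n j ^ 2 - n i ^ 2 * n j +
        (if i = j then 2 * (n i : ℤ) ^ 3 - n i ^ 2 * ∑ k, (n k : ℤ) else 0) := by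
      intro i j
      by_cases hij : i = j
      · subst hij
        simp
        ring
      · simp only [if_neg hij, sub_zero, one_mul, add_zero]
        have : ∀ k, ((1 : ℤ) - if j = k then 1 else 0) * (1 - if i = k then 1 else 0) *
            (n i * n j * n k) = n i * n j * n k - (if j = k then (n i * n j * n k : ℤ) else 0) -
            (if i = k then (n i * n j * n k : ℤ) else 0) := by
          intro k
          by_cases hj : j = k
          · subst hj; simp [hij]
          · by_cases hi : i = k <;> simp [hi, hj]
        simp only [this, Finset.sum_sub_distrib, Finset.sum_ite_eq, Finset.mem_univ, if_true,
          ← Finset.mul_sum]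
        ring
    simp only [e₃, Finset.sum_add_distrib, Finset.sum_sub_distrib, Finset.sum_ite_eq,
      Finset.mem_univ, if_true, ← Finset.mul_sum, ← Finset.sum_mul]
    ring
  rw [e₁, e₂]
  ring

end blocks

/-- The new triangles consist of `x` and an old edge with both ends in `N`. The weights are general,
so that patterns are covered as well. -/
theorem triSum_inc {x : ℕ} {N : List ℕ} {e : GExpr} (h : (inc x N e).WellFormed) (w : ℕ → ℕ) :
    triSum w (ind (inc x N e).edges) (inc x N e).verts = triSum w (ind e.edges) e.verts +
      6 * (e.el.map fun p => if p.1 ∈ N ∧ p.2 ∈ N then w x * (w p.1 * w p.2) else 0).sum := by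
  obtain ⟨h₀, hx, hN, hN'⟩ := h
  have hA : ∀ u v, (inc x N e).edges.Adj u v ↔ e.edges.Adj u v ∨
      u ≠ v ∧ (u = x ∧ v ∈ N ∨ v = x ∧ u ∈ N) := by
    intro u v
    rw [edges, SimpleGraph.sup_adj, SimpleGraph.fromRel_adj]
  have h₁ : ∀ u ∈ e.verts, ∀ v ∈ e.verts, ind (inc x N e).edges u v = ind e.edges u v := by
    intro u hu v hv
    refine ind_congr ?_
    have h₁ : u ≠ x := fun h => hx (h ▸ hu)
    have h₂ : v ≠ x := fun h => hx (h ▸ hv)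
    rw [hA]; simp [h₁, h₂]
  have h₂ : ∀ u ∈ e.verts, ind (inc x N e).edges x u = if u ∈ N then 1 else 0 := by
    intro u hu
    have hne : x ≠ u := fun h => hx (h ▸ hu)
    have : (inc x N e).edges.Adj x u ↔ u ∈ N := by
      rw [hA]
      constructor
      · rintro (h | ⟨_, ⟨_, h⟩ | ⟨h, _⟩⟩)
        · exact absurd (h₀.adj_verts h) hx
        · exact h
        · exact absurd h.symm hne
      · exact fun h => Or.inr ⟨hne, Or.inl ⟨rfl, h⟩⟩
    unfold ind
    split_ifs <;> simp_all
  rw [verts, triSum_insert (ind_comm _) (ind_self _ x) hx, triSum_congr h₁]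
  have h₃ := h₀.isEdgeList.two_mul_sum
    (φ := fun u v => if u ∈ N ∧ v ∈ N then w x * (w u * w v) else 0) fun u v => by
      rw [mul_comm (w u)]; simp only [and_comm]
  have h₄ : ∑ u ∈ e.verts, ∑ v ∈ e.verts, ind (inc x N e).edges u v *
      (ind (inc x N e).edges x u * ind (inc x N e).edges x v * (w x * w u * w v)) =
      ∑ u ∈ e.verts, ∑ v ∈ e.verts, ind e.edges u v *
        if u ∈ N ∧ v ∈ N then w x * (w u * w v) else 0 := by
    refine Finset.sum_congr rfl fun u hu => Finset.sum_congr rfl fun v hv => ?_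
    rw [h₁ u hu v hv, h₂ u hu, h₂ v hv]
    by_cases hu' : u ∈ N <;> by_cases hv' : v ∈ N <;> simp [hu', hv']
    ring_nf
    simp
  rw [h₄, ← h₃]
  ring

theorem six_mul_wt {e : GExpr} (h : e.WellFormed) (h' : e.IsTd) (w : ℕ → ℕ) :
    6 * e.wt w = triSum w (ind e.edges) e.verts := by
  induction e with
  | empty => simp [wt, triSum, verts]
  | single v => exact h'.elim
  | union t args ih =>
    have h₁ := triSum_blocks (w := w) h.2.2 (ind_comm ⊥) (ind_self ⊥) (ind_mul_self ⊥)
      (ind_blockGraph (Hp := ⊥) (fun i u v => (h.2.1 i).adj_verts) h.2.2)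
    have h0 : ∀ i j : Fin t, ind (⊥ : SimpleGraph (Fin t)) i j = 0 := by simp [ind]
    rw [blockGraph_bot] at h₁
    simp only [h0, zero_mul, Finset.sum_const_zero, mul_zero, triSum, add_zero] at h₁
    rw [edges, verts, triSum, h₁, wt, List.sum_ofFn, Finset.mul_sum]
    exact Finset.sum_congr rfl fun i _ => ih i (h.2.1 i) (h' i)
  | join t args ih => exact h'.elim
  | inc x N e ih => rw [triSum_inc h, ← ih h.1 h', wt]; ring
  | substSmall t E args ih => exact h'.elim
  | substTd t H args _ ih => exact h'.elim

/-- The matrix is defined by the multiplicities themselves, so that it is a function on `ℕ`; its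
agreement with the pattern graph is `smallPattern_count`. -/
theorem smallPattern_isEdgeList {t : ℕ} (E : List (Fin t × Fin t)) :
    IsEdgeList (E.map fun p => ((p.1 : ℕ), (p.2 : ℕ))) (Finset.range t) fun i j =>
      (E.map fun p => ((p.1 : ℕ), (p.2 : ℕ))).count (i, j) +
      (E.map fun p => ((p.1 : ℕ), (p.2 : ℕ))).count (j, i) := by
  refine ⟨fun p hp => ?_, fun u _ v _ => rfl⟩
  obtain ⟨q, _, rfl⟩ := List.mem_map.1 hp
  simp

/-- The summands of `triSum_blockGraph` are matched one by one: single blocks by induction, pairs of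
blocks by `crossTri_eq`, triples by `six_mul_pairTri` or `six_mul_wt`; `joinTri_eq` treats pairs and
triples of a join together. -/
theorem six_mul_tr {e : GExpr} (h : e.WellFormed) :
    6 * e.tr 1 = triSum 1 (ind e.edges) e.verts := by
  induction e with
  | empty => simp [tr, triSum, verts]
  | single v => simp [tr, triSum, verts, ind, edges]
  | union t args ih =>
    have h₁ := triSum_blockGraph (Hp := ⊥) h.2.1 h.2.2
    have h0 : ∀ i j : Fin t, ind (⊥ : SimpleGraph (Fin t)) i j = 0 := by simp [ind]
    rw [blockGraph_bot] at h₁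
    rw [edges, verts, h₁, tr, List.sum_ofFn, Finset.mul_sum]
    simp only [h0, zero_mul, Finset.sum_const_zero, mul_zero, triSum, add_zero]
    exact Finset.sum_congr rfl fun i _ => ih i (h.2.1 i)
  | join t args ih =>
    have h₁ := triSum_blockGraph (Hp := ⊤) h.2.1 h.2.2
    have h₂ := joinTri_eq (fun i => (args i).vl.length) fun i => (args i).el.length
    rw [edges, verts, ← blockGraph, h₁, tr, List.sum_ofFn, mul_add, Finset.mul_sum, add_assoc, ← h₂]
    congr 1
    exact Finset.sum_congr rfl fun i _ => ih i (h.2.1 i)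
  | inc x N e ih =>
    rw [triSum_inc h, ← ih h.1, tr]
    simp
    ring
  | substSmall t E args ih =>
    have h₁ := triSum_blockGraph (Hp := SimpleGraph.fromRel fun i j => (i, j) ∈ E) h.2.1 h.2.2
    have h₂ := crossTri_eq (args := args) (smallPattern_isEdgeList E) (smallPattern_count h.1)
    have h₃ := six_mul_pairTri (smallPattern_isEdgeList E) (smallPattern_count h.1)
      (blockSize args)
    simp only [blockSize_eq] at h₃
    rw [edges, verts, ← blockGraph, h₁, tr, List.sum_ofFn, mul_add, Finset.mul_sum, mul_add, h₂, h₃,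
      ← add_assoc]
    congr 2
    exact Finset.sum_congr rfl fun i _ => ih i (h.2.1 i)
  | substTd t H args ihH ih =>
    have hH := h.1.1.isEdgeList
    rw [h.1.2.2] at hH
    have hA : ∀ i j : Fin t, ind H.edges i j = ind (H.edges.comap Fin.val) i j :=
      fun i j => ind_congr Iff.rfl
    have h₁ := triSum_blockGraph (Hp := H.edges.comap Fin.val) h.2.1 h.2.2
    have h₂ := crossTri_eq (args := args) hH hA
    have h₃ := six_mul_wt h.1.1 h.1.2.1 (blockSize args)
    rw [h.1.2.2, triSum_range, triSum_congr fun u _ v _ => hA u v] at h₃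
    simp only [blockSize_eq] at h₃
    rw [edges, verts, ← blockGraph, h₁, tr, List.sum_ofFn, mul_add, Finset.mul_sum, mul_add, h₂, h₃,
      ← add_assoc]
    congr 2
    exact Finset.sum_congr rfl fun i _ => ih i (h.2.1 i)

end GExpr

/-! ### Triangles of finite graphs -/

/-- The map from ordered triangles to their vertex sets has fibres of size six, the orderings of
three distinct vertices. -/
theorem six_mul_card_cliqueFinset {V : Type*} [Fintype V] [DecidableEq V] (G : SimpleGraph V)
    [DecidableRel G.Adj] : 6 * (G.cliqueFinset 3).card = triSum 1 (ind G) Finset.univ := by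
  have h₁ : triSum 1 (ind G) Finset.univ =
      ((Finset.univ : Finset (V × V × V)).filter fun p =>
        G.Adj p.1 p.2.1 ∧ G.Adj p.2.1 p.2.2 ∧ G.Adj p.1 p.2.2).card := by
    rw [Finset.card_filter, Fintype.sum_prod_type, triSum]
    refine Finset.sum_congr rfl fun a _ => ?_
    rw [Fintype.sum_prod_type]
    refine Finset.sum_congr rfl fun b _ => Finset.sum_congr rfl fun c _ => ?_
    unfold ind
    split_ifs <;> simp_all
  rw [h₁, Finset.card_eq_sum_card_fiberwise (f := fun p : V × V × V =>
    ({p.1, p.2.1, p.2.2} : Finset V))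
    (t := G.cliqueFinset 3)]
  · rw [Finset.sum_const_nat (m := 6)]
    · ring
    intro s hs
    rw [SimpleGraph.mem_cliqueFinset_iff, SimpleGraph.is3Clique_iff] at hs
    obtain ⟨a, b, c, hab, hac, hbc, rfl⟩ := hs
    have e : (((Finset.univ : Finset (V × V × V)).filter fun p =>
        G.Adj p.1 p.2.1 ∧ G.Adj p.2.1 p.2.2 ∧ G.Adj p.1 p.2.2).filter
        fun p => ({p.1, p.2.1, p.2.2} : Finset V) = {a, b, c}) =
        {(a, b, c), (a, c, b), (b, a, c), (b, c, a), (c, a, b), (c, b, a)} := by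
      ext ⟨x, y, z⟩
      simp only [Finset.mem_filter, Finset.mem_univ, true_and, Finset.mem_insert,
        Finset.mem_singleton, Prod.mk.injEq]
      constructor
      · rintro ⟨⟨hxy, hyz, hxz⟩, h⟩
        have hx : x ∈ ({a, b, c} : Finset V) := h ▸ by simp
        have hy : y ∈ ({a, b, c} : Finset V) := h ▸ by simp
        have hz : z ∈ ({a, b, c} : Finset V) := h ▸ by simp
        simp only [Finset.mem_insert, Finset.mem_singleton] at hx hy hz
        have := hxy.ne
        have := hyz.ne
        have := hxz.ne
        rcases hx with rfl | rfl | rfl <;> rcases hy with rfl | rfl | rfl <;>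
          rcases hz with rfl | rfl | rfl <;> simp_all
      · have hba := hab.symm
        have hca := hac.symm
        have hcb := hbc.symm
        rintro (⟨rfl, rfl, rfl⟩ | ⟨rfl, rfl, rfl⟩ | ⟨rfl, rfl, rfl⟩ | ⟨rfl, rfl, rfl⟩ |
          ⟨rfl, rfl, rfl⟩ | ⟨rfl, rfl, rfl⟩) <;> refine ⟨⟨by assumption, by assumption,
          by assumption⟩, ?_⟩ <;> ext w <;> simp only [Finset.mem_insert, Finset.mem_singleton] <;>
          tauto
    rw [e]
    have h₁ := hab.ne
    have h₂ := hac.ne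
    have h₃ := hbc.ne
    have h₁' := hab.ne'
    have h₂' := hac.ne'
    have h₃' := hbc.ne'
    simp [Finset.card_insert_of_notMem, *]
  · rintro ⟨a, b, c⟩ h
    simp only [Finset.coe_filter, Finset.mem_univ, true_and, Set.mem_ofPred_eq] at h
    rw [SimpleGraph.coe_cliqueFinset, SimpleGraph.mem_cliqueSet_iff, SimpleGraph.is3Clique_iff]
    exact ⟨a, b, c, h.1, h.2.2, h.2.1, rfl⟩

theorem two_mul_card_edgeFinset {V : Type*} [Fintype V] [DecidableEq V] (G : SimpleGraph V)
    [DecidableRel G.Adj] : 2 * G.edgeFinset.card = edgeSum 1 (ind G) Finset.univ := by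
  rw [← G.sum_degrees_eq_twice_card_edges, edgeSum]
  refine Finset.sum_congr rfl fun u _ => ?_
  rw [← SimpleGraph.card_neighborFinset_eq_degree, SimpleGraph.neighborFinset_eq_filter,
    Finset.card_filter]
  refine Finset.sum_congr rfl fun v _ => ?_
  unfold ind
  split_ifs <;> simp_all

namespace GExpr

/-! ### Invariance under renaming of the vertices. -/

section iso

variable {e : GExpr} {V : Type*} {G : SimpleGraph V} (φ : e.val ≃g G)

theorem ind_iso (u v : (e.verts : Set ℕ)) : ind G (φ u) (φ v) = ind e.edges u v :=
  ind_congr (φ.map_adj_iff.trans (by simp [GExpr.val]))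

variable [Fintype V]

theorem sum_comp_iso (F : V → ℕ) (F' : ℕ → ℕ)
    (hF : ∀ u : (e.verts : Set ℕ), F (φ u) = F' u) : ∑ v, F v = ∑ u ∈ e.verts, F' u := by
  rw [← Finset.sum_coe_sort e.verts]
  exact (Fintype.sum_equiv φ.toEquiv _ _ fun u => (hF u).symm).symm

variable (h : e.WellFormed)

include h φ

theorem card_eq_of_iso : Fintype.card V = e.vl.length := by
  rw [h.length_vl, Finset.card_eq_sum_ones, ← sum_comp_iso φ (fun _ => 1) _ fun _ => rfl]
  simp

variable [DecidableEq V] [DecidableRel G.Adj]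

theorem card_edgeFinset_eq_of_iso : G.edgeFinset.card = e.el.length := by
  have h₁ := two_mul_card_edgeFinset G
  have h₂ := h.isEdgeList.two_mul_length
  have h₃ : edgeSum 1 (ind G) Finset.univ = edgeSum 1 (ind e.edges) e.verts :=
    sum_comp_iso φ _ _ fun u => sum_comp_iso φ _ _ fun v => by rw [ind_iso]; rfl
  omega

theorem card_cliqueFinset_eq_of_iso : (G.cliqueFinset 3).card = e.tr 1 := by
  have h₁ := six_mul_card_cliqueFinset G
  have h₂ := six_mul_tr h
  have h₃ : triSum 1 (ind G) Finset.univ = triSum 1 (ind e.edges) e.verts :=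
    sum_comp_iso φ _ _ fun u => sum_comp_iso φ _ _ fun v => sum_comp_iso φ _ _ fun w => by
      rw [ind_iso, ind_iso, ind_iso]; rfl
  omega

end iso

end GExpr

/-! ### Sizes and costs of expressions -/

/-- The number of nonempty blocks. -/
def nonemptyCount (d : List (ℕ × ℕ)) : ℕ := (d.map fun a => 1 - (1 - a.1)).sum

theorem length_flatten_ofFn {α : Type*} {t : ℕ} (f : Fin t → List α) :
    (List.ofFn f).flatten.length = ∑ i, (f i).length := by
  rw [List.length_flatten, sum_map_ofFn]

namespace GExpr

/-- The edges of a pattern between vertices of nonzero weight. -/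
def fel (w : ℕ → ℕ) (H : GExpr) : List (ℕ × ℕ) := H.el.filter fun p => w p.1 * w p.2 ≠ 0

/-- The cost of the evaluation of a tree-depth expression with weights. -/
def pct (w : ℕ → ℕ) : GExpr → ℕ
  | union t args => (List.ofFn fun i => (args i).pct w).sum + (t + 1)
  | inc x N e => e.pct w + (1 + N.length + if w x = 0 then 0 else (e.fel w).length)
  | _ => 1

/-- The number of nonempty arguments. -/
def argCount {t : ℕ} (args : Fin t → GExpr) : ℕ := nonemptyCount (List.ofFn fun i => (args i).size)

/-- The cost of the evaluation of an expression; `M r` is the cost of the multiplication of `r × r`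
matrices. -/
def ct (M : ℕ → ℕ) (f : ℕ) : GExpr → ℕ
  | empty => 1
  | single _ => 1
  | union t args => (List.ofFn fun i => (args i).ct M f).sum + (t + 1)
  | join t args => (List.ofFn fun i => (args i).ct M f).sum +
      (t + 1 + f * (joinEdges (List.ofFn fun i => (args i).vl)).length)
  | inc _ N e => e.ct M f + (1 + N.length + f * e.el.length)
  | substSmall t E args => (List.ofFn fun i => (args i).ct M f).sum +
      (t + 1 + E.length + M (argCount args) + f * (blockEdges (E.map fun p => ((p.1 : ℕ), (p.2 : ℕ)))
        (List.ofFn fun i => (args i).vl)).length)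
  | substTd t H args => (List.ofFn fun i => (args i).ct M f).sum +
      (t + 1 + H.code.length + H.pct (blockSize args) +
        f * (blockEdges H.el (List.ofFn fun i => (args i).vl)).length)

/-- The total cost of the matrix multiplications. -/
def matCost (M : ℕ → ℕ) : GExpr → ℕ
  | empty => 0
  | single _ => 0
  | union _ args => (List.ofFn fun i => (args i).matCost M).sum
  | join _ args => (List.ofFn fun i => (args i).matCost M).sum
  | inc _ _ e => e.matCost M
  | substSmall _ _ args => (List.ofFn fun i => (args i).matCost M).sum + M (argCount args)
  | substTd _ _ args => (List.ofFn fun i => (args i).matCost M).sum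

/-- The total number of nonempty arguments of substitutions, where at least two are present. -/
def branching : GExpr → ℕ
  | empty => 0
  | single _ => 0
  | union _ args => (List.ofFn fun i => (args i).branching).sum
  | join _ args => (List.ofFn fun i => (args i).branching).sum
  | inc _ _ e => e.branching
  | substSmall _ _ args => (List.ofFn fun i => (args i).branching).sum +
      if 2 ≤ argCount args then argCount args else 0
  | substTd _ _ args => (List.ofFn fun i => (args i).branching).sum +
      if 2 ≤ argCount args then argCount args else 0

/-- By truncation, `1 - (1 - x)` is 0 for `x = 0` and 1 otherwise. The programs use the same term as
a test for being nonzero. -/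
theorem argCount_eq {t : ℕ} (args : Fin t → GExpr) :
    argCount args = ∑ i, (1 - (1 - (args i).vl.length)) := by
  rw [argCount, nonemptyCount, sum_map_ofFn]; rfl

theorem length_vl_le (e : GExpr) : e.vl.length ≤ e.code.length := by
  induction e with
  | empty => simp [vl, code]
  | single v => simp [vl, code]
  | union t args ih =>
    simp only [vl, code, List.length_append, length_flatten_ofFn]
    exact (Finset.sum_le_sum fun i _ => ih i).trans (Nat.le_add_right _ _)
  | join t args ih =>
    simp only [vl, code, List.length_append, length_flatten_ofFn]
    exact (Finset.sum_le_sum fun i _ => ih i).trans (Nat.le_add_right _ _)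
  | inc x N e ih => simp [vl, code]; omega
  | substSmall t E args ih =>
    simp only [vl, code, List.length_append, length_flatten_ofFn, add_assoc]
    exact (Finset.sum_le_sum fun i _ => ih i).trans (Nat.le_add_right _ _)
  | substTd t H args _ ih =>
    simp only [vl, code, List.length_append, length_flatten_ofFn, add_assoc]
    exact (Finset.sum_le_sum fun i _ => ih i).trans (Nat.le_add_right _ _)

theorem code_length_pos (e : GExpr) : 1 ≤ e.code.length := by
  cases e <;> simp [code] <;> omega

theorem le_sum_code {t : ℕ} (args : Fin t → GExpr) : t ≤ ∑ i, (args i).code.length := by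
  calc t = ∑ _i : Fin t, 1 := by simp
    _ ≤ _ := Finset.sum_le_sum fun i _ => (args i).code_length_pos

/-- This and the cubic bound for `tr` only serve to show that the numbers of the computation fit
into a word. -/
theorem WellFormed.length_el_le {e : GExpr} (h : e.WellFormed) :
    e.el.length ≤ e.vl.length ^ 2 := by
  have h₁ := h.isEdgeList.two_mul_length
  have h₂ : edgeSum 1 (ind e.edges) e.verts ≤ ∑ u ∈ e.verts, ∑ v ∈ e.verts, 1 :=
    Finset.sum_le_sum fun u _ => Finset.sum_le_sum fun v _ => by simpa using ind_le_one _ _ _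
  simp only [Finset.sum_const, smul_eq_mul, mul_one, ← h.length_vl] at h₂
  nlinarith

theorem WellFormed.tr_le {e : GExpr} (h : e.WellFormed) : e.tr 1 ≤ e.vl.length ^ 3 := by
  have h₁ := six_mul_tr h
  have h₂ : triSum 1 (ind e.edges) e.verts ≤ ∑ u ∈ e.verts, ∑ v ∈ e.verts, ∑ w ∈ e.verts, 1 :=
    Finset.sum_le_sum fun u _ => Finset.sum_le_sum fun v _ => Finset.sum_le_sum fun w _ => by
      have h₁ := ind_le_one e.edges u v
      have h₂ := ind_le_one e.edges v w
      have h₃ := ind_le_one e.edges u w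
      simpa using Nat.mul_le_mul (Nat.mul_le_mul h₁ h₂) h₃
  simp only [Finset.sum_const, smul_eq_mul, mul_one, ← h.length_vl] at h₂
  nlinarith

theorem tr_le_tr_one {f : ℕ} (hf : f ≤ 1) (e : GExpr) : e.tr f ≤ e.tr 1 := by
  have hs : ∀ {t : ℕ} {args : Fin t → GExpr}, (∀ i, (args i).tr f ≤ (args i).tr 1) →
      (List.ofFn fun i => (args i).tr f).sum ≤ (List.ofFn fun i => (args i).tr 1).sum := by
    intro t args h
    rw [List.sum_ofFn, List.sum_ofFn]
    exact Finset.sum_le_sum fun i _ => h i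
  induction e with
  | empty => exact le_rfl
  | single v => exact le_rfl
  | union t args ih => exact hs ih
  | join t args ih => exact Nat.add_le_add_right (hs ih) _
  | inc x N e ih => exact Nat.add_le_add ih (Nat.mul_le_mul_right _ hf)
  | substSmall t E args ih => exact Nat.add_le_add_right (hs ih) _
  | substTd t H args _ ih => exact Nat.add_le_add_right (hs ih) _

theorem fel_inc (w : ℕ → ℕ) (x : ℕ) (N : List ℕ) (e : GExpr) :
    (inc x N e).fel w = e.fel w ++ (N.filter fun v => w x * w v ≠ 0).map fun v => (x, v) := by
  simp only [fel, el, List.filter_append, List.filter_map]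
  rfl

theorem fel_union (w : ℕ → ℕ) {t : ℕ} (args : Fin t → GExpr) :
    (union t args).fel w = (List.ofFn fun i => (args i).fel w).flatten := by
  simp only [fel, el, List.filter_flatten, List.map_ofFn]
  rfl

/-- An edge of nonzero weight is scanned only by the increments above it. The additional 1 on the
left, summed over the arguments of a union, pays for taking them from the stack. -/
theorem IsTd.pct_le {e : GExpr} (h : e.IsTd) (w : ℕ → ℕ) :
    e.pct w + 1 ≤ 3 * e.code.length + e.incDepth * (e.fel w).length := by
  induction e with
  | empty => simp [pct, code]; omega
  | single v => exact h.elim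
  | union t args ih =>
    have h₁ : ∑ i, ((args i).pct w + 1) ≤
        ∑ i, (3 * (args i).code.length + (union t args).incDepth * ((args i).fel w).length) := by
      refine Finset.sum_le_sum fun i _ => (ih i (h i)).trans ?_
      have : (args i).incDepth ≤ (union t args).incDepth :=
        Finset.le_sup (f := fun i => (args i).incDepth) (Finset.mem_univ i)
      gcongr
    rw [fel_union]
    simp only [Finset.sum_add_distrib, ← Finset.mul_sum, Finset.sum_const, Finset.card_univ,
      Fintype.card_fin, smul_eq_mul, mul_one] at h₁
    simp only [pct, code, List.sum_ofFn, List.length_append, length_flatten_ofFn, List.length_cons,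
      List.length_nil]
    omega
  | join t args ih => exact h.elim
  | inc x N e ih =>
    have h₁ := ih h
    rw [fel_inc]
    simp only [pct, code, incDepth, List.length_append, List.length_cons, List.length_nil]
    split_ifs <;> nlinarith
  | substSmall t E args ih => exact h.elim
  | substTd t H args _ ih => exact h.elim

theorem length_blockEdges {t : ℕ} (P : List (ℕ × ℕ)) (args : Fin t → GExpr) :
    (blockEdges P (List.ofFn fun i => (args i).vl)).length =
      (P.map fun p => blockSize args p.1 * blockSize args p.2).sum := by
  have : ∀ i, ((List.ofFn fun i => (args i).vl).getD i []).length = blockSize args i := by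
    intro i
    by_cases hi : i < t
    · have h₁ := getD_ofFn (fun i => (args i).vl) [] ⟨i, hi⟩
      have h₂ := blockSize_eq (args := args) ⟨i, hi⟩
      simp only at h₁ h₂
      rw [h₁, h₂]
    · rw [getD_ofFn_of_le _ _ (not_lt.1 hi), blockSize_of_le (not_lt.1 hi)]; rfl
  rw [blockEdges, List.length_flatMap]
  simp only [List.length_product, this]

theorem length_filter_le_sum (P : List (ℕ × ℕ)) (w : ℕ → ℕ) :
    (P.filter fun p => w p.1 * w p.2 ≠ 0).length ≤ (P.map fun p => w p.1 * w p.2).sum := by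
  induction P with
  | nil => simp
  | cons p P ih =>
    rw [List.filter_cons, List.map_cons, List.sum_cons]
    split_ifs with h
    · have := Nat.pos_of_ne_zero (of_decide_eq_true h)
      rw [List.length_cons]
      omega
    · exact ih.trans (Nat.le_add_left _ _)

/-- A pattern edge between nonempty blocks yields at least one edge of the graph. Therefore work on
pattern edges can be charged to `m`. -/
theorem length_fel_le {t : ℕ} (H : GExpr) (args : Fin t → GExpr) :
    (H.fel (blockSize args)).length ≤
      (blockEdges H.el (List.ofFn fun i => (args i).vl)).length := by
  rw [length_blockEdges]
  exact length_filter_le_sum _ _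

/-! ### The cost of the evaluation in terms of code, edges and matrix products. -/

section bounds

variable {t : ℕ} {args : Fin t → GExpr} {M : ℕ → ℕ} {f l d : ℕ}

/-- The surplus 1 of each argument adds up to `t`, the cost of collecting `t` operands. -/
theorem sum_ct_le (hd : ∀ i, (args i).incDepth ≤ d)
    (h : ∀ i, (args i).ct M f + 1 ≤ 5 * (args i).code.length + (args i).matCost M +
      ((args i).incDepth + 1) * (f * (args i).el.length) + l * (args i).el.length) :
    (List.ofFn fun i => (args i).ct M f).sum + t ≤
      5 * (List.ofFn fun i => (args i).code).flatten.length +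
      (List.ofFn fun i => (args i).matCost M).sum +
      (d + 1) * (f * (List.ofFn fun i => (args i).el).flatten.length) +
      l * (List.ofFn fun i => (args i).el).flatten.length := by
  have h₁ : ∑ i, ((args i).ct M f + 1) ≤ ∑ i, (5 * (args i).code.length + (args i).matCost M +
      (d + 1) * (f * (args i).el.length) + l * (args i).el.length) := by
    refine Finset.sum_le_sum fun i _ => (h i).trans ?_
    have := hd i
    gcongr
  simp only [Finset.sum_add_distrib, ← Finset.mul_sum, Finset.sum_const, Finset.card_univ,
    Fintype.card_fin, smul_eq_mul, mul_one] at h₁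
  simpa only [List.sum_ofFn, length_flatten_ofFn] using h₁

theorem incDepth_le_sup (i : Fin t) :
    (args i).incDepth ≤ Finset.univ.sup fun i => (args i).incDepth :=
  Finset.le_sup (f := fun i => (args i).incDepth) (Finset.mem_univ i)

end bounds

/-- If `f = 1`, an edge is written once and scanned at most once by each increment above it, which
explains `incDepth + 1`. The scans inside a pattern are charged, `l` times, to the edges that its
substitution creates. -/
theorem ct_le {e : GExpr} (hw : e.WellFormed) {h l : ℕ} (hp : e.PatternsBounded h l) (M : ℕ → ℕ)
    (f : ℕ) : e.ct M f + 1 ≤ 5 * e.code.length + e.matCost M +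
      (e.incDepth + 1) * (f * e.el.length) + l * e.el.length := by
  induction e with
  | empty => simp [ct, code]; omega
  | single v => simp [ct, code]; omega
  | union t args ih =>
    have h₁ := sum_ct_le incDepth_le_sup fun i => ih i (hw.2.1 i) (hp i)
    simp only [ct, code, matCost, incDepth, el, List.length_append, List.length_cons,
      List.length_nil]
    omega
  | join t args ih =>
    have h₁ := sum_ct_le incDepth_le_sup fun i => ih i (hw.2.1 i) (hp i)
    simp only [ct, code, matCost, incDepth, el, List.length_append, List.length_cons,
      List.length_nil, mul_add]
    have h₂ := Nat.le_mul_of_pos_left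
      (f * (joinEdges (List.ofFn fun i => (args i).vl)).length)
      (Nat.succ_pos (Finset.univ.sup fun i => (args i).incDepth))
    simp only [Nat.succ_eq_add_one] at h₂
    omega
  | inc x N e ih =>
    have h₁ := ih hw.1 hp
    simp only [ct, code, matCost, incDepth, el, List.length_append, List.length_cons,
      List.length_nil, List.length_map, mul_add, add_mul, one_mul] at h₁ ⊢
    omega
  | substSmall t E args ih =>
    have h₁ := sum_ct_le incDepth_le_sup fun i => ih i (hw.2.1 i) (hp.2 i)
    have h₂ : (E.flatMap fun p => [(p.1 : ℕ), (p.2 : ℕ)]).length = 2 * E.length := by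
      simp [List.length_flatMap, mul_comm]
    simp only [ct, code, matCost, incDepth, el, List.length_append, List.length_cons,
      List.length_nil, h₂, mul_add]
    have h₃ := Nat.le_mul_of_pos_left
      (f * (blockEdges (E.map fun p => ((p.1 : ℕ), (p.2 : ℕ)))
        (List.ofFn fun i => (args i).vl)).length)
      (Nat.succ_pos (Finset.univ.sup fun i => (args i).incDepth))
    simp only [Nat.succ_eq_add_one] at h₃
    omega
  | substTd t H args _ ih =>
    have h₁ := sum_ct_le incDepth_le_sup fun i => ih i (hw.2.1 i) (hp.2 i)
    have h₂ := hw.1.2.1.pct_le (blockSize args)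
    have h₃ : H.incDepth * (H.fel (blockSize args)).length ≤
        l * (blockEdges H.el (List.ofFn fun i => (args i).vl)).length :=
      Nat.mul_le_mul hp.1 (length_fel_le H args)
    simp only [ct, code, matCost, incDepth, el, List.length_append, List.length_cons,
      List.length_nil, mul_add]
    have h₄ := Nat.le_mul_of_pos_left
      (f * (blockEdges H.el (List.ofFn fun i => (args i).vl)).length)
      (Nat.succ_pos (Finset.univ.sup fun i => (args i).incDepth))
    simp only [Nat.succ_eq_add_one] at h₄
    omega

/-! ### Amortisation of the numbers of nonempty arguments. -/

section branching

variable {t : ℕ} {args : Fin t → GExpr}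

theorem sum_branching_le
    (h : ∀ i, (args i).branching + 2 * (1 - (1 - (args i).vl.length)) ≤ 2 * (args i).vl.length) :
    (List.ofFn fun i => (args i).branching).sum + 2 * argCount args ≤
      2 * (List.ofFn fun i => (args i).vl).flatten.length := by
  have h₁ := Finset.sum_le_sum fun i (_ : i ∈ Finset.univ) => h i
  simp only [Finset.sum_add_distrib, ← Finset.mul_sum] at h₁
  rwa [argCount_eq, List.sum_ofFn, length_flatten_ofFn]

theorem argCount_pos (h : (List.ofFn fun i => (args i).vl).flatten.length ≠ 0) :
    1 ≤ argCount args := by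
  by_contra h'
  rw [length_flatten_ofFn] at h
  refine h (Finset.sum_eq_zero fun i _ => ?_)
  rw [argCount_eq] at h'
  have := (Finset.sum_eq_zero_iff.1 (Nat.lt_one_iff.1 (not_le.1 h'))) i (Finset.mem_univ i)
  omega

end branching

/-- A nonempty expression keeps a credit of 2. If `r ≥ 2` nonempty arguments meet in a substitution,
their credits give `2 * r`, of which `r` pays for the substitution and `r ≥ 2` remains as the new
credit. For `r = 1` nothing is charged and the credit is passed on. -/
theorem branching_le (e : GExpr) :
    e.branching + 2 * (1 - (1 - e.vl.length)) ≤ 2 * e.vl.length := by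
  induction e with
  | empty => simp [branching, vl]
  | single v => simp [branching, vl]
  | union t args ih =>
    have h₁ := sum_branching_le ih
    have h₂ := argCount_pos (args := args)
    simp only [branching, vl]
    omega
  | join t args ih =>
    have h₁ := sum_branching_le ih
    have h₂ := argCount_pos (args := args)
    simp only [branching, vl]
    omega
  | inc x N e ih =>
    simp only [branching, vl, List.length_append, List.length_singleton]
    omega
  | substSmall t E args ih =>
    have h₁ := sum_branching_le ih
    have h₂ := argCount_pos (args := args)
    simp only [branching, vl]
    split_ifs <;> omega
  | substTd t H args _ ih =>
    have h₁ := sum_branching_le ih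
    have h₂ := argCount_pos (args := args)
    simp only [branching, vl]
    split_ifs <;> omega

theorem argCount_le {t : ℕ} (args : Fin t → GExpr) : argCount args ≤ t := by
  rw [argCount_eq]
  calc _ ≤ ∑ _i : Fin t, 1 := Finset.sum_le_sum fun i _ => Nat.sub_le _ _
    _ = t := by simp

/-- The bound for `M` has a part proportional to `r`, which is charged to `branching`, and a
constant part, which is charged to the code of the operation. The constant covers the products with
`r ≤ 1`. -/
theorem matCost_le {h l : ℕ} {M : ℕ → ℕ} {K D : ℝ} (hK : 0 ≤ K)
    (hM : ∀ r ≤ h, (M r : ℝ) ≤ K * (D * (if 2 ≤ r then r else 0 : ℕ) + 1)) (hD : 0 ≤ D)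
    {e : GExpr} (hp : e.PatternsBounded h l) :
    (e.matCost M : ℝ) ≤ K * (D * e.branching + e.code.length) := by
  have hs : ∀ {t : ℕ} {args : Fin t → GExpr}, (∀ i, ((args i).matCost M : ℝ) ≤
      K * (D * (args i).branching + (args i).code.length)) →
      (((List.ofFn fun i => (args i).matCost M).sum : ℕ) : ℝ) ≤
      K * (D * (((List.ofFn fun i => (args i).branching).sum : ℕ) : ℝ) +
        (((List.ofFn fun i => (args i).code).flatten.length : ℕ) : ℝ)) := by
    intro t args h
    simp only [List.sum_ofFn, length_flatten_ofFn, Nat.cast_sum, Finset.mul_sum,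
      ← Finset.sum_add_distrib]
    exact Finset.sum_le_sum fun i _ => h i
  induction e with
  | empty => simp only [matCost, branching, code]; push_cast; simpa using hK
  | single v => simp only [matCost, branching, code]; push_cast; simpa using by positivity
  | union t args ih =>
    have h₁ := hs fun i => ih i (hp i)
    simp only [matCost, branching, code, List.length_append, Nat.cast_add]
    have h₃ : 0 ≤ K * ([2, t].length : ℝ) := by positivity
    linarith
  | join t args ih =>
    have h₁ := hs fun i => ih i (hp i)
    simp only [matCost, branching, code, List.length_append, Nat.cast_add]
    have h₃ : 0 ≤ K * ([3, t].length : ℝ) := by positivity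
    linarith
  | inc x N e ih =>
    have := ih hp
    simp only [matCost, branching, code, List.length_append, Nat.cast_add]
    have h₂ : 0 ≤ K * (([4, x, N.length].length : ℝ) + N.length) := by positivity
    linarith
  | substSmall t E args ih =>
    have h₁ := hs fun i => ih i (hp.2 i)
    have h₂ := hM _ ((argCount_le args).trans hp.1)
    simp only [matCost, branching, code, List.length_append, Nat.cast_add]
    have h₃ : K ≤ K * ([5, t, E.length].length : ℝ) := by simp; linarith
    have h₄ : 0 ≤ K * ((E.flatMap fun p => [(p.1 : ℕ), (p.2 : ℕ)]).length : ℝ) := by positivity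
    linarith
  | substTd t H args _ ih =>
    have h₁ := hs fun i => ih i (hp.2 i)
    simp only [matCost, branching, code, List.length_append, Nat.cast_add]
    have h₃ : 0 ≤ K * (([6, t, H.code.length].length : ℝ) + (H.code.length : ℝ)) := by positivity
    have h₄ : 0 ≤ K * (D * ((if 2 ≤ argCount args then argCount args else 0 : ℕ) : ℝ)) := by
      positivity
    linarith

/-! ### Reduced expressions -/

theorem vl_length_pos {e : GExpr} (h : e.verts.Nonempty) : 1 ≤ e.vl.length := by
  obtain ⟨v, hv⟩ := h
  exact List.length_pos_of_mem ((mem_vl e v).2 hv)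

/-- All operations with several arguments have nonempty ones. This settles increments, whose operand
may be empty even in a reduced expression. -/
theorem Reduced.eq_empty {e : GExpr} (h : e.Reduced) (hw : e.WellFormed)
    (h0 : e.vl.length = 0) : e = empty := by
  have key : ∀ {t : ℕ} {args : Fin t → GExpr}, 2 ≤ t → (∀ i, (args i).verts.Nonempty) →
      (List.ofFn fun i => (args i).vl).flatten.length ≠ 0 := by
    intro t args ht hn h
    rw [length_flatten_ofFn, Finset.sum_eq_zero_iff] at h
    have := h ⟨0, by omega⟩ (Finset.mem_univ _)
    have := vl_length_pos (hn ⟨0, by omega⟩)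
    omega
  cases e with
  | empty => rfl
  | single v => simp [vl] at h0
  | union t args => exact absurd h0 (key hw.1 fun i => (h i).2)
  | join t args => exact absurd h0 (key hw.1 fun i => (h i).2)
  | inc x N e => simp [vl] at h0
  | substSmall t E args => exact absurd h0 (key h.1 fun i => (h.2 i).2)
  | substTd t H args => exact absurd h0 (key h.1 fun i => (h.2.2 i).2)

/-- The surplus 3 makes unions work: at least two arguments provide 6, enough for the two numbers of
the union and the surplus of the result. -/
theorem IsTd.length_code_le {e : GExpr} (h : e.IsTd) (hr : e.Reduced) (hw : e.WellFormed)
    (hn : 1 ≤ e.vl.length) : e.code.length + 3 ≤ 7 * e.vl.length + e.el.length := by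
  induction e with
  | empty => simp [vl] at hn
  | single v => exact h.elim
  | union t args ih =>
    have h₁ : ∑ i, ((args i).code.length + 3) ≤
        ∑ i, (7 * (args i).vl.length + (args i).el.length) :=
      Finset.sum_le_sum fun i _ => ih i (h i) (hr i).1 (hw.2.1 i) (vl_length_pos (hr i).2)
    have := hw.1
    simp only [Finset.sum_add_distrib, ← Finset.mul_sum, Finset.sum_const, Finset.card_univ,
      Fintype.card_fin, smul_eq_mul] at h₁
    simp only [code, vl, el, List.length_append, length_flatten_ofFn, List.length_cons,
      List.length_nil]
    omega
  | join t args ih => exact h.elim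
  | inc x N e ih =>
    simp only [code, vl, el, List.length_append, List.length_cons, List.length_nil, List.length_map]
    by_cases h0 : e.vl.length = 0
    -- The constant 7 comes from here: one number for the empty graph, three for the increment, and
    -- the surplus 3.
    · obtain rfl := Reduced.eq_empty (e := e) hr hw.1 h0
      simp [code]
      omega
    · have := ih h hr hw.1 (by omega)
      omega
  | substSmall t E args ih => exact h.elim
  | substTd t H args _ ih => exact h.elim

/-- In a tree-depth expression vertices arise only from increments. Hence `l ≥ 1` if such a pattern
occurs in a reduced expression, and the code of the pattern edges may be charged to `l * m`. -/
theorem IsTd.incDepth_pos {e : GExpr} (h : e.IsTd) (hn : 1 ≤ e.vl.length) : 1 ≤ e.incDepth := by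
  induction e with
  | empty => simp [vl] at hn
  | single v => exact h.elim
  | union t args ih =>
    rw [vl, length_flatten_ofFn] at hn
    have : ∃ i, (args i).vl.length ≠ 0 := by
      by_contra h'
      push Not at h'
      rw [Finset.sum_eq_zero fun i _ => h' i] at hn
      omega
    obtain ⟨i, hi⟩ := this
    exact (ih i (h i) (by omega)).trans (incDepth_le_sup i)
  | join t args ih => exact h.elim
  | inc x N e ih => exact Nat.le_add_left _ _
  | substSmall t E args ih => exact h.elim
  | substTd t H args _ ih => exact h.elim

section reduced

variable {t : ℕ} {args : Fin t → GExpr}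

theorem argCount_eq_of_nonempty (h : ∀ i, (args i).verts.Nonempty) : argCount args = t := by
  rw [argCount_eq]
  calc _ = ∑ _i : Fin t, 1 := Finset.sum_congr rfl fun i _ => by
        have := vl_length_pos (h i); omega
    _ = t := by simp

theorem sum_code_le {c l : ℕ}
    (h : ∀ i, (args i).code.length + 3 ≤ 7 * (args i).vl.length + c * (args i).branching +
      ((args i).incDepth + l) * (args i).el.length) :
    (List.ofFn fun i => (args i).code).flatten.length + 3 * t ≤
      7 * (List.ofFn fun i => (args i).vl).flatten.length +
      c * (List.ofFn fun i => (args i).branching).sum +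
      ((Finset.univ.sup fun i => (args i).incDepth) + l) *
        (List.ofFn fun i => (args i).el).flatten.length := by
  have h₁ : ∑ i, ((args i).code.length + 3) ≤ ∑ i, (7 * (args i).vl.length +
      c * (args i).branching +
      ((Finset.univ.sup fun i => (args i).incDepth) + l) * (args i).el.length) := by
    refine Finset.sum_le_sum fun i _ => (h i).trans ?_
    have := incDepth_le_sup (args := args) i
    gcongr
  simp only [Finset.sum_add_distrib, ← Finset.mul_sum, Finset.sum_const, Finset.card_univ,
    Fintype.card_fin, smul_eq_mul] at h₁
  simp only [List.sum_ofFn, length_flatten_ofFn]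
  omega

end reduced

/-- A small pattern with `t ≤ h` vertices has at most `h * t` edges with two numbers each, which
gives `2 * h` per argument; all arguments are nonempty and thus counted by `branching`. The code of
a tree-depth pattern takes 7 per argument and one number per pattern edge, which is charged to an
edge of the graph. The neighbours listed by an increment are charged to its own contribution to
`incDepth`. -/
theorem Reduced.length_code_le {e : GExpr} (hr : e.Reduced) (hw : e.WellFormed) {h l : ℕ}
    (hp : e.PatternsBounded h l) (hn : 1 ≤ e.vl.length) :
    e.code.length + 3 ≤ 7 * e.vl.length + (2 * h + 7) * e.branching +
      (e.incDepth + l) * e.el.length := by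
  induction e with
  | empty => simp [vl] at hn
  | single v => simp [code, vl]; omega
  | union t args ih =>
    have h₁ := sum_code_le fun i => ih i (hr i).1 (hw.2.1 i) (hp i) (vl_length_pos (hr i).2)
    have := hw.1
    simp only [code, vl, el, branching, incDepth, List.length_append, List.length_cons,
      List.length_nil]
    omega
  | join t args ih =>
    have h₁ := sum_code_le fun i => ih i (hr i).1 (hw.2.1 i) (hp i) (vl_length_pos (hr i).2)
    have := hw.1
    simp only [code, vl, el, branching, incDepth, List.length_append, List.length_cons,
      List.length_nil, mul_add]
    omega
  | inc x N e ih =>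
    simp only [code, vl, el, branching, incDepth, List.length_append, List.length_cons,
      List.length_nil, List.length_map]
    by_cases h0 : e.vl.length = 0
    · obtain rfl := Reduced.eq_empty (e := e) hr hw.1 h0
      simp [code]
      nlinarith
    · have := ih hr hw.1 hp (by omega)
      nlinarith
  | substSmall t E args ih =>
    have h₁ := sum_code_le fun i =>
      ih i (hr.2 i).1 (hw.2.1 i) (hp.2 i) (vl_length_pos (hr.2 i).2)
    have ht := hr.1
    have hE : E.length ≤ t * t := by
      have := hw.1.1.length_le_card
      simpa using this
    have h₂ : (E.flatMap fun p => [(p.1 : ℕ), (p.2 : ℕ)]).length = 2 * E.length := by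
      simp [List.length_flatMap, mul_comm]
    have h₃ : t * t ≤ h * t := Nat.mul_le_mul_right _ hp.1
    simp only [code, vl, el, branching, incDepth, List.length_append, List.length_cons,
      List.length_nil, argCount_eq_of_nonempty fun i => (hr.2 i).2, ht, if_true, h₂, mul_add,
      add_mul] at h₁ ⊢
    have h₄ : 2 * h * t = 2 * (h * t) := by ring
    omega
  | substTd t H args _ ih =>
    have h₁ := sum_code_le fun i =>
      ih i (hr.2.2 i).1 (hw.2.1 i) (hp.2 i) (vl_length_pos (hr.2.2 i).2)
    have ht := hr.1
    have hvl : H.vl.length = t := by rw [hw.1.1.length_vl, hw.1.2.2, Finset.card_range]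
    have h₂ := hw.1.2.1.length_code_le hr.2.1 hw.1.1 (by omega)
    have h₃ := (hw.1.2.1.incDepth_pos (by omega)).trans hp.1
    have h₄ : H.el.length ≤ (blockEdges H.el (List.ofFn fun i => (args i).vl)).length := by
      have := length_fel_le H args
      rwa [fel, List.filter_eq_self.2] at this
      intro p hp
      have hm := hw.1.1.isEdgeList.mem p hp
      rw [hw.1.2.2, Finset.mem_range, Finset.mem_range] at hm
      have h₅ := vl_length_pos (hr.2.2 ⟨p.1, hm.1⟩).2
      have h₆ := vl_length_pos (hr.2.2 ⟨p.2, hm.2⟩).2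
      have e₅ := blockSize_eq (args := args) ⟨p.1, hm.1⟩
      have e₆ := blockSize_eq (args := args) ⟨p.2, hm.2⟩
      simp only at e₅ e₆
      rw [e₅, e₆]
      exact decide_eq_true (Nat.mul_ne_zero (by omega) (by omega))
    have h₅ := Nat.mul_le_mul h₃ h₄
    simp only [code, vl, el, branching, incDepth, List.length_append, List.length_cons,
      List.length_nil, argCount_eq_of_nonempty fun i => (hr.2.2 i).2, ht, if_true, mul_add,
      add_mul, hvl] at h₁ h₂ ⊢
    omega

/-- The expression contains an increment outside of the patterns. -/
def HasInc (e : GExpr) : Prop := 1 ≤ e.incDepth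

/-- Only increments read the flag. So the first evaluation, which lists no edges, gives the final
result if there is no increment. -/
theorem tr_eq_of_not_hasInc {e : GExpr} (h : ¬ e.HasInc) (f : ℕ) : e.tr f = e.tr 1 := by
  have key : ∀ {t : ℕ} {args : Fin t → GExpr},
      (∀ i, ¬ (args i).HasInc → (args i).tr f = (args i).tr 1) →
      ¬ 1 ≤ (Finset.univ.sup fun i => (args i).incDepth) →
      (List.ofFn fun i => (args i).tr f).sum = (List.ofFn fun i => (args i).tr 1).sum := by
    intro t args ih h
    rw [List.sum_ofFn, List.sum_ofFn]
    exact Finset.sum_congr rfl fun i _ => ih i fun h' => h (h'.trans (incDepth_le_sup i))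
  induction e with
  | empty => rfl
  | single v => rfl
  | union t args ih => exact key ih h
  | join t args ih => simp only [tr, key ih h]
  | inc x N e ih => exact absurd (Nat.le_add_left _ _) h
  | substSmall t E args ih => simp only [tr, key ih h]
  | substTd t H args _ ih => simp only [tr, key ih h]

end GExpr

/-! ### Notation for programs -/

namespace RamTerm

instance (n : ℕ) : OfNat RamTerm n := ⟨.lit n⟩
instance : Add RamTerm := ⟨.add⟩
instance : Sub RamTerm := ⟨.sub⟩
instance : Mul RamTerm := ⟨.mul⟩
instance : Div RamTerm := ⟨.div⟩

variable (B : ℕ) (s : RamState) (p q : RamTerm) (n : ℕ)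

@[simp] theorem val_ofNat : (no_index (OfNat.ofNat n) : RamTerm).val s = n := rfl
@[simp] theorem val_reg : (RamTerm.reg n).val s = s.reg n := rfl
@[simp] theorem val_mem : (RamTerm.mem n p).val s = s.mem n (p.val s) := rfl
@[simp] theorem val_add : (p + q).val s = p.val s + q.val s := rfl
@[simp] theorem val_sub : (p - q).val s = p.val s - q.val s := rfl
@[simp] theorem val_mul : (p * q).val s = p.val s * q.val s := rfl
@[simp] theorem val_div : (p / q).val s = p.val s / q.val s := rfl

@[simp] theorem safe_ofNat : (no_index (OfNat.ofNat n) : RamTerm).Safe B s ↔ n ≤ B := Iff.rfl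
@[simp] theorem safe_reg : (RamTerm.reg n).Safe B s ↔ True := Iff.rfl
@[simp] theorem safe_mem : (RamTerm.mem n p).Safe B s ↔ p.Safe B s := Iff.rfl
@[simp] theorem safe_add : (p + q).Safe B s ↔
    p.Safe B s ∧ q.Safe B s ∧ p.val s + q.val s ≤ B := Iff.rfl
@[simp] theorem safe_sub : (p - q).Safe B s ↔ p.Safe B s ∧ q.Safe B s := Iff.rfl
@[simp] theorem safe_mul : (p * q).Safe B s ↔
    p.Safe B s ∧ q.Safe B s ∧ p.val s * q.val s ≤ B := Iff.rfl
@[simp] theorem safe_div : (p / q).Safe B s ↔ p.Safe B s ∧ q.Safe B s := Iff.rfl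

end RamTerm

attribute [simp] RamProg.WritesReg RamProg.WritesMem RamProg.exec RamProg.Ok

infixr:60 " ;; " => RamProg.seq

/-! ### Lists in memory -/

/-- The array cells contain the list, from position `o` on. -/
def HoldsAt (m : ℕ → ℕ) (o : ℕ) (l : List ℕ) : Prop := ∀ i x, l[i]? = some x → m (o + i) = x

/-- The arrays `U` and `V` contain the list of pairs. -/
def HoldsPairs (U V : ℕ → ℕ) (l : List (ℕ × ℕ)) : Prop :=
  ∀ i p, l[i]? = some p → U i = p.1 ∧ V i = p.2

theorem HoldsAt.append {m : ℕ → ℕ} {o : ℕ} {l l' : List ℕ} (h : HoldsAt m o (l ++ l')) :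
    HoldsAt m o l ∧ HoldsAt m (o + l.length) l' := by
  constructor
  · intro i x hx
    exact h i x (by rw [List.getElem?_append_left (List.getElem?_eq_some_iff.1 hx).1]; exact hx)
  · intro i x hx
    rw [Nat.add_assoc]
    exact h _ x (by rw [List.getElem?_append_right (by omega)]; simpa using hx)

theorem HoldsAt.snoc {m : ℕ → ℕ} {l : List ℕ} (h : HoldsAt m 0 l) (x : ℕ) :
    HoldsAt (Function.update m l.length x) 0 (l ++ [x]) := by
  intro i y hy
  rw [List.getElem?_append] at hy
  split_ifs at hy with hi
  · rw [Nat.zero_add, Function.update_of_ne (by omega), ← h i y hy, Nat.zero_add]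
  · obtain ⟨h₁, h₂⟩ := List.getElem?_eq_some_iff.1 hy
    simp at h₁ h₂
    have : i = l.length := by omega
    subst this
    simp [h₂]

theorem HoldsPairs.of_append {U V : ℕ → ℕ} {l l' : List (ℕ × ℕ)} (h : HoldsPairs U V (l ++ l')) :
    HoldsPairs U V l :=
  fun i x hx => h i x
    (by rw [List.getElem?_append_left (List.getElem?_eq_some_iff.1 hx).1]; exact hx)

theorem HoldsPairs.append_right {U V : ℕ → ℕ} {l l' : List (ℕ × ℕ)}
    (h : HoldsPairs U V (l ++ l')) {i : ℕ} {p : ℕ × ℕ} (hp : l'[i]? = some p) :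
    U (l.length + i) = p.1 ∧ V (l.length + i) = p.2 :=
  h _ p (by rw [List.getElem?_append_right (by omega)]; simpa using hp)

theorem HoldsPairs.snoc {U V : ℕ → ℕ} {l : List (ℕ × ℕ)} (h : HoldsPairs U V l) (x y : ℕ) :
    HoldsPairs (Function.update U l.length x) (Function.update V l.length y) (l ++ [(x, y)]) := by
  intro i p hp
  rw [List.getElem?_append] at hp
  split_ifs at hp with hi
  · rw [Function.update_of_ne (by omega), Function.update_of_ne (by omega)]
    exact h i p hp
  · obtain ⟨h₁, h₂⟩ := List.getElem?_eq_some_iff.1 hp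
    simp at h₁ h₂
    have : i = l.length := by omega
    subst this
    simp [← h₂]

theorem HoldsPairs.update {U V : ℕ → ℕ} {l : List (ℕ × ℕ)} (h : HoldsPairs U V l) {i : ℕ}
    (hi : l.length ≤ i) (x y : ℕ) :
    HoldsPairs (Function.update U i x) (Function.update V i y) l := by
  intro j p hp
  have := (List.getElem?_eq_some_iff.1 hp).1
  rw [Function.update_of_ne (by omega), Function.update_of_ne (by omega)]
  exact h j p hp

/-- Position `c` decomposes into quotient and remainder by the length of `b`. The remainder is
written with a subtraction, because the machine has division but no remainder operation. -/
theorem List.getElem?_product {a b : List ℕ} {c : ℕ} {p : ℕ × ℕ} (h : (a ×ˢ b)[c]? = some p) :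
    a[c / b.length]? = some p.1 ∧ b[c - c / b.length * b.length]? = some p.2 := by
  induction a generalizing c with
  | nil => simp at h
  | cons x a ih =>
    rw [List.product_cons, List.getElem?_append] at h
    simp only [List.length_map, List.getElem?_map] at h
    split_ifs at h with hc
    · rw [Nat.div_eq_of_lt hc]
      simp only [Option.map_eq_some_iff] at h
      obtain ⟨y, hy, rfl⟩ := h
      simpa using hy
    · have hb : 0 < b.length := by
        by_contra h0
        have : b = [] := List.length_eq_zero_iff.1 (by omega)
        subst this
        simp at h
      obtain ⟨h₁, h₂⟩ := ih h
      have e : c / b.length = (c - b.length) / b.length + 1 := by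
        rw [← Nat.div_eq_sub_div hb (not_lt.1 hc)]
      rw [e]
      refine ⟨by simpa using h₁, ?_⟩
      rw [Nat.add_mul, one_mul, ← Nat.sub_sub, Nat.sub_right_comm]
      exact h₂

/-- The list, if `f ≠ 0`. -/
def listIf {α : Type*} (f : ℕ) (l : List α) : List α := if f = 0 then [] else l

theorem listIf_append {α : Type*} (f : ℕ) (l l' : List α) :
    listIf f (l ++ l') = listIf f l ++ listIf f l' := by
  unfold listIf; split_ifs <;> simp

theorem length_listIf {α : Type*} {f : ℕ} (hf : f ≤ 1) (l : List α) :
    (listIf f l).length = f * l.length := by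
  unfold listIf
  split_ifs with h
  · simp [h]
  · have : f = 1 := by omega
    simp [this]

/-! ### Edges between two blocks of vertices -/

namespace RamProg

open RamTerm

/-- Appends the edges between the vertices from position `R₁₀` and the `R₁₂` vertices from position
`R₁₁` of array `3` to the edge list in arrays `4` and `5`; their number is `R₁₃`. -/
def appendEdges : RamProg :=
  set 14 0 ;;
  loop (reg 13 - reg 14) (
    store 4 (reg 4) (mem 3 (reg 10 + reg 14 / reg 12)) ;;
    store 5 (reg 4) (mem 3 (reg 11 + (reg 14 - reg 14 / reg 12 * reg 12))) ;;
    set 4 (reg 4 + 1) ;;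
    set 14 (reg 14 + 1))

/-- One counter runs through all pairs and division recovers the two positions. Thus the time
depends only on the number of listed pairs, not on the lengths of `a` and `b`, and is constant if
nothing is listed. -/
theorem appendEdges_does {B : ℕ} {s : RamState} (hs : s.Fits B) {ed : List (ℕ × ℕ)} {a b : List ℕ}
    {f : ℕ} (hed : HoldsPairs (s.mem 4) (s.mem 5) ed) (h4 : s.reg 4 = ed.length)
    (ha : HoldsAt (s.mem 3) (s.reg 10) a) (hb : HoldsAt (s.mem 3) (s.reg 11) b)
    (h12 : s.reg 12 = b.length) (h13 : s.reg 13 = (listIf f (a ×ˢ b)).length)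
    (hB : ed.length + (listIf f (a ×ˢ b)).length + s.reg 10 + a.length + s.reg 11 + b.length + 1 ≤ B) :
    appendEdges.Does B s (60 * (listIf f (a ×ˢ b)).length + 60) fun s' =>
      HoldsPairs (s'.mem 4) (s'.mem 5) (ed ++ listIf f (a ×ˢ b)) ∧
      s'.reg 4 = ed.length + (listIf f (a ×ˢ b)).length := by
  set L := listIf f (a ×ˢ b) with hL
  have hLget : ∀ {c p}, L[c]? = some p →
      a[c / b.length]? = some p.1 ∧ b[c - c / b.length * b.length]? = some p.2 := by
    intro c p h
    rw [hL, listIf] at h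
    split_ifs at h
    · simp at h
    · exact List.getElem?_product h
  unfold appendEdges
  refine Does.seq hs (T₁ := 10) (T₂ := 44 * L.length + 44)
    (Q := fun s' => s' = exec (set 14 0) s)
    (Ok.does hs (by simp) (Nat.le_of_ble_eq_true rfl) rfl) ?_ (by omega)
  rintro s₁ hs₁ - rfl
  refine (Does.loop_list_const (c := 40) (k := 44) (hk := Nat.le_of_ble_eq_true rfl) (fun done todo s' => done ++ todo = L ∧
    s'.reg 14 = done.length ∧ HoldsPairs (s'.mem 4) (s'.mem 5) (ed ++ done) ∧
    s'.reg 4 = (ed ++ done).length) _ ?_ ?_ hs₁ L ⟨rfl, by simpa using ⟨hed, h4⟩⟩).mono ?_ ?_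
  · rintro done p todo s' hs' hfr ⟨hdt, h14, hH, h4'⟩
    have e10 := hfr.1 10 (by simp)
    have e11 := hfr.1 11 (by simp)
    have e12 := hfr.1 12 (by simp)
    have e13 := hfr.1 13 (by simp)
    have m3 := hfr.2 3 (by simp)
    simp at e10 e11 e12 e13 m3
    have hlen : done.length + (todo.length + 1) = L.length := by rw [← hdt]; simp
    have hp : L[done.length]? = some p := by rw [← hdt]; simp
    obtain ⟨hp₁, hp₂⟩ := hLget hp
    have l₁ := (List.getElem?_eq_some_iff.1 hp₁).1
    have l₂ := (List.getElem?_eq_some_iff.1 hp₂).1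
    have v₁ := ha _ _ hp₁
    have v₂ := hb _ _ hp₂
    refine ⟨by simp, by simp [e13, h13, h14]; omega, ?_⟩
    have hdm := Nat.div_mul_le_self done.length b.length
    simp only [List.length_append] at h4'
    refine Ok.does hs' ?_ (Nat.le_of_ble_eq_true rfl) ?_
    · simp [h14, e10, e11, e12, h12, h4']
      omega
    · simp [h14, e10, e11, e12, h12, h4', m3, v₁, v₂]
      refine ⟨hdt, ?_, by omega⟩
      have := hH.snoc p.1 p.2
      simpa using this
  · rintro done s' hs' hfr ⟨hdt, h14, -, -⟩
    have e13 := hfr.1 13 (by simp)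
    simp at e13
    refine ⟨by simp, ?_⟩
    rw [List.append_nil] at hdt
    simp [e13, h13, h14, hdt]
  · exact le_rfl
  · rintro s' ⟨-, -, h₁, h₂⟩
    exact ⟨h₁, by simpa using h₂⟩

end RamProg

/-! ### Unions and joins -/

/-- The state represents the intermediate result of an evaluation of the code `w`, where `pos` is
the position in the code, `stk` lists the numbers of vertices and edges of the operands, `vs` and
`ed` are the vertices and edges met so far, `tri` is the number of triangles, and `hi` tells
whether increments have occurred. Edges are listed if `f = 1`. -/
structure EvalState (w : List ℕ) (f pos : ℕ) (stk : List (ℕ × ℕ)) (vs : List ℕ) (ed : List (ℕ × ℕ))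
    (tri hi : ℕ) (s : RamState) : Prop where
  reg_length : s.reg 0 = w.length
  code : HoldsAt (s.mem 0) 0 w
  reg_pos : s.reg 1 = pos
  reg_sp : s.reg 2 = stk.length
  stack : HoldsPairs (s.mem 1) (s.mem 2) stk
  reg_vtop : s.reg 3 = vs.length
  vertices : HoldsAt (s.mem 3) 0 vs
  reg_etop : s.reg 4 = ed.length
  edges : HoldsPairs (s.mem 4) (s.mem 5) ed
  reg_tri : s.reg 5 = tri
  reg_flag : s.reg 6 = f
  reg_inc : s.reg 7 = hi
  marks : ∀ v ∈ vs, s.mem 6 v = 0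

/-- The numbers of vertices and edges of operands with given vertex lists and edge numbers. -/
def blockSizes (bl : List (List ℕ × ℕ)) : List (ℕ × ℕ) := bl.map fun a => (a.1.length, a.2)

theorem length_blockSizes (bl : List (List ℕ × ℕ)) : (blockSizes bl).length = bl.length :=
  List.length_map _

theorem joinSize_blockSizes (bl : List (List ℕ × ℕ)) :
    joinSize (blockSizes bl) =
      (bl.map Prod.snd).sum + (joinEdges (bl.map Prod.fst)).length := by
  rw [length_joinEdges _ (bl.map Prod.snd) (by simp)]
  congr 1
  rw [blockSizes, List.map_map, List.zip_map']
  rfl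

theorem sum_fst_blockSizes (bl : List (List ℕ × ℕ)) :
    ((blockSizes bl).map Prod.fst).sum = (bl.map Prod.fst).flatten.length := by
  rw [blockSizes, List.map_map, List.length_flatten, List.map_map]
  rfl

/-- The blocks are processed from the last to the first. Intermediate numbers are therefore bounded
by the final one and cannot overflow. -/
theorem joinTri_append_le (d d' : List (ℕ × ℕ)) : joinTri d' ≤ joinTri (d ++ d') := by
  induction d with
  | nil => exact le_rfl
  | cons a d ih => exact ih.trans (Nat.le_add_right _ _)

theorem joinEdges_append_le (d d' : List (List ℕ)) :
    (joinEdges d').length ≤ (joinEdges (d ++ d')).length := by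
  induction d with
  | nil => exact le_rfl
  | cons a d ih =>
    refine ih.trans ?_
    simp [joinEdges]

namespace RamProg

open RamTerm

/-- Replaces the topmost operands by their union or join. -/
def joinStep : RamProg :=
  (set 9 (reg 8 - 2) ;;
    set 18 (mem 0 (reg 1 + 1)) ;;
    set 15 0 ;;
    set 16 0 ;;
    set 17 (reg 3)) ;;
  loop (reg 18) (
    (set 18 (reg 18 - 1) ;;
      set 2 (reg 2 - 1) ;;
      set 19 (mem 1 (reg 2)) ;;
      set 20 (mem 2 (reg 2)) ;;
      set 11 (reg 17) ;;
      set 17 (reg 17 - reg 19) ;;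
      set 10 (reg 17) ;;
      set 12 (reg 15) ;;
      set 21 (reg 9 * (reg 19 * reg 15)) ;;
      set 13 (reg 6 * reg 21) ;;
      set 5 (reg 5 + reg 9 * (reg 16 * reg 19 + reg 20 * reg 15))) ;;
    appendEdges ;;
    (set 16 (reg 16 + (reg 20 + reg 21)) ;;
      set 15 (reg 15 + reg 19))) ;;
  (store 1 (reg 2) (reg 15) ;;
    store 2 (reg 2) (reg 16) ;;
    set 2 (reg 2 + 1) ;;
    set 1 (reg 1 + 2))

/-- Unions (`j = 0`) and joins (`j = 1`) share the program; `j` is the operation number minus 2 and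
multiplies all contributions between blocks. Popping the stack takes the operands from right to
left, which is the recursion of `joinEdges`, `joinSize` and `joinTri`; registers 15 and 16 hold the
totals of the operands popped so far. -/
theorem joinStep_does {B D : ℕ} {s : RamState} (hs : s.Fits B) {w : List ℕ} {f j pos : ℕ}
    {st : List (ℕ × ℕ)} {bl : List (List ℕ × ℕ)} {vs : List ℕ} {ed : List (ℕ × ℕ)} {tri hi : ℕ}
    (hrep : EvalState w f pos (st ++ blockSizes bl) (vs ++ (bl.map Prod.fst).flatten) ed tri hi s)
    (hf : f ≤ 1) (hj : j ≤ 1) (h8 : s.reg 8 = j + 2) (hw : w[pos + 1]? = some bl.length)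
    (hB : 8 * (D * D) ≤ B) (hpos : pos + 2 ≤ D) (hst : st.length + bl.length + 1 ≤ D)
    (hvs : vs.length + (bl.map Prod.fst).flatten.length ≤ D)
    (hed : ed.length + (joinEdges (bl.map Prod.fst)).length ≤ D)
    (hm : (bl.map Prod.snd).sum + (joinEdges (bl.map Prod.fst)).length ≤ D)
    (htri : tri + joinTri (blockSizes bl) ≤ D) :
    joinStep.Does B s
      (300 * (bl.length + 1 + (listIf (f * j) (joinEdges (bl.map Prod.fst))).length))
      (EvalState w f (pos + 2) (st ++ [((bl.map Prod.fst).flatten.length,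
        (bl.map Prod.snd).sum + j * (joinEdges (bl.map Prod.fst)).length)])
        (vs ++ (bl.map Prod.fst).flatten) (ed ++ listIf (f * j) (joinEdges (bl.map Prod.fst)))
        (tri + j * joinTri (blockSizes bl)) hi) := by
  have hD : 2 ≤ D := by omega
  have hDB : 8 * D ≤ B := le_trans (by nlinarith) hB
  have hfj : f * j ≤ 1 := Nat.mul_le_mul hf hj
  unfold joinStep
  have h0 := hrep.code _ _ hw
  rw [Nat.zero_add] at h0
  refine Does.seq hs (T₁ := 40)
    (T₂ := 200 * bl.length + 100 * (listIf (f * j) (joinEdges (bl.map Prod.fst))).length + 100)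
    (Q := fun s' => s' = exec _ s) (Ok.does hs ?_ (Nat.le_of_ble_eq_true rfl) rfl) ?_ (by omega)
  · simp [-List.length_flatten, hrep.reg_pos]; omega
  rintro s₁ hs₁ - rfl
  refine Does.seq hs₁
    (T₁ := 200 * bl.length + 60 * (listIf (f * j) (joinEdges (bl.map Prod.fst))).length + 2)
    (T₂ := 40)
    (Does.loop_list_rev (fun todo done s' => bl = todo ++ done ∧ s'.reg 18 = todo.length ∧
      s'.reg 2 = st.length + todo.length ∧
      s'.reg 15 = (done.map Prod.fst).flatten.length ∧
      s'.reg 16 = (done.map Prod.snd).sum + j * (joinEdges (done.map Prod.fst)).length ∧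
      s'.reg 17 = vs.length + (todo.map Prod.fst).flatten.length ∧
      s'.reg 5 = tri + j * joinTri (blockSizes done) ∧
      HoldsPairs (s'.mem 4) (s'.mem 5) (ed ++ listIf (f * j) (joinEdges (done.map Prod.fst))) ∧
      s'.reg 4 = (ed ++ listIf (f * j) (joinEdges (done.map Prod.fst))).length)
      (fun done => 200 * done.length +
        60 * (listIf (f * j) (joinEdges (done.map Prod.fst))).length) _ ?_ ?_ hs₁ bl ?_) ?_
    (by omega)
  · rintro todo a done s' hs' hfr ⟨hbl, h18, h2, h15, h16, h17, h5, hH, h4⟩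
    have e6 := hfr.1 6 (by simp [-List.length_flatten, appendEdges])
    have e9 := hfr.1 9 (by simp [-List.length_flatten, appendEdges])
    have m1 := hfr.2 1 (by simp [-List.length_flatten, appendEdges])
    have m2 := hfr.2 2 (by simp [-List.length_flatten, appendEdges])
    have m3 := hfr.2 3 (by simp [-List.length_flatten, appendEdges])
    simp [-List.length_flatten, hrep.reg_flag, h8] at e6 e9 m1 m2 m3
    have hbl' : bl = todo ++ a :: done := by simpa [-List.length_flatten] using hbl
    have htop : (st ++ blockSizes bl)[st.length + todo.length]? = some (a.1.length, a.2) := by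
      rw [hbl', List.getElem?_append_right (by omega)]
      simp [-List.length_flatten, blockSizes]
    obtain ⟨t1, t2⟩ := hrep.stack _ _ htop
    have hfl : (bl.map Prod.fst).flatten = (todo.map Prod.fst).flatten ++
        (a.1 ++ (done.map Prod.fst).flatten) := by rw [hbl']; simp
    have hV := hrep.vertices
    rw [hfl] at hV
    have hV₂ := (hV.append).2.append.2
    have hVa := hV₂.append.1
    have hVd := hV₂.append.2
    have hedle := joinEdges_append_le (todo.map Prod.fst) ((a :: done).map Prod.fst)
    rw [← List.map_append, ← hbl'] at hedle
    have htrle := joinTri_append_le (blockSizes todo) (blockSizes (a :: done))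
    rw [blockSizes, blockSizes, ← List.map_append, ← hbl', ← blockSizes, ← blockSizes] at htrle
    have hmle : a.2 + (done.map Prod.snd).sum ≤ (bl.map Prod.snd).sum := by rw [hbl']; simp
    have hje : joinEdges ((a :: done).map Prod.fst) =
        joinEdges (done.map Prod.fst) ++ a.1 ×ˢ (done.map Prod.fst).flatten := rfl
    have hjt : joinTri (blockSizes (a :: done)) = joinTri (blockSizes done) +
        (a.2 * (done.map Prod.fst).flatten.length +
          ((done.map Prod.snd).sum + (joinEdges (done.map Prod.fst)).length) * a.1.length) := by
      rw [← sum_fst_blockSizes, ← joinSize_blockSizes]; rfl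
    have hvs' : vs.length + ((todo.map Prod.fst).flatten.length +
        (a.1.length + (done.map Prod.fst).flatten.length)) ≤ D := by
      rw [hfl] at hvs; simpa [-List.length_flatten] using hvs
    rw [hje, List.length_append, List.length_product] at hedle
    set n := a.1.length with hn
    set N := (done.map Prod.fst).flatten.length with hN
    set S := (done.map Prod.snd).sum with hS
    set J := (joinEdges (done.map Prod.fst)).length with hJ
    have hX : (listIf (f * j) (a.1 ×ˢ (done.map Prod.fst).flatten)).length = f * (j * (n * N)) := by
      rw [length_listIf hfj, List.length_product]; ring
    have hjJ : j * J ≤ J := by simpa [-List.length_flatten] using Nat.mul_le_mul_right J hj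
    have hjn : j * (n * N) ≤ n * N := by simpa [-List.length_flatten] using Nat.mul_le_mul_right (n * N) hj
    have hfn : f * (j * (n * N)) ≤ j * (n * N) := by
      simpa [-List.length_flatten] using Nat.mul_le_mul_right (j * (n * N)) hf
    -- These products are formed before the factor `j` is applied, so they have to fit into a word
    -- also for unions.
    have hP₁ : (S + j * J) * n ≤ D * D := Nat.mul_le_mul (by omega) (by omega)
    have hP₂ : a.2 * N ≤ D * D := Nat.mul_le_mul (by omega) (by omega)
    have hP₃ : j * ((S + j * J) * n + a.2 * N) ≤ (S + j * J) * n + a.2 * N := by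
      simpa [-List.length_flatten] using Nat.mul_le_mul_right _ hj
    have hjt' : j * joinTri (blockSizes done) ≤ joinTri (blockSizes done) := by
      simpa [-List.length_flatten] using Nat.mul_le_mul_right _ hj
    have hlen : bl.length = todo.length + (done.length + 1) := by rw [hbl']; simp
    have hsub : vs.length + ((todo.map Prod.fst).flatten.length + n) - n =
        vs.length + (todo.map Prod.fst).flatten.length := by omega
    have hfjJ : f * j * J ≤ J := by simpa using Nat.mul_le_mul_right J hfj
    simp only [List.length_append, List.length_singleton, List.map_append, List.map_cons,
      List.map_nil, List.flatten_append, List.flatten_cons, List.flatten_nil, List.append_nil]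
      at h18 h2 h17 h4
    rw [← hn] at h17
    refine ⟨by simp, by simp [-List.length_flatten, h18], 150 + 60 * (f * (j * (n * N))), ?_, ?_⟩
    · rw [hje, listIf_append, List.length_append, hX, List.length_cons]
      have : (reg 18).cost = 1 := rfl
      omega
    refine Does.seq hs' (T₁ := 70) (T₂ := 80 + 60 * (f * (j * (n * N))))
      (Q := fun s'' => s'' = exec _ s') (Ok.does hs' ?_ (Nat.le_of_ble_eq_true rfl) rfl) ?_
      (by omega)
    · simp [-List.length_flatten, h18, h2, h15, h16, h17, h5, e6, e9, m1, m2, t1, t2]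
      omega
    rintro s₂ hs₂ - rfl
    refine Does.seq hs₂ (T₁ := 60 * (f * (j * (n * N))) + 60) (T₂ := 20)
      ((appendEdges_does hs₂ (a := a.1) (b := (done.map Prod.fst).flatten) (f := f * j)
        (ed := ed ++ listIf (f * j) (joinEdges (done.map Prod.fst))) ?_ ?_ ?_ ?_ ?_ ?_ ?_).mono
        (by rw [hX]) fun _ h => h) ?_ (by omega)
    · simpa [-List.length_flatten] using hH
    · simpa [-List.length_flatten] using h4
    · simp [-List.length_flatten, h2, m1, m3, t1, h17, hsub]
      simpa [-List.length_flatten] using hVa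
    · simp [-List.length_flatten, m3, h17]
      rw [← Nat.add_assoc]
      simpa [-List.length_flatten] using hVd
    · simp [-List.length_flatten, h15, ← hN]
    · rw [hX]
      simp [-List.length_flatten, h2, m1, t1, h15, e6, e9]
    · rw [hX]
      simp [-List.length_flatten, h2, h17, m1, t1, length_listIf hfj, hsub, ← hN, ← hJ, ← hn]
      omega
    rintro s₃ hs₃ hfr₃ ⟨hH₃, h4₃⟩
    have g2 := hfr₃.1 2 (by simp [-List.length_flatten, appendEdges])
    have g5 := hfr₃.1 5 (by simp [-List.length_flatten, appendEdges])
    have g15 := hfr₃.1 15 (by simp [-List.length_flatten, appendEdges])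
    have g16 := hfr₃.1 16 (by simp [-List.length_flatten, appendEdges])
    have g17 := hfr₃.1 17 (by simp [-List.length_flatten, appendEdges])
    have g18 := hfr₃.1 18 (by simp [-List.length_flatten, appendEdges])
    have g19 := hfr₃.1 19 (by simp [-List.length_flatten, appendEdges])
    have g20 := hfr₃.1 20 (by simp [-List.length_flatten, appendEdges])
    have g21 := hfr₃.1 21 (by simp [-List.length_flatten, appendEdges])
    simp [-List.length_flatten, h18, h2, h15, h16, h17, h5, e6, e9, m1, m2, t1, t2, hsub]
      at g2 g5 g15 g16 g17 g18 g19 g20 g21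
    refine Ok.does hs₃ ?_ (Nat.le_of_ble_eq_true rfl) ⟨hbl', ?_⟩
    · simp [-List.length_flatten, g16, g20, g21, g15, g19]
      omega
    · rw [hje, listIf_append, ← List.append_assoc, hjt]
      simp [-List.length_flatten, g2, g5, g15, g16, g17, g18]
      refine ⟨by omega, ?_, ?_, by simpa using hH₃, by simpa [-List.length_flatten, Nat.add_assoc] using h4₃⟩
      · rw [List.length_product, mul_add, ← hJ, ← hN, ← hS, ← hn]
        omega
      · obtain rfl | rfl : j = 0 ∨ j = 1 := by omega
        · simp
        · ring
  · rintro done s' hs' hfr ⟨-, h18, -⟩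
    exact ⟨by simp, by simpa [-List.length_flatten] using h18⟩
  · refine ⟨by simp, by simp [-List.length_flatten, hrep.reg_pos, h0], ?_⟩
    simp [-List.length_flatten, hrep.reg_sp, hrep.reg_vtop, hrep.reg_tri, joinEdges, blockSizes,
      joinTri, listIf, hrep.reg_etop, hrep.edges]
  · rintro s₂ hs₂ hfr ⟨-, h18, h2, h15, h16, h17, h5, hH, h4⟩
    have hf := hfr.1
    have e0 := hfr.1 0 (by simp [-List.length_flatten, appendEdges])
    have e1 := hfr.1 1 (by simp [-List.length_flatten, appendEdges])
    have e3 := hfr.1 3 (by simp [-List.length_flatten, appendEdges])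
    have e6 := hfr.1 6 (by simp [-List.length_flatten, appendEdges])
    have e7 := hfr.1 7 (by simp [-List.length_flatten, appendEdges])
    have m0 := hfr.2 0 (by simp [-List.length_flatten, appendEdges])
    have m1 := hfr.2 1 (by simp [-List.length_flatten, appendEdges])
    have m2 := hfr.2 2 (by simp [-List.length_flatten, appendEdges])
    have m3 := hfr.2 3 (by simp [-List.length_flatten, appendEdges])
    have m6 := hfr.2 6 (by simp [-List.length_flatten, appendEdges])
    simp [-List.length_flatten] at e0 e1 e3 e6 e7 m0 m1 m2 m3 m6
    simp only [List.length_nil, Nat.add_zero] at h2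
    refine Ok.does hs₂ ?_ (Nat.le_of_ble_eq_true rfl) ?_
    · simp [-List.length_flatten, h2, e1, hrep.reg_pos]
      omega
    · have hstk := hrep.stack.of_append.snoc ((bl.map Prod.fst).flatten.length)
        ((bl.map Prod.snd).sum + j * (joinEdges (bl.map Prod.fst)).length)
      constructor
      · simp [-List.length_flatten, e0, hrep.reg_length]
      · simpa [-List.length_flatten, m0] using hrep.code
      · simp [-List.length_flatten, e1, hrep.reg_pos]
      · simp [-List.length_flatten, h2]
      · simpa [-List.length_flatten, h2, m1, m2, h15, h16] using hstk
      · simp [-List.length_flatten, e3, hrep.reg_vtop]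
      · simpa [-List.length_flatten, m3] using hrep.vertices
      · simpa [-List.length_flatten] using h4
      · simpa [-List.length_flatten] using hH
      · simpa [-List.length_flatten] using h5
      · simp [-List.length_flatten, e6, hrep.reg_flag]
      · simp [-List.length_flatten, e7, hrep.reg_inc]
      · simpa [-List.length_flatten, m6] using hrep.marks

end RamProg

/-! ### Increments -/

namespace RamProg

open RamTerm

/-- Appends the edges from the vertex `R₉` to the `R₁₀` vertices listed from position `R₁₆` of the
input to the edge list in the arrays `U` and `V`, and adds to `R₂₂` the weights of the triangles
that arise with the last `R₁₃` edges. The array `K` is used for marks. -/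
def incLoops (U V K : ℕ) (wt g : RamTerm) : RamProg :=
  set 14 0 ;;
  loop (reg 10 - reg 14) (store K (mem 0 (reg 16 + reg 14)) 1 ;; set 14 (reg 14 + 1)) ;;
  set 14 (reg 13) ;;
  loop (reg 14) (
    (set 17 (mem U (reg 21 - reg 14)) ;;
      set 18 (mem V (reg 21 - reg 14))) ;;
    set 22 (reg 22 + mem K (reg 17) * (mem K (reg 18) * wt)) ;;
    set 14 (reg 14 - 1)) ;;
  set 14 0 ;;
  loop (reg 10 - reg 14) (
    (set 17 (mem 0 (reg 16 + reg 14)) ;;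
      store K (reg 17) 0 ;;
      store U (reg 21) (reg 9) ;;
      store V (reg 21) (reg 17)) ;;
    set 21 (reg 21 + g) ;;
    set 14 (reg 14 + 1))

/-- The neighbours are marked, the last edges are tested by the marks of their ends, and the marks
are removed while the new edges are written. So the time is linear in the number of neighbours and
scanned edges and does not depend on the number of vertices. The routine serves main increments
(weight 1) and pattern increments (weights of the blocks); accordingly `wt` and `g` are terms whose
values are determined by a few registers and array `1`. Marks are known to be zero only on `S`, as
memory is uninitialised. -/
theorem incLoops_does {U V K : ℕ} {wt g : RamTerm} (hUV : U ≠ V) (hUK : U ≠ K) (hVK : V ≠ K)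
    (hU : U ≠ 0 ∧ U ≠ 1) (hV : V ≠ 0 ∧ V ≠ 1) (hK : K ≠ 0 ∧ K ≠ 1) (hwt : wt.cost ≤ 20)
    (hg : g.cost ≤ 20) {B D : ℕ} {s : RamState} (hs : s.Fits B) {x acc : ℕ} {N : List ℕ}
    {ed ee : List (ℕ × ℕ)} {S : Set ℕ} {W : ℕ × ℕ → ℕ} {G : ℕ → ℕ} (hG : ∀ v ∈ N, G v ≤ 1)
    (hWval : ∀ p ∈ ee, ∀ s' : RamState, s'.reg 2 = s.reg 2 → s'.reg 11 = s.reg 11 →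
      s'.mem 1 = s.mem 1 → s'.reg 17 = p.1 → s'.reg 18 = p.2 → wt.Safe B s' ∧ wt.val s' = W p)
    (hGval : ∀ v ∈ N, ∀ s' : RamState, s'.reg 2 = s.reg 2 → s'.reg 6 = s.reg 6 →
      s'.reg 11 = s.reg 11 → s'.mem 1 = s.mem 1 → s'.reg 17 = v → g.Safe B s' ∧ g.val s' = G v)
    (h9 : s.reg 9 = x) (h10 : s.reg 10 = N.length) (h13 : s.reg 13 = ee.length)
    (hN : HoldsAt (s.mem 0) (s.reg 16) N)
    (hee : ∀ p ∈ ee, p.1 ∈ S ∧ p.2 ∈ S) (h21 : s.reg 21 = (ed ++ ee).length)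
    (hed : HoldsPairs (s.mem U) (s.mem V) (ed ++ ee)) (hm : ∀ v ∈ S, s.mem K v = 0)
    (h22 : s.reg 22 = acc) (hB : 4 * D ≤ B) (hD₁ : 1 ≤ D) (hD₂ : s.reg 16 + N.length ≤ D)
    (hD₃ : (ed ++ ee).length + N.length ≤ D)
    (hD₄ : acc + (ee.map fun p => if p.1 ∈ N ∧ p.2 ∈ N then W p else 0).sum ≤ D) :
    (incLoops U V K wt g).Does B s (100 * (N.length + ee.length + 1)) fun s' =>
      HoldsPairs (s'.mem U) (s'.mem V)
        (ed ++ ee ++ (N.filter fun v => G v ≠ 0).map fun v => (x, v)) ∧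
      s'.reg 21 = (ed ++ ee ++ (N.filter fun v => G v ≠ 0).map fun v => (x, v)).length ∧
      s'.reg 22 = acc + (ee.map fun p => if p.1 ∈ N ∧ p.2 ∈ N then W p else 0).sum ∧
      ∀ v ∈ S, s'.mem K v = 0 := by
  have hUV' := hUV.symm
  have hUK' := hUK.symm
  have hVK' := hVK.symm
  have hU' := hU.1.symm
  have hU'' := hU.2.symm
  have hV' := hV.1.symm
  have hV'' := hV.2.symm
  have hK' := hK.1.symm
  have hK'' := hK.2.symm
  unfold incLoops
  refine Does.seq hs (T₁ := 5) (T₂ := 98 * (N.length + ee.length) + 92)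
    (Q := fun s' => s' = exec _ s)
    (Ok.does hs (by simp) (Nat.le_of_ble_eq_true rfl) rfl) ?_ (by omega)
  rintro s₁ hs₁ - rfl
  refine Does.seq hs₁ (T₁ := 20 * N.length + 20) (T₂ := 78 * N.length + 98 * ee.length + 72)
    (Does.loop_list_const (c := 16) (k := 20) (hk := Nat.le_of_ble_eq_true rfl)
      (fun done todo s' => done ++ todo = N ∧ s'.reg 14 = done.length ∧
        ∀ v ∈ S, s'.mem K v = if v ∈ done then 1 else 0) _ ?_ ?_ hs₁ N ?_) ?_ (by omega)
  · rintro done a todo s' hs' hfr ⟨hdt, h14, hmk⟩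
    have e10 := hfr.1 10 (by simp)
    have e16 := hfr.1 16 (by simp)
    have m0 := hfr.2 0 (by simp [hK'])
    simp at e10 e16 m0
    have hlen : done.length + (todo.length + 1) = N.length := by rw [← hdt]; simp
    have ha := hN done.length a (by rw [← hdt]; simp)
    refine ⟨by simp, by simp [e10, h10, h14]; omega, Ok.does hs' ?_ (Nat.le_of_ble_eq_true rfl) ?_⟩
    · simp [h14, e16]; omega
    · simp [h14, e16, m0, ha]
      refine ⟨hdt, fun v hv => ?_⟩
      by_cases hva : v = a
      · simp [hva]
      · simp [hva, hmk v hv]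
  · rintro done s' hs' hfr ⟨hdt, h14, hmk⟩
    have e10 := hfr.1 10 (by simp)
    simp at e10
    rw [List.append_nil] at hdt
    simp [e10, h10, h14, hdt]
  · simpa using hm
  rintro s₂ hs₂ hfr₂ ⟨-, -, hmk⟩
  have e2 := hfr₂.1 2 (by simp)
  have e6 := hfr₂.1 6 (by simp)
  have e9 := hfr₂.1 9 (by simp)
  have e10 := hfr₂.1 10 (by simp)
  have e11 := hfr₂.1 11 (by simp)
  have e13 := hfr₂.1 13 (by simp)
  have e16 := hfr₂.1 16 (by simp)
  have e21 := hfr₂.1 21 (by simp)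
  have e22 := hfr₂.1 22 (by simp)
  have m0 := hfr₂.2 0 (by simp [hK'])
  have m1 := hfr₂.2 1 (by simp [hK''])
  have mU := hfr₂.2 U (by simp [hUK])
  have mV := hfr₂.2 V (by simp [hVK])
  simp at e2 e6 e9 e10 e11 e13 e16 e21 e22 m0 m1 mU mV
  refine Does.seq hs₂ (T₁ := 5) (T₂ := 78 * N.length + 98 * ee.length + 67)
    (Q := fun s' => s' = exec _ s₂)
    (Ok.does hs₂ (by simp) (Nat.le_of_ble_eq_true rfl) rfl) ?_ (by omega)
  rintro s₃ hs₃ - rfl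
  refine Does.seq hs₃ (T₁ := 70 * ee.length + 2) (T₂ := 78 * N.length + 65)
    ((Does.loop_list (c := fun _ => 60)
      (fun done todo s' => done ++ todo = ee ∧ s'.reg 14 = todo.length ∧
        s'.reg 22 = acc + (done.map fun p => if p.1 ∈ N ∧ p.2 ∈ N then W p else 0).sum)
      _ ?_ ?_ hs₃ ee ?_).mono ?_ fun _ h => h) ?_ (by omega)
  · rintro done p todo s' hs' hfr ⟨hdt, h14, h22'⟩
    have g2 := hfr.1 2 (by simp)
    have g11 := hfr.1 11 (by simp)
    have g21 := hfr.1 21 (by simp)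
    have n1 := hfr.2 1 (by simp)
    have nU := hfr.2 U (by simp)
    have nV := hfr.2 V (by simp)
    have nK := hfr.2 K (by simp)
    simp [e2, e11, e21, m1, mU, mV] at g2 g11 g21 n1 nU nV nK
    have hp : p ∈ ee := by rw [← hdt]; simp
    have hlen : done.length + (todo.length + 1) = ee.length := by rw [← hdt]; simp
    obtain ⟨hp₁, hp₂⟩ := hed.append_right (i := done.length) (p := p) (by rw [← hdt]; simp)
    have hi : (ed ++ ee).length - (todo.length + 1) = ed.length + done.length := by
      rw [List.length_append]; omega
    have hW := hWval p hp
    have hk₁ := hmk _ (hee p hp).1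
    have hk₂ := hmk _ (hee p hp).2
    have hsum : (done.map fun p => if p.1 ∈ N ∧ p.2 ∈ N then W p else 0).sum +
        (if p.1 ∈ N ∧ p.2 ∈ N then W p else 0) ≤
        (ee.map fun p => if p.1 ∈ N ∧ p.2 ∈ N then W p else 0).sum := by
      rw [← hdt]; simp
    -- The marks are 0 or 1, so their product is the indicator that both ends are neighbours of the
    -- new vertex.
    have hmul : s₂.mem K p.1 * (s₂.mem K p.2 * W p) = if p.1 ∈ N ∧ p.2 ∈ N then W p else 0 := by
      rw [hk₁, hk₂]
      by_cases h₁ : p.1 ∈ N <;> by_cases h₂ : p.2 ∈ N <;> simp [h₁, h₂]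
    rw [List.length_cons] at h14
    refine ⟨by simp, by simp [h14], ?_⟩
    refine Does.seq hs' (T₁ := 14) (T₂ := 46) (Q := fun s' => s' = exec _ _)
      (Ok.does hs' (by simp) (Nat.le_of_ble_eq_true rfl) rfl) ?_ (by omega)
    rintro s'' hs'' - hs''e
    have q17 : s''.reg 17 = p.1 := by
      rw [hs''e, ← hp₁]; simp only [exec]; simp [g21, h21, h14, nU]
      congr 1; simpa using hi
    have q18 : s''.reg 18 = p.2 := by
      rw [hs''e, ← hp₂]; simp only [exec]; simp [g21, h21, h14, nV]
      congr 1; simpa using hi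
    obtain ⟨w₁, w₂⟩ := hW s'' (by simp [hs''e, g2]) (by simp [hs''e, g11]) (by simp [hs''e, n1])
      q17 q18
    have q22 : s''.reg 22 = s'.reg 22 := by simp [hs''e]
    have q14 : s''.reg 14 = s'.reg 14 := by simp [hs''e]
    have qK : s''.mem K = s₂.mem K := by simp [hs''e, nK]
    have hWB := (w₁.fits hs'').val_le
    rw [w₂] at hWB
    refine Ok.does hs'' ?_ ?_ ?_
    · simp only [Ok, safe_add, safe_mul, safe_mem, safe_reg, val_add, val_mul, val_mem, val_reg,
        w₂, q17, q18, qK, q22, h22', hmul, w₁, true_and, exec]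
      have : s₂.mem K p.2 * W p ≤ B := by
        rw [hk₂]; split_ifs <;> simp [hWB]
      refine ⟨⟨⟨this, ?_⟩, ?_⟩, ?_⟩
      · split_ifs <;> simp [hWB]
      · omega
      · simp; omega
    · have : (reg 22 + mem K (reg 17) * (mem K (reg 18) * wt)).cost = 1 + (2 + (2 + wt.cost + 1) + 1) + 1 :=
        rfl
      have : (reg 14 - 1).cost = 3 := rfl
      simp only [time]
      omega
    · refine ⟨by simpa using hdt, by simp [q14, h14], ?_⟩
      simp only [exec, val_add, val_mul, val_mem, val_reg, w₂, q17, q18, qK, q22, h22', hmul]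
      simp [Nat.add_assoc]
  · rintro done s' hs' hfr ⟨hdt, h14, -⟩
    exact ⟨by simp, by simpa using h14⟩
  · simp [e13, h13, e22, h22]
  · rw [List.map_const', List.sum_replicate, smul_eq_mul, mul_comm]
    show (60 + 2) * ee.length + 2 ≤ _
    omega
  rintro s₄ hs₄ hfr₄ ⟨-, -, h22'⟩
  have g2 := hfr₄.1 2 (by simp)
  have g6 := hfr₄.1 6 (by simp)
  have g9 := hfr₄.1 9 (by simp)
  have g10 := hfr₄.1 10 (by simp)
  have g11 := hfr₄.1 11 (by simp)
  have g16 := hfr₄.1 16 (by simp)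
  have g21 := hfr₄.1 21 (by simp)
  have n0 := hfr₄.2 0 (by simp)
  have n1 := hfr₄.2 1 (by simp)
  have nU := hfr₄.2 U (by simp)
  have nV := hfr₄.2 V (by simp)
  have nK := hfr₄.2 K (by simp)
  simp [e2, e6, e9, e10, e11, e16, e21, m0, m1, mU, mV] at g2 g6 g9 g10 g11 g16 g21 n0 n1 nU nV nK
  refine Does.seq hs₄ (T₁ := 5) (T₂ := 78 * N.length + 60)
    (Q := fun s' => s' = exec _ s₄)
    (Ok.does hs₄ (by simp) (Nat.le_of_ble_eq_true rfl) rfl) ?_ (by omega)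
  rintro s₅ hs₅ - rfl
  refine (Does.loop_list_const (c := 55) (k := 60) (hk := Nat.le_of_ble_eq_true rfl)
      (fun done todo s' => done ++ todo = N ∧ s'.reg 14 = done.length ∧
        HoldsPairs (s'.mem U) (s'.mem V)
          (ed ++ ee ++ (done.filter fun v => G v ≠ 0).map fun v => (x, v)) ∧
        s'.reg 21 = (ed ++ ee ++ (done.filter fun v => G v ≠ 0).map fun v => (x, v)).length ∧
        s'.reg 22 = acc + (ee.map fun p => if p.1 ∈ N ∧ p.2 ∈ N then W p else 0).sum ∧
        ∀ v ∈ S, s'.mem K v = if v ∈ N ∧ v ∉ done then 1 else 0) _ ?_ ?_ hs₅ N ?_).mono (by omega) ?_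
  · rintro done v todo s' hs' hfr ⟨hdt, h14, hP, h21', h22'', hmk'⟩
    have a2 := hfr.1 2 (by simp)
    have a6 := hfr.1 6 (by simp)
    have a9 := hfr.1 9 (by simp)
    have a10 := hfr.1 10 (by simp)
    have a11 := hfr.1 11 (by simp)
    have a16 := hfr.1 16 (by simp)
    have b0 := hfr.2 0 (by simp [hK', hU', hV'])
    have b1 := hfr.2 1 (by simp [hK'', hU'', hV''])
    simp [g2, g6, g9, g10, g11, g16, n0, n1] at a2 a6 a9 a10 a11 a16 b0 b1
    have hlen : done.length + (todo.length + 1) = N.length := by rw [← hdt]; simp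
    have hv := hN done.length v (by rw [← hdt]; simp)
    have hvN : v ∈ N := by rw [← hdt]; simp
    have hfl := List.length_filter_le (fun v => decide (G v ≠ 0)) done
    simp only [List.length_append, List.length_map] at h21' hD₃
    refine ⟨by simp, by simp [a10, h10, h14]; omega, ?_⟩
    refine Does.seq hs' (T₁ := 26) (T₂ := 29) (Q := fun s' => s' = exec _ _)
      (Ok.does hs' (by simp [h14, a16]; omega) (Nat.le_of_ble_eq_true rfl) rfl) ?_ (by omega)
    rintro s'' hs'' - hs''e
    have q17 : s''.reg 17 = v := by
      rw [hs''e]; simp [a16, h14, b0, hv]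
    obtain ⟨w₁, w₂⟩ := hGval v hvN s'' (by simp [hs''e, a2]) (by simp [hs''e, a6])
      (by simp [hs''e, a11]) (by simp [hs''e, hK'', hU'', hV'', b1]) q17
    have q14 : s''.reg 14 = s'.reg 14 := by simp [hs''e]
    have q21 : s''.reg 21 = s'.reg 21 := by simp [hs''e]
    have q22 : s''.reg 22 = s'.reg 22 := by simp [hs''e]
    have qU : s''.mem U = Function.update (s'.mem U) (s'.reg 21) x := by
      rw [hs''e]; simp [hUV, hUK, a9, h9]
    have qV : s''.mem V = Function.update (s'.mem V) (s'.reg 21) v := by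
      rw [hs''e]; simp [hUV', hVK, a16, h14, b0, hv, hUK]
    have qK : s''.mem K = Function.update (s'.mem K) v 0 := by
      rw [hs''e]; simp [hUK', hVK', a16, h14, b0, hv]
    have hGv := hG v hvN
    refine Ok.does hs'' ?_ ?_ ?_
    · simp only [Ok, safe_add, safe_reg, val_add, val_reg, w₁, w₂, q21, exec]
      simp [q14]
      omega
    · have : (reg 21 + g).cost = 1 + g.cost + 1 := rfl
      have : (reg 14 + 1).cost = 3 := rfl
      simp only [time]
      omega
    · simp only [exec, val_add, val_reg, w₂]
      refine ⟨by simpa using hdt, by simp [q14, h14], ?_, ?_, by simp [q22, h22''], ?_⟩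
      · simp only [qU, qV]
        by_cases hGz : G v = 0
        · simp only [List.filter_append, List.filter_cons, hGz]
          simp only [ne_eq, not_true_eq_false, decide_false, Bool.false_eq_true, if_false,
            List.filter_nil, List.append_nil]
          refine hP.update ?_ _ _
          simp [h21', Nat.add_assoc]
        · have := hP.snoc x v
          simp only [List.length_append, List.length_map, ← h21'] at this
          simpa [List.filter_append, hGz] using this
      · by_cases hGz : G v = 0
        · simp [List.filter_append, hGz, q21, h21', Nat.add_assoc]
        · have : G v = 1 := by omega
          simp [List.filter_append, this, q21, h21']
          omega
      · intro u hu
        simp only [qK]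
        by_cases huv : u = v
        · subst huv
          simp
        · simp [huv, hmk' u hu]
  · rintro done s' hs' hfr ⟨hdt, h14, -⟩
    have a10 := hfr.1 10 (by simp)
    simp [g10] at a10
    rw [List.append_nil] at hdt
    simp [a10, h10, h14, hdt]
  · refine ⟨rfl, by simp, ?_, ?_, ?_, ?_⟩
    · simpa [nU, nV] using hed
    · simpa [g21] using h21
    · simpa using h22'
    · simpa [nK] using hmk
  · rintro s' ⟨-, -, h₁, h₂, h₃, h₄⟩
    exact ⟨h₁, h₂, h₃, fun v hv => by simpa using h₄ v hv⟩

end RamProg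

/-! ### Vertices and increments -/

theorem EvalState.code_at {w pre seg post : List ℕ} {f : ℕ} {stk ed : List (ℕ × ℕ)} {vs : List ℕ}
    {tri hi : ℕ} {s : RamState} (h : EvalState w f pre.length stk vs ed tri hi s)
    (hw : w = pre ++ seg ++ post) : HoldsAt (s.mem 0) pre.length seg := by
  have := h.code
  rw [hw, List.append_assoc] at this
  simpa using this.append.2.append.1

namespace RamProg

open RamTerm

/-- Pushes the graph without vertices. -/
def emptyStep : RamProg :=
  store 1 (reg 2) 0 ;;
  store 2 (reg 2) 0 ;;
  set 2 (reg 2 + 1) ;;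
  set 1 (reg 1 + 1)

theorem emptyStep_does {B D : ℕ} {s : RamState} (hs : s.Fits B) {w pre : List ℕ} {f : ℕ}
    {st ed : List (ℕ × ℕ)} {vs : List ℕ} {tri hi : ℕ}
    (h : EvalState w f pre.length st vs ed tri hi s) (hB : 4 * D ≤ B)
    (hpos : pre.length + 1 ≤ D) (hst : st.length + 1 ≤ D) :
    emptyStep.Does B s 50
      (EvalState w f (pre.length + 1) (st ++ [(0, 0)]) vs ed tri hi) := by
  refine Ok.does hs ?_ (Nat.le_of_ble_eq_true rfl) ?_
  · simp [emptyStep, h.reg_pos, h.reg_sp]; omega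
  · have hstk := h.stack.snoc 0 0
    constructor <;> simp [emptyStep, h.reg_pos, h.reg_sp, h.reg_length, h.reg_vtop, h.reg_etop,
      h.reg_tri, h.reg_flag, h.reg_inc, h.code, h.vertices, h.edges]
    · exact hstk
    · exact h.marks

/-- Pushes the graph with one vertex. -/
def singleStep : RamProg :=
  set 9 (mem 0 (reg 1 + 1)) ;;
  store 3 (reg 3) (reg 9) ;;
  store 6 (reg 9) 0 ;;
  set 3 (reg 3 + 1) ;;
  store 1 (reg 2) 1 ;;
  store 2 (reg 2) 0 ;;
  set 2 (reg 2 + 1) ;;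
  set 1 (reg 1 + 2)

theorem singleStep_does {B D : ℕ} {s : RamState} (hs : s.Fits B) {w pre post : List ℕ} {f v : ℕ}
    {st ed : List (ℕ × ℕ)} {vs : List ℕ} {tri hi : ℕ}
    (h : EvalState w f pre.length st vs ed tri hi s) (hw : w = pre ++ [1, v] ++ post)
    (hB : 4 * D ≤ B) (hpos : pre.length + 2 ≤ D) (hst : st.length + 1 ≤ D)
    (hvs : vs.length + 1 ≤ D) :
    singleStep.Does B s 50
      (EvalState w f (pre.length + 2) (st ++ [(1, 0)]) (vs ++ [v]) ed tri hi) := by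
  have hv := h.code_at hw 1 v rfl
  refine Ok.does hs ?_ (Nat.le_of_ble_eq_true rfl) ?_
  · simp [singleStep, h.reg_pos, h.reg_sp, h.reg_vtop]; omega
  · have hstk := h.stack.snoc 1 0
    have hvx := h.vertices.snoc v
    constructor <;> simp [singleStep, h.reg_pos, h.reg_sp, h.reg_length, h.reg_vtop, h.reg_etop,
      h.reg_tri, h.reg_flag, h.reg_inc, h.code, h.edges, hv]
    · exact hstk
    · exact hvx
    -- The mark cell of the new vertex was set to zero by the program; before that it could hold any
    -- word.
    · rintro u (hu | rfl)
      · by_cases huv : u = v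
        · simp [huv]
        · simp [huv, h.marks u hu]
      · simp

/-- Adds a vertex to the topmost operand. -/
def incStep : RamProg :=
  (set 9 (mem 0 (reg 1 + 1)) ;;
    set 10 (mem 0 (reg 1 + 2)) ;;
    set 2 (reg 2 - 1) ;;
    set 13 (reg 6 * mem 2 (reg 2)) ;;
    set 16 (reg 1 + 3) ;;
    set 21 (reg 4) ;;
    set 22 (reg 5)) ;;
  incLoops 4 5 6 1 (reg 6) ;;
  (set 4 (reg 21) ;;
    set 5 (reg 22) ;;
    store 3 (reg 3) (reg 9) ;;
    store 6 (reg 9) 0 ;;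
    set 3 (reg 3 + 1) ;;
    store 2 (reg 2) (mem 2 (reg 2) + reg 10) ;;
    store 1 (reg 2) (mem 1 (reg 2) + 1) ;;
    set 2 (reg 2 + 1) ;;
    set 7 (reg 7 + 1) ;;
    set 1 (reg 1 + (3 + reg 10)))

/-- The operand is the topmost one, so its edges form the end of the edge list and are scanned
without a search. With `f = 0` no edge is listed or scanned, but the number of edges on the stack is
kept correct. -/
theorem incStep_does {B D : ℕ} {s : RamState} (hs : s.Fits B) {w pre post N : List ℕ} {f x : ℕ}
    {n : ℕ} {st ed ee : List (ℕ × ℕ)} {vs : List ℕ} {tri hi : ℕ} (hf : f ≤ 1)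
    (h : EvalState w f pre.length (st ++ [(n, ee.length)]) vs (ed ++ listIf f ee) tri hi s)
    (hw : w = pre ++ ([4, x, N.length] ++ N) ++ post)
    (hee : ∀ p ∈ ee, p.1 ∈ vs ∧ p.2 ∈ vs) (hB : 4 * D ≤ B)
    (hpos : pre.length + (3 + N.length) ≤ D) (hst : st.length + 1 ≤ D) (hvs : vs.length + 1 ≤ D)
    (hn : n + 1 ≤ D) (hed : ed.length + ee.length + N.length ≤ D) (hhi : hi + 1 ≤ D)
    (htri : tri + f * (ee.map fun p => if p.1 ∈ N ∧ p.2 ∈ N then 1 else 0).sum ≤ D) :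
    incStep.Does B s (300 * (1 + N.length + f * ee.length))
      (EvalState w f (pre.length + (3 + N.length)) (st ++ [(n + 1, ee.length + N.length)])
        (vs ++ [x]) (ed ++ listIf f (ee ++ N.map fun v => (x, v)))
        (tri + f * (ee.map fun p => if p.1 ∈ N ∧ p.2 ∈ N then 1 else 0).sum) (hi + 1)) := by
  have hseg := h.code_at hw
  have h1 := hseg 1 x rfl
  have h2 := hseg 2 N.length rfl
  have hNat := hseg.append.2
  obtain ⟨t1, t2⟩ := h.stack st.length (n, ee.length) (by simp)
  simp only at t1 t2
  have hle : (listIf f ee).length = f * ee.length := length_listIf hf ee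
  have hfe : f * ee.length ≤ ee.length := by simpa using Nat.mul_le_mul_right ee.length hf
  have hsum : ((listIf f ee).map fun p => if p.1 ∈ N ∧ p.2 ∈ N then 1 else 0).sum =
      f * (ee.map fun p => if p.1 ∈ N ∧ p.2 ∈ N then 1 else 0).sum := by
    unfold listIf
    split_ifs with h0
    · simp [h0]
    · have : f = 1 := by omega
      simp [this]
  have hfil : ((N.filter fun _ => decide (f ≠ 0)).map fun v => (x, v)) =
      listIf f (N.map fun v => (x, v)) := by
    unfold listIf
    split_ifs with h0 <;> simp [h0]
  unfold incStep
  refine Does.seq hs (T₁ := 50) (T₂ := 100 * (N.length + f * ee.length + 1) + 60)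
    (Q := fun s' => s' = exec _ s) (Ok.does hs ?_ (Nat.le_of_ble_eq_true rfl) rfl) ?_ (by omega)
  · simp [h.reg_pos, h.reg_sp, h.reg_flag, t2]; omega
  rintro s₁ hs₁ - rfl
  refine Does.seq hs₁ (T₂ := 60) (incLoops_does (D := D) (x := x) (N := N) (acc := tri)
    (ed := ed) (ee := listIf f ee) (S := {v | v ∈ vs}) (W := fun _ => 1) (G := fun _ => f)
    (by simp) (by simp) (by simp) (by simp) (by simp) (by simp) (Nat.le_of_ble_eq_true rfl)
    (Nat.le_of_ble_eq_true rfl) hs₁ (fun _ _ => hf) ?_ ?_ ?_ ?_ ?_ ?_ ?_ ?_ ?_ ?_ ?_ hB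
    (by omega) ?_ ?_ ?_) ?_ (by rw [hle])
  · rintro p - s' - - - - -
    exact ⟨by simp; omega, rfl⟩
  · rintro v - s' - h6 - - -
    refine ⟨by simp, ?_⟩
    simpa [h.reg_flag] using h6
  · simp [h.reg_pos, h1]
  · simp [h.reg_pos, h2]
  · simp [h.reg_sp, h.reg_flag, t2, hle]
  · simpa [h.reg_pos] using hNat
  · intro p hp
    apply hee
    unfold listIf at hp
    split_ifs at hp
    · simp at hp
    · exact hp
  · simp [h.reg_etop]
  · simpa using h.edges
  · simpa using h.marks
  · simp [h.reg_tri]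
  · simp [h.reg_pos]; omega
  · simp [hle]; omega
  · simpa [hsum] using htri
  rintro s₂ hs₂ hfr ⟨hP, h21, h22, hmk⟩
  have e0 := hfr.1 0 (by simp [incLoops])
  have e1 := hfr.1 1 (by simp [incLoops])
  have e2 := hfr.1 2 (by simp [incLoops])
  have e3 := hfr.1 3 (by simp [incLoops])
  have e6 := hfr.1 6 (by simp [incLoops])
  have e7 := hfr.1 7 (by simp [incLoops])
  have e9 := hfr.1 9 (by simp [incLoops])
  have e10 := hfr.1 10 (by simp [incLoops])
  have m0 := hfr.2 0 (by simp [incLoops])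
  have m1 := hfr.2 1 (by simp [incLoops])
  have m2 := hfr.2 2 (by simp [incLoops])
  have m3 := hfr.2 3 (by simp [incLoops])
  simp [h.reg_pos, h.reg_sp, h.reg_length, h.reg_vtop, h.reg_flag, h.reg_inc, h1, h2]
    at e0 e1 e2 e3 e6 e7 e9 e10 m0 m1 m2 m3
  rw [hfil, List.append_assoc, ← listIf_append] at hP h21
  rw [hsum] at h22
  refine Ok.does hs₂ ?_ (Nat.le_of_ble_eq_true rfl) ?_
  · simp [e1, e2, e3, e7, e10, m1, m2, t1, t2]; omega
  · have hstk := h.stack.of_append.snoc (n + 1) (ee.length + N.length)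
    have hvx := h.vertices.snoc x
    constructor <;> simp [e0, e1, e2, e3, e6, e7, e9, e10, m0, m1, m2, m3, t1, t2, h.code]
    · exact hstk
    · exact hvx
    · simpa using h21
    · exact hP
    · exact h22
    · rintro u (hu | rfl)
      · by_cases huv : u = x
        · simp [huv]
        · simp [huv, hmk u hu]
      · simp

end RamProg

/-! ### Evaluation of patterns of bounded tree-depth -/

/-- The state represents the intermediate result of an evaluation of a tree-depth expression that
is a part of the code `w` and ends at position `pend`. The weights `n` of the vertices `0, …, t - 1`
are stored from position `b` on; `pos` is the position in the code, `stk` lists the numbers of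
edges of the operands, `ed` are the edges and `acc` is the weight of the triangles met so far. -/
structure PatternState (w : List ℕ) (b t pend : ℕ) (n : ℕ → ℕ) (pos : ℕ) (stk : List ℕ)
    (ed : List (ℕ × ℕ)) (acc : ℕ) (s : RamState) : Prop where
  code : HoldsAt (s.mem 0) 0 w
  reg_base : s.reg 2 = b
  weights : ∀ v < t, s.mem 1 (b + v) = n v
  reg_pos : s.reg 23 = pos
  reg_end : s.reg 24 = pend
  reg_sp : s.reg 25 = stk.length
  stack : HoldsAt (s.mem 11) 0 stk
  reg_top : s.reg 21 = ed.length
  edges : HoldsPairs (s.mem 9) (s.mem 10) ed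
  reg_acc : s.reg 22 = acc
  marks : ∀ v < t, s.mem 12 v = 0

theorem HoldsAt.of_append {m : ℕ → ℕ} {w pre seg post : List ℕ} (h : HoldsAt m 0 w)
    (hw : w = pre ++ seg ++ post) : HoldsAt m pre.length seg := by
  rw [hw, List.append_assoc] at h
  simpa using h.append.2.append.1

namespace RamProg

open RamTerm

/-- Pushes the empty pattern. -/
def patternEmpty : RamProg :=
  store 11 (reg 25) 0 ;;
  set 25 (reg 25 + 1) ;;
  set 23 (reg 23 + 1)

/-- Replaces the topmost patterns by their union. -/
def patternUnion : RamProg :=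
  (set 14 (mem 0 (reg 23 + 1)) ;;
    set 18 0) ;;
  loop (reg 14) (
    set 25 (reg 25 - 1) ;;
    set 18 (reg 18 + mem 11 (reg 25)) ;;
    set 14 (reg 14 - 1)) ;;
  store 11 (reg 25) (reg 18) ;;
  set 25 (reg 25 + 1) ;;
  set 23 (reg 23 + 2)

/-- Adds a vertex to the topmost pattern. -/
def patternInc : RamProg :=
  (set 9 (mem 0 (reg 23 + 1)) ;;
    set 10 (mem 0 (reg 23 + 2)) ;;
    set 16 (reg 23 + 3) ;;
    set 11 (mem 1 (reg 2 + reg 9)) ;;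
    set 25 (reg 25 - 1) ;;
    set 19 (reg 21) ;;
    set 13 (mem 11 (reg 25) * (1 - (1 - reg 11)))) ;;
  incLoops 9 10 12 (reg 11 * (mem 1 (reg 2 + reg 17) * mem 1 (reg 2 + reg 18)))
    (1 - (1 - reg 11 * mem 1 (reg 2 + reg 17))) ;;
  (store 11 (reg 25) (mem 11 (reg 25) + (reg 21 - reg 19)) ;;
    set 25 (reg 25 + 1) ;;
    set 23 (reg 23 + (3 + reg 10)))

/-- One step of the evaluation of a pattern. -/
def patternStep : RamProg :=
  set 26 (mem 0 (reg 23)) ;;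
  cond (reg 26) (cond (reg 26 - 2) patternInc patternUnion) patternEmpty

variable {B D t b pend pos : ℕ} {w pre post : List ℕ} {n : ℕ → ℕ} {stk : List ℕ}
  {ed : List (ℕ × ℕ)} {acc : ℕ} {s : RamState}

theorem patternStep_empty (hs : s.Fits B) (h : PatternState w b t pend n pre.length stk ed acc s)
    (hw : w = pre ++ [0] ++ post) (hB : 4 * D ≤ B) (hpos : pre.length + 1 ≤ D)
    (hst : stk.length + 1 ≤ D) :
    patternStep.Does B s 50
      (PatternState w b t pend n (pre.length + 1) (stk ++ [0]) ed acc) := by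
  have h0 := h.code.of_append hw 0 0 rfl
  rw [Nat.add_zero] at h0
  refine Does.seq hs (T₁ := 5) (T₂ := 40) (Q := fun s' => s' = exec _ s)
    (Ok.does hs (by simp) (Nat.le_of_ble_eq_true rfl) rfl) ?_ (by omega)
  rintro s₁ hs₁ - rfl
  refine Does.cond_neg hs₁ (by simp) (by simp [h.reg_pos, h0]) (T := 30)
    (Ok.does hs₁ ?_ (Nat.le_of_ble_eq_true rfl) ?_) (Nat.le_of_ble_eq_true rfl)
  · simp [patternEmpty, h.reg_pos, h.reg_sp]; omega
  · have hstk := h.stack.snoc 0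
    constructor <;> simp [patternEmpty, h.reg_pos, h.reg_sp, h.reg_base, h.reg_end, h.reg_top,
      h.reg_acc, h.code, h.edges]
    · exact h.weights
    · exact hstk
    · exact h.marks

theorem patternStep_union (hs : s.Fits B) {ms : List ℕ}
    (h : PatternState w b t pend n pre.length (stk ++ ms) ed acc s)
    (hw : w = pre ++ [2, ms.length] ++ post) (hB : 4 * D ≤ B) (hpos : pre.length + 2 ≤ D)
    (hst : stk.length + ms.length + 1 ≤ D) (hm : ms.sum ≤ D) :
    patternStep.Does B s (100 * (ms.length + 1))
      (PatternState w b t pend n (pre.length + 2) (stk ++ [ms.sum]) ed acc) := by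
  have h0 := h.code.of_append hw 0 2 rfl
  have h1 := h.code.of_append hw 1 _ rfl
  rw [Nat.add_zero] at h0
  refine Does.seq hs (T₁ := 5) (T₂ := 30 * ms.length + 50) (Q := fun s' => s' = exec _ s)
    (Ok.does hs (by simp) (Nat.le_of_ble_eq_true rfl) rfl) ?_ (by omega)
  rintro s₁ hs₁ - rfl
  refine Does.cond_pos hs₁ (by simp) (by simp [h.reg_pos, h0]) (T := 30 * ms.length + 48) ?_
    (show 2 + _ ≤ _ by omega)
  refine Does.cond_neg hs₁ (by simp; omega) (by simp [h.reg_pos, h0]) (T := 30 * ms.length + 44) ?_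
    (show 4 + _ ≤ _ by omega)
  unfold patternUnion
  refine Does.seq hs₁ (T₁ := 8) (T₂ := 30 * ms.length + 30) (Q := fun s' => s' = exec _ _)
    (Ok.does hs₁ (by simp [h.reg_pos]; omega) (Nat.le_of_ble_eq_true rfl) rfl) ?_ (by omega)
  rintro s₂ hs₂ - rfl
  refine Does.seq hs₂ (T₁ := 30 * ms.length + 2) (T₂ := 20)
    ((Does.loop_list_rev (fun todo done s' => ms = todo ++ done ∧ s'.reg 14 = todo.length ∧
      s'.reg 25 = (stk ++ todo).length ∧ s'.reg 18 = done.sum) (fun done => 30 * done.length)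
      _ ?_ ?_ hs₂ ms ?_).mono le_rfl fun _ h => h) ?_ (by omega)
  · rintro todo a done s' hs' hfr ⟨hdt, h14, h25, h18⟩
    have m11 := hfr.2 11 (by simp)
    simp at m11 h25 h14
    have ha := h.stack (stk.length + todo.length) a (by
      rw [hdt, List.getElem?_append_right (by omega)]; simp)
    rw [Nat.zero_add] at ha
    have hsum : a + done.sum ≤ ms.sum := by rw [hdt]; simp
    refine ⟨by simp, by simp [h14], 28, show 28 + 2 + _ ≤ _ by simp; omega, ?_⟩
    refine Ok.does hs' ?_ (Nat.le_of_ble_eq_true rfl) ?_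
    · simp [h25, m11, ha, h18]; omega
    · simp [h14, h25, m11, ha, h18, hdt]; omega
  · rintro done s' hs' hfr ⟨-, h14, -, -⟩
    exact ⟨by simp, by simpa using h14⟩
  · simp [h.reg_pos, h1, h.reg_sp]
  rintro s₃ hs₃ hfr ⟨-, -, h25, h18⟩
  have e2 := hfr.1 2 (by simp)
  have e21 := hfr.1 21 (by simp)
  have e22 := hfr.1 22 (by simp)
  have e23 := hfr.1 23 (by simp)
  have e24 := hfr.1 24 (by simp)
  have m := fun a => hfr.2 a (by simp)
  simp at e2 e21 e22 e23 e24 m h25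
  refine Ok.does hs₃ ?_ (Nat.le_of_ble_eq_true rfl) ?_
  · simp [h25, e23, h.reg_pos]; omega
  · have hstk := h.stack.append.1.snoc ms.sum
    constructor <;> simp [e2, e21, e22, e23, e24, m, h25, h18, h.reg_pos, h.reg_base, h.reg_end,
      h.reg_top, h.reg_acc, h.code, h.edges]
    · exact h.weights
    · exact hstk
    · exact h.marks

/-- New edges of weight zero are not stored, so that all stored edges can be charged to edges of the
graph. The bound `E` on the weights keeps products of three weights within a word. -/
theorem patternStep_inc (hs : s.Fits B) {N : List ℕ} {x E : ℕ} {ee : List (ℕ × ℕ)}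
    (h : PatternState w b t pend n pre.length (stk ++ [ee.length]) (ed ++ ee) acc s)
    (hw : w = pre ++ ([4, x, N.length] ++ N) ++ post) (hx : x < t) (hN : ∀ v ∈ N, v < t)
    (hee : ∀ p ∈ ee, p.1 < t ∧ p.2 < t) (hn : ∀ v < t, n v ≤ E) (hE : E ^ 3 ≤ D) (hE' : E ^ 2 ≤ D)
    (hB : 4 * D ≤ B) (hpos : pre.length + (3 + N.length) ≤ D) (hst : stk.length + 1 ≤ D)
    (hbt : b + t ≤ D) (hed : ed.length + ee.length + N.length ≤ D)
    (hacc : acc + (ee.map fun p => if p.1 ∈ N ∧ p.2 ∈ N then n x * (n p.1 * n p.2) else 0).sum ≤ D) :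
    patternStep.Does B s (300 * (1 + N.length + if n x = 0 then 0 else ee.length))
      (PatternState w b t pend n (pre.length + (3 + N.length))
        (stk ++ [ee.length + (N.filter fun v => n x * n v ≠ 0).length])
        (ed ++ ee ++ (N.filter fun v => n x * n v ≠ 0).map fun v => (x, v))
        (acc + (ee.map fun p => if p.1 ∈ N ∧ p.2 ∈ N then n x * (n p.1 * n p.2) else 0).sum)) := by
  have hseg := h.code.of_append hw
  have h0 := hseg 0 4 rfl
  have h1 := hseg 1 x rfl
  have h2 := hseg 2 N.length rfl
  rw [Nat.add_zero] at h0
  have hNat := hseg.append.2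
  have t1 := h.stack stk.length ee.length (by simp)
  rw [Nat.zero_add] at t1
  -- If `n x = 0`, all triangles at `x` have weight zero and no edge is scanned: the list is split
  -- differently, with an empty part `ee'` to scan.
  obtain ⟨ed', ee', hed', hee', hlen, hsum⟩ : ∃ ed' ee', ed ++ ee = ed' ++ ee' ∧
      (∀ p ∈ ee', p.1 < t ∧ p.2 < t) ∧ ee'.length = (if n x = 0 then 0 else ee.length) ∧
      (ee'.map fun p => if p.1 ∈ N ∧ p.2 ∈ N then n x * (n p.1 * n p.2) else 0).sum =
      (ee.map fun p => if p.1 ∈ N ∧ p.2 ∈ N then n x * (n p.1 * n p.2) else 0).sum := by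
    by_cases hx0 : n x = 0
    · exact ⟨ed ++ ee, [], by simp, by simp, by simp [hx0], by simp [hx0]⟩
    · exact ⟨ed, ee, rfl, hee, by simp [hx0], rfl⟩
  have hlen' := congrArg List.length hed'
  simp only [List.length_append] at hlen'
  refine Does.seq hs (T₁ := 5) (T₂ := 100 * (N.length + ee'.length + 1) + 150)
    (Q := fun s' => s' = exec _ s)
    (Ok.does hs (by simp) (Nat.le_of_ble_eq_true rfl) rfl) ?_ (by omega)
  rintro s₁ hs₁ - rfl
  refine Does.cond_pos hs₁ (by simp) (by simp [h.reg_pos, h0])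
    (T := 100 * (N.length + ee'.length + 1) + 148) ?_ (show 2 + _ ≤ _ by omega)
  refine Does.cond_pos hs₁ (by simp; omega) (by simp [h.reg_pos, h0])
    (T := 100 * (N.length + ee'.length + 1) + 144) ?_ (show 4 + _ ≤ _ by omega)
  unfold patternInc
  refine Does.seq hs₁ (T₁ := 60) (T₂ := 100 * (N.length + ee'.length + 1) + 60)
    (Q := fun s' => s' = exec _ _)
    (Ok.does hs₁ ?_ (Nat.le_of_ble_eq_true rfl) rfl) ?_ (by omega)
  · simp [h.reg_pos, h.reg_base, h.reg_sp, h1, t1]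
    have : ee.length * (1 - (1 - n x)) ≤ ee.length * 1 := Nat.mul_le_mul_left _ (by omega)
    have := h.weights x hx
    simp [this]
    omega
  rintro s₂ hs₂ - rfl
  have hwx := h.weights x hx
  have hE₁ : ∀ u < t, ∀ v < t, n u * n v ≤ D := fun u hu v hv => by
    calc n u * n v ≤ E * E := Nat.mul_le_mul (hn u hu) (hn v hv)
      _ = E ^ 2 := by ring
      _ ≤ D := hE'
  have hE₂ : ∀ u < t, ∀ v < t, n x * (n u * n v) ≤ D := fun u hu v hv => by
    calc n x * (n u * n v) ≤ E * (E * E) :=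
        Nat.mul_le_mul (hn x hx) (Nat.mul_le_mul (hn u hu) (hn v hv))
      _ = E ^ 3 := by ring
      _ ≤ D := hE
  refine Does.seq hs₂ (T₂ := 60) (incLoops_does (D := D) (x := x) (N := N) (acc := acc)
    (ed := ed') (ee := ee') (S := {v | v < t}) (W := fun p => n x * (n p.1 * n p.2))
    (G := fun v => 1 - (1 - n x * n v))
    (by simp) (by simp) (by simp) (by simp) (by simp) (by simp) (Nat.le_of_ble_eq_true rfl)
    (Nat.le_of_ble_eq_true rfl) hs₂ ?_ ?_ ?_ ?_ ?_ ?_ ?_ hee' ?_ ?_ ?_ ?_ hB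
    (by omega) ?_ ?_ ?_) ?_ (by omega)
  · intro v _; omega
  · rintro p hp s' h2' h11 hm1 h17 h18
    simp [h1, h.reg_pos, h.reg_base] at h2' h11 hm1
    rw [hwx] at h11
    obtain ⟨p₁, p₂⟩ := hee' p hp
    simp [h2', h11, hm1, h17, h18, h.weights _ p₁, h.weights _ p₂]
    have := hE₁ _ p₁ _ p₂
    have := hE₂ _ p₁ _ p₂
    omega
  · rintro v hv s' h2' - h11 hm1 h17
    simp [h1, h.reg_pos, h.reg_base] at h2' h11 hm1
    rw [hwx] at h11
    simp [h2', h11, hm1, h17, h.weights _ (hN v hv)]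
    have := hE₁ _ hx _ (hN v hv)
    have := hN v hv
    omega
  · simp [h.reg_pos, h1]
  · simp [h.reg_pos, h2]
  · simp [h.reg_pos, h.reg_base, h.reg_sp, t1, h1, hwx, hlen]
    by_cases hx0 : n x = 0
    · simp [hx0]
    · have : 1 - (1 - n x) = 1 := by omega
      simp [hx0, this]
  · simpa [h.reg_pos] using hNat
  · simp [h.reg_top, hlen']
  · simpa [← hed'] using h.edges
  · simpa using h.marks
  · simp [h.reg_acc]
  · simp [h.reg_pos]; omega
  · simp [← hlen']; omega
  · simpa [hsum] using hacc
  rintro s₃ hs₃ hfr ⟨hP, h21, h22, hmk⟩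
  have e2 := hfr.1 2 (by simp [incLoops])
  have e10 := hfr.1 10 (by simp [incLoops])
  have e19 := hfr.1 19 (by simp [incLoops])
  have e23 := hfr.1 23 (by simp [incLoops])
  have e24 := hfr.1 24 (by simp [incLoops])
  have e25 := hfr.1 25 (by simp [incLoops])
  have m0 := hfr.2 0 (by simp [incLoops])
  have m1 := hfr.2 1 (by simp [incLoops])
  have m11 := hfr.2 11 (by simp [incLoops])
  simp [h.reg_pos, h.reg_base, h.reg_top, h.reg_sp, h1, h2] at e2 e10 e19 e23 e24 e25 m0 m1 m11
  have hfil : (N.filter fun v => decide (1 - (1 - n x * n v) ≠ 0)) =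
      N.filter fun v => decide (n x * n v ≠ 0) :=
    List.filter_congr fun v _ => by congr 1; simp only [eq_iff_iff]; omega
  rw [hfil, ← hed'] at hP h21
  rw [hsum] at h22
  simp only [List.length_append, List.length_map] at h21
  set F := N.filter fun v => decide (n x * n v ≠ 0) with hF
  have hFN : F.length ≤ N.length := List.length_filter_le _ _
  have hsub : ed.length + ee.length + F.length - (ed.length + ee.length) = F.length := by omega
  refine Ok.does hs₃ ?_ (Nat.le_of_ble_eq_true rfl) ?_
  · simp [e10, e19, e23, e25, m11, t1, h21, hsub]; omega
  · have hstk := h.stack.append.1.snoc (ee.length + F.length)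
    constructor <;> simp [e2, e10, e19, e23, e24, e25, m0, m1, m11, t1, h21, h22, hsub, h.code,
      h.reg_end]
    · exact h.weights
    · exact hstk
    · omega
    · simpa using hP
    · exact hmk

end RamProg

theorem List.ofFn_comp {α β : Type*} {t : ℕ} (f : α → β) (a : Fin t → α) :
    (List.ofFn fun i => f (a i)) = (List.ofFn a).map f := by
  rw [List.map_ofFn]; rfl

theorem List.sum_map_filter_of_eq_zero {α : Type*} {q : α → Bool} {f : α → ℕ} {l : List α}
    (h : ∀ a ∈ l, q a = false → f a = 0) : ((l.filter q).map f).sum = (l.map f).sum := by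
  induction l with
  | nil => rfl
  | cons a l ih =>
    have ih := ih fun b hb => h b (List.mem_cons_of_mem _ hb)
    cases hq : q a with
    | false => simp [hq, ih, h a (by simp) hq]
    | true => simp [hq, ih]

namespace GExpr

theorem IsTd.length_el_le {H : GExpr} (h : H.IsTd) : H.el.length ≤ H.code.length := by
  induction H with
  | empty => simp [el]
  | single v => exact h.elim
  | union t args ih =>
    simp only [el, code, List.length_append, length_flatten_ofFn]
    exact (Finset.sum_le_sum fun i _ => ih i (h i)).trans (Nat.le_add_right _ _)
  | join t args ih => exact h.elim
  | inc x N e ih =>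
    have := ih h
    simp [el, code]; omega
  | substSmall t E args ih => exact h.elim
  | substTd t H args _ ih => exact h.elim

end GExpr

namespace RamProg

open RamTerm

/-- The loop evaluates the expression wherever it occurs in the code. -/
def EvaluatesPattern (B D t b pend : ℕ) (w : List ℕ) (n : ℕ → ℕ) (H : GExpr) : Prop :=
  ∀ ⦃pre post stk : List ℕ⦄ ⦃ed : List (ℕ × ℕ)⦄ ⦃acc : ℕ⦄ ⦃s : RamState⦄,
    w = pre ++ H.code ++ post → PatternState w b t pend n pre.length stk ed acc s → s.Fits B →
    pre.length + H.code.length ≤ pend → stk.length + H.code.length ≤ D →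
    ed.length + H.code.length ≤ D → acc + H.wt n ≤ D →
    ∃ T s', Reach B (reg 24 - reg 23) patternStep s T s' ∧ T ≤ 320 * H.pct n ∧ s'.Fits B ∧
      PatternState w b t pend n (pre.length + H.code.length) (stk ++ [(H.fel n).length])
        (ed ++ H.fel n) (acc + H.wt n) s'

/-- In postfix order the codes of the arguments are consecutive. The segments of the loop are
chained, and the results pile up on the stack in the order of the arguments. -/
theorem EvaluatesPattern.list {B D t b pend : ℕ} {w : List ℕ} {n : ℕ → ℕ} {es : List GExpr}
    (hes : ∀ e ∈ es, e.IsTd ∧ EvaluatesPattern B D t b pend w n e) {pre post stk : List ℕ}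
    {ed : List (ℕ × ℕ)} {acc : ℕ} {s : RamState}
    (hw : w = pre ++ (es.map GExpr.code).flatten ++ post)
    (h : PatternState w b t pend n pre.length stk ed acc s) (hs : s.Fits B)
    (hpend : pre.length + (es.map GExpr.code).flatten.length ≤ pend)
    (hst : stk.length + (es.map GExpr.code).flatten.length ≤ D)
    (hed : ed.length + (es.map GExpr.code).flatten.length ≤ D)
    (hacc : acc + (es.map (GExpr.wt n)).sum ≤ D) :
    ∃ T s', Reach B (reg 24 - reg 23) patternStep s T s' ∧ T ≤ 320 * (es.map (GExpr.pct n)).sum ∧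
      s'.Fits B ∧ PatternState w b t pend n (pre.length + (es.map GExpr.code).flatten.length)
        (stk ++ es.map fun e => (e.fel n).length)
        (ed ++ (es.map (GExpr.fel n)).flatten) (acc + (es.map (GExpr.wt n)).sum) s' := by
  induction es generalizing pre stk ed acc s with
  | nil => exact ⟨0, s, Reach.refl _ _ _ _, le_rfl, hs, by simpa using h⟩
  | cons e es ih =>
    simp only [List.map_cons, List.flatten_cons, List.length_append, List.sum_cons] at *
    obtain ⟨he₁, he₂⟩ := hes e (by simp)
    have hel := he₁.length_el_le
    have hfel : (e.fel n).length ≤ e.el.length := List.length_filter_le _ _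
    have := e.code_length_pos
    obtain ⟨T₁, s₁, r₁, hT₁, hs₁, h₁⟩ := he₂ (post := (es.map GExpr.code).flatten ++ post)
      (by simpa using hw) h hs (by omega) (by omega) (by omega) (by omega)
    rw [← List.length_append] at h₁
    obtain ⟨T₂, s₂, r₂, hT₂, hs₂, h₂⟩ := ih (fun e he => hes e (by simp [he]))
      (by simpa using hw) h₁ hs₁ (by simp; simp at hpend; omega) (by simp; simp at hst; omega)
      (by simp; simp at hed; omega) (by omega)
    refine ⟨_, s₂, r₁.trans r₂, by omega, hs₂, ?_⟩
    simpa [Nat.add_assoc] using h₂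

/-- Structural induction: after the segments of the arguments, one round performs the operation.
Bounds by the code length keep the stack and the edge list small. -/
theorem evaluatesPattern {B D t b pend E : ℕ} {w : List ℕ} {n : ℕ → ℕ} (hB : 4 * D ≤ B)
    (hwD : w.length ≤ D) (hn : ∀ v < t, n v ≤ E) (hE : E ^ 3 ≤ D) (hE' : E ^ 2 ≤ D)
    (hbt : b + t ≤ D) {H : GExpr} (hTd : H.IsTd) (hwf : H.WellFormed) (ht : ∀ v ∈ H.verts, v < t) :
    EvaluatesPattern B D t b pend w n H := by
  induction H with
  | single v => exact hTd.elim
  | join t args ih => exact hTd.elim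
  | substSmall t E args ih => exact hTd.elim
  | substTd t H args _ ih => exact hTd.elim
  | empty =>
    intro pre post stk ed acc s hw h hs hpend hst hed hacc
    have hwl := congrArg List.length hw
    simp [GExpr.code] at hw hpend hst hed hwl
    obtain ⟨T, s', hr, hT, hs', h'⟩ := (patternStep_empty hs h (post := post) (by simpa using hw) hB
      (by omega) hst).reach (g := reg 24 - reg 23) hs (by simp)
      (by simp [h.reg_pos, h.reg_end]; omega)
    exact ⟨T, s', hr, hT.trans (Nat.le_of_ble_eq_true rfl), hs', by
      simpa [GExpr.fel, GExpr.el, GExpr.wt, GExpr.code] using h'⟩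
  | union r args ih =>
    intro pre post stk ed acc s hw h hs hpend hst hed hacc
    have hwl := congrArg List.length hw
    simp only [GExpr.code, GExpr.wt, GExpr.fel_union, GExpr.pct, List.ofFn_comp] at *
    set es := List.ofFn args with hes
    have hr : es.length = r := by simp [hes]
    simp only [List.length_append, List.length_cons, List.length_nil, Nat.zero_add] at hwl hpend hst hed
    obtain ⟨T₁, s₁, r₁, hT₁, hs₁, h₁⟩ := EvaluatesPattern.list (es := es) (fun e he => by
      obtain ⟨i, rfl⟩ := (List.mem_ofFn' _ _).1 he
      exact ⟨hTd i, ih i (hTd i) (hwf.2.1 i) fun v hv => ht v (by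
        simp only [GExpr.verts, Finset.mem_biUnion, Finset.mem_univ, true_and]; exact ⟨i, hv⟩)⟩)
      (post := [2, r] ++ post) (by simpa using hw) h hs (by omega) (by omega) (by omega) (by omega)
    rw [← List.length_append] at h₁
    have hsum : (es.map fun e => (e.fel n).length).sum = ((es.map (GExpr.fel n)).flatten).length := by
      rw [List.length_flatten, List.map_map]; rfl
    have hle : (es.map fun e => (e.fel n).length).sum ≤ (es.map GExpr.code).flatten.length := by
      rw [List.length_flatten, List.map_map]
      refine List.sum_le_sum fun e he => ?_
      obtain ⟨i, rfl⟩ := (List.mem_ofFn' _ _).1 he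
      exact (List.length_filter_le _ _).trans (hTd i).length_el_le
    have hrl : es.length ≤ (es.map GExpr.code).flatten.length := by
      rw [List.length_flatten, List.map_map]
      calc es.length = (es.map fun _ => 1).sum := by simp
        _ ≤ _ := List.sum_le_sum fun e _ => e.code_length_pos
    obtain ⟨T₂, s₂, r₂, hT₂, hs₂, h₂⟩ := (patternStep_union hs₁ h₁ (D := D) (post := post)
      (by simpa [hr] using hw) hB
      (by rw [List.length_append]; omega) (by rw [List.length_map]; omega) (by omega)).reach
      (g := reg 24 - reg 23) hs₁ (by simp) (by
        simp only [val_sub, val_reg, h₁.reg_pos, h₁.reg_end, List.length_append]; omega)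
    refine ⟨_, s₂, r₁.trans r₂, ?_, hs₂, ?_⟩
    · rw [List.length_map, hr] at hT₂
      have : (reg 24 - reg 23).cost = 3 := rfl
      omega
    · rw [hsum] at h₂
      simpa [Nat.add_assoc, -List.length_flatten] using h₂
  | inc x N e ih =>
    intro pre post stk ed acc s hw h hs hpend hst hed hacc
    have hwl := congrArg List.length hw
    simp only [GExpr.code, GExpr.wt, GExpr.fel_inc, GExpr.pct] at *
    simp only [List.length_append, List.length_cons, List.length_nil, Nat.zero_add] at hwl hpend hst hed
    obtain ⟨hwf', hx, hNd, hN⟩ := hwf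
    have hte : ∀ v ∈ e.verts, v < t := fun v hv => ht v (Finset.mem_insert_of_mem hv)
    have hfel : (e.fel n).length ≤ e.el.length := List.length_filter_le _ _
    have hel := GExpr.IsTd.length_el_le (H := e) hTd
    obtain ⟨T₁, s₁, r₁, hT₁, hs₁, h₁⟩ := ih hTd hwf' hte (post := [4, x, N.length] ++ N ++ post)
      (by simpa using hw) h hs (by omega) (by omega) (by omega) (by omega)
    rw [← List.length_append] at h₁
    -- The scan sees only stored edges, but the omitted ones have weight zero.
    have hsum : ((e.fel n).map fun p => if p.1 ∈ N ∧ p.2 ∈ N then n x * (n p.1 * n p.2) else 0).sum =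
        (e.el.map fun p => if p.1 ∈ N ∧ p.2 ∈ N then n x * (n p.1 * n p.2) else 0).sum := by
      refine List.sum_map_filter_of_eq_zero fun p _ hp => ?_
      have hp : n p.1 * n p.2 = 0 := of_not_not (of_decide_eq_false hp)
      simp [hp]
    obtain ⟨T₂, s₂, r₂, hT₂, hs₂, h₂⟩ := (patternStep_inc hs₁ h₁ (D := D) (E := E) (x := x) (N := N)
      (post := post)
      (by simpa using hw) (ht x (Finset.mem_insert_self _ _)) (fun v hv => hte v (hN v hv))
      (fun p hp => by
        have := hwf'.isEdgeList.1 p (List.mem_of_mem_filter hp)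
        exact ⟨hte _ this.1, hte _ this.2⟩) hn hE hE' hB
      (by rw [List.length_append]; omega) (by omega) hbt (by omega) (by rw [hsum]; omega)).reach
      (g := reg 24 - reg 23) hs₁ (by simp) (by
        simp only [val_sub, val_reg, h₁.reg_pos, h₁.reg_end, List.length_append]; omega)
    refine ⟨_, s₂, r₁.trans r₂, ?_, hs₂, ?_⟩
    · have : (reg 24 - reg 23).cost = 3 := rfl
      omega
    · rw [hsum] at h₂
      simpa [Nat.add_assoc, Nat.add_comm 3] using h₂

end RamProg

/-! ### Substitutions: arguments and edges between them -/

theorem EvalState.congr {w : List ℕ} {f pos : ℕ} {stk ed : List (ℕ × ℕ)} {vs : List ℕ}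
    {tri hi : ℕ} {s s' : RamState} (h : EvalState w f pos stk vs ed tri hi s)
    (hr : ∀ r < 8, s'.reg r = s.reg r) (hm : ∀ a < 7, s'.mem a = s.mem a) :
    EvalState w f pos stk vs ed tri hi s' := by
  obtain ⟨h1, h2, h3, h4, h5, h6, h7, h8, h9, h10, h11, h12, h13⟩ := h
  constructor <;> simp_all

/-- The state describes the arguments `bl` of a substitution: numbers of vertices and edges,
positions of the vertices, and an enumeration of the nonempty arguments. -/
structure ArgState (st : List (ℕ × ℕ)) (bl : List (List ℕ × ℕ)) (vn : ℕ) (s : RamState) : Prop where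
  sizes : HoldsPairs (s.mem 1) (s.mem 2) (st ++ blockSizes bl)
  starts : ∀ i a, bl[i]? = some a →
    HoldsAt (s.mem 3) (s.mem 7 i) a.1 ∧ s.mem 7 i + a.1.length ≤ vn
  ids : ∀ i < bl.length, s.mem 8 i = nonemptyCount (blockSizes (bl.drop (i + 1)))
  reg_count : s.reg 27 = bl.length
  reg_verts : s.reg 30 = (bl.map Prod.fst).flatten.length
  reg_edges : s.reg 31 = (bl.map Prod.snd).sum
  reg_nonempty : s.reg 32 = nonemptyCount (blockSizes bl)

theorem ArgState.congr {st : List (ℕ × ℕ)} {bl : List (List ℕ × ℕ)} {vn : ℕ} {s s' : RamState}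
    (h : ArgState st bl vn s) (hr : ∀ r, 27 ≤ r → r < 33 → s'.reg r = s.reg r)
    (hm : ∀ a < 9, s'.mem a = s.mem a) : ArgState st bl vn s' := by
  obtain ⟨h1, h2, h3, h4, h5, h6, h7⟩ := h
  constructor <;> simp_all

theorem nonemptyCount_le (d : List (ℕ × ℕ)) : nonemptyCount d ≤ d.length := by
  unfold nonemptyCount
  induction d with
  | nil => simp
  | cons a d ih => simp; omega

theorem crossTri_append (P P' d : List (ℕ × ℕ)) :
    crossTri (P ++ P') d = crossTri P d + crossTri P' d := by
  simp [crossTri]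

theorem blockEdges_append (P P' : List (ℕ × ℕ)) (b : List (List ℕ)) :
    blockEdges (P ++ P') b = blockEdges P b ++ blockEdges P' b := by
  simp [blockEdges]

namespace RamProg

open RamTerm

/-- Takes the arguments of a substitution from the stack. -/
def popArgs : RamProg :=
  (set 27 (mem 0 (reg 1 + 1)) ;;
    set 14 (reg 27) ;;
    set 30 0 ;;
    set 31 0 ;;
    set 32 0 ;;
    set 17 (reg 3)) ;;
  loop (reg 14) (
    set 14 (reg 14 - 1) ;;
    set 2 (reg 2 - 1) ;;
    set 18 (mem 1 (reg 2)) ;;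
    set 17 (reg 17 - reg 18) ;;
    store 7 (reg 14) (reg 17) ;;
    store 8 (reg 14) (reg 32) ;;
    set 30 (reg 30 + reg 18) ;;
    set 31 (reg 31 + mem 2 (reg 2)) ;;
    set 32 (reg 32 + (1 - (1 - reg 18))))

/-- Popping only lowers the stack pointer, so the sizes remain readable above it. The starts of the
vertex lists are found by subtracting lengths from the top, and the number given to an argument is
the number of nonempty arguments after it. -/
theorem popArgs_does {B D : ℕ} {s : RamState} (hs : s.Fits B) {w : List ℕ} {f pos : ℕ}
    {st : List (ℕ × ℕ)} {bl : List (List ℕ × ℕ)} {vs : List ℕ} {ed : List (ℕ × ℕ)} {tri hi : ℕ}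
    (h : EvalState w f pos (st ++ blockSizes bl) (vs ++ (bl.map Prod.fst).flatten) ed tri hi s)
    (hw : w[pos + 1]? = some bl.length) (hB : 4 * D ≤ B) (hpos : pos + 2 ≤ D)
    (hst : st.length + bl.length + 1 ≤ D)
    (hvs : vs.length + (bl.map Prod.fst).flatten.length ≤ D) (hm : (bl.map Prod.snd).sum ≤ D) :
    popArgs.Does B s (100 * (bl.length + 1)) fun s' =>
      EvalState w f pos st (vs ++ (bl.map Prod.fst).flatten) ed tri hi s' ∧
      ArgState st bl (vs ++ (bl.map Prod.fst).flatten).length s' := by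
  have h0 := h.code _ _ hw
  rw [Nat.zero_add] at h0
  unfold popArgs
  refine Does.seq hs (T₁ := 30) (T₂ := 70 * bl.length + 10)
    (Q := fun s' => s' = exec _ s) (Ok.does hs ?_ (Nat.le_of_ble_eq_true rfl) rfl) ?_ (by omega)
  · simp [h.reg_pos]; omega
  rintro s₁ hs₁ - rfl
  refine ((Does.loop_list_rev (fun todo done s' => bl = todo ++ done ∧ s'.reg 14 = todo.length ∧
      s'.reg 2 = st.length + todo.length ∧
      s'.reg 17 = vs.length + (todo.map Prod.fst).flatten.length ∧
      s'.reg 30 = (done.map Prod.fst).flatten.length ∧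
      s'.reg 31 = (done.map Prod.snd).sum ∧
      s'.reg 32 = nonemptyCount (blockSizes done) ∧
      (∀ i a, bl[i]? = some a → todo.length ≤ i →
        HoldsAt (s'.mem 3) (s'.mem 7 i) a.1 ∧ s'.mem 7 i + a.1.length ≤
          (vs ++ (bl.map Prod.fst).flatten).length) ∧
      ∀ i, todo.length ≤ i → i < bl.length →
        s'.mem 8 i = nonemptyCount (blockSizes (bl.drop (i + 1))))
      (fun done => 70 * done.length) _ ?_ ?_ hs₁ bl ?_).strong hs₁).mono
      (show 70 * bl.length + 2 ≤ _ by omega) ?_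
  · rintro todo a done s' hs' hfr ⟨hbl, h14, h2, h17, h30, h31, h32, hst', hid⟩
    have m1 := hfr.2 1 (by simp)
    have m2 := hfr.2 2 (by simp)
    have m3 := hfr.2 3 (by simp)
    simp at m1 m2 m3
    have hbl' : bl = todo ++ a :: done := by simpa using hbl
    have htop : (st ++ blockSizes bl)[st.length + todo.length]? = some (a.1.length, a.2) := by
      rw [hbl', List.getElem?_append_right (by omega)]
      simp [blockSizes]
    obtain ⟨t1, t2⟩ := h.stack _ _ htop
    have hfl : (bl.map Prod.fst).flatten = (todo.map Prod.fst).flatten ++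
        (a.1 ++ (done.map Prod.fst).flatten) := by rw [hbl']; simp
    have hV := h.vertices
    rw [hfl] at hV
    have hVa := (hV.append).2.append.2.append.1
    have hmle : a.2 + (done.map Prod.snd).sum ≤ (bl.map Prod.snd).sum := by rw [hbl']; simp
    have hvs' : vs.length + ((todo.map Prod.fst).flatten.length +
        (a.1.length + (done.map Prod.fst).flatten.length)) ≤ D := by
      rw [hfl] at hvs; simpa [-List.length_flatten] using hvs
    have hlen : bl.length = todo.length + (done.length + 1) := by rw [hbl']; simp
    have hsub : vs.length + ((todo.map Prod.fst).flatten.length + a.1.length) - a.1.length =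
        vs.length + (todo.map Prod.fst).flatten.length := by omega
    simp only [List.length_append, List.length_singleton, List.map_append, List.map_cons,
      List.map_nil, List.flatten_append, List.flatten_cons, List.flatten_nil, List.append_nil]
      at h14 h2 h17
    have hcnt := nonemptyCount_le (blockSizes done)
    rw [length_blockSizes] at hcnt
    have hdrop : bl.drop (todo.length + 1) = done := by rw [hbl']; simp
    refine ⟨by simp, by simp [h14], 67, show 67 + 2 + 70 * _ ≤ _ by simp; omega, ?_⟩
    refine Ok.does hs' ?_ (Nat.le_of_ble_eq_true rfl) ⟨hbl', ?_⟩
    · simp [-List.length_flatten, h14, h2, h17, h30, h31, h32, m1, m2, t1, t2]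
      omega
    · simp only [exec]
      simp [-List.length_flatten, h14, h2, h17, h30, h31, h32, m1, m2, m3, t1, t2, hsub]
      refine ⟨by omega, by omega, by simp [nonemptyCount, blockSizes]; omega, ?_, ?_⟩
      · intro i b c hb hi
        by_cases hit : i = todo.length
        · subst hit
          have hba : a = (b, c) := by rw [hbl'] at hb; simpa using hb
          subst hba
          simp only [Function.update_self]
          exact ⟨by simpa using hVa, by rw [hfl]; simp only [List.length_append]; omega⟩
        · have := hst' i (b, c) hb (by simp; omega)
          rw [m3] at this
          simpa [hit, -List.length_flatten] using this
      · intro i hi hib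
        by_cases hit : i = todo.length
        · subst hit
          simp [hdrop]
        · simp [hit]
          exact hid i (by simp; omega) hib
  · rintro done s' hs' hfr ⟨-, h14, -⟩
    exact ⟨by simp, by simpa using h14⟩
  · refine ⟨by simp, by simp [h.reg_pos, h0], by simp [h.reg_sp, length_blockSizes],
      by simp [h.reg_vtop], by simp, by simp, by simp [nonemptyCount, blockSizes], ?_, ?_⟩
    · intro i a hi hle
      have := (List.getElem?_eq_some_iff.1 hi).1
      omega
    · intro i h₁ h₂
      omega
  · rintro s₂ ⟨hs₂, hfr, -, -, h2, -, h30, h31, h32, hst', hid⟩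
    have e0 := hfr.1 0 (by simp)
    have e1 := hfr.1 1 (by simp)
    have e3 := hfr.1 3 (by simp)
    have e4 := hfr.1 4 (by simp)
    have e5 := hfr.1 5 (by simp)
    have e6 := hfr.1 6 (by simp)
    have e7 := hfr.1 7 (by simp)
    have e27 := hfr.1 27 (by simp)
    have m := fun a (ha : a < 7) => hfr.2 a (by simp; omega)
    simp [h.reg_pos, h0] at e0 e1 e3 e4 e5 e6 e7 e27 m
    constructor
    · constructor <;> simp [-List.length_flatten, -List.length_append, e0, e1, e3, e4, e5, e6, e7,
        m, h2, h.reg_length, h.code, h.reg_vtop, h.vertices, h.reg_etop, h.edges, h.reg_tri,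
        h.reg_flag, h.reg_inc]
      · exact h.stack.of_append
      · simpa using h.marks
    · exact ⟨by simpa [m] using h.stack, fun i a hi => hst' i a hi (Nat.zero_le _),
        fun i hi => hid i (Nat.zero_le _) hi, e27, h30, h31, h32⟩

/-- Adds the edges and triangles of a substitution that meet exactly two arguments. The edges of
the pattern are stored in the arrays `9` and `10`. -/
def joinArgs : RamProg :=
  set 28 0 ;;
  loop (reg 21 - reg 28) (
    (set 33 (mem 9 (reg 28)) ;;
      set 34 (mem 10 (reg 28)) ;;
      set 28 (reg 28 + 1) ;;
      set 35 (mem 1 (reg 2 + reg 33)) ;;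
      set 12 (mem 1 (reg 2 + reg 34)) ;;
      set 5 (reg 5 + (mem 2 (reg 2 + reg 33) * reg 12 + mem 2 (reg 2 + reg 34) * reg 35)) ;;
      set 31 (reg 31 + reg 35 * reg 12) ;;
      set 10 (mem 7 (reg 33)) ;;
      set 11 (mem 7 (reg 34)) ;;
      set 13 (reg 6 * (reg 35 * reg 12))) ;;
    appendEdges) ;;
  store 1 (reg 2) (reg 30) ;;
  store 2 (reg 2) (reg 31) ;;
  set 2 (reg 2 + 1)

/-- Vertex and edge counts suffice for the triangles that meet two arguments. Apart from listing
edges, each pattern edge takes constant time; with `f = 0` the time is linear in the number of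
pattern edges. -/
theorem joinArgs_does {B D : ℕ} {s : RamState} (hs : s.Fits B) {w : List ℕ} {f pos : ℕ}
    {st : List (ℕ × ℕ)} {bl : List (List ℕ × ℕ)} {vs : List ℕ} {ed P : List (ℕ × ℕ)} {tri hi : ℕ}
    (h : EvalState w f pos st vs ed tri hi s) (ha : ArgState st bl vs.length s) (hf : f ≤ 1)
    (h21 : s.reg 21 = P.length) (hP : HoldsPairs (s.mem 9) (s.mem 10) P)
    (hPbl : ∀ p ∈ P, p.1 < bl.length ∧ p.2 < bl.length)
    (hB : 4 * D ≤ B) (hPD : P.length + 1 ≤ D)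
    (hst : st.length + bl.length + 1 ≤ D) (hvs : vs.length ≤ D)
    (hed : ed.length + (blockEdges P (bl.map Prod.fst)).length ≤ D)
    (hm : (bl.map Prod.snd).sum + (blockEdges P (bl.map Prod.fst)).length ≤ D)
    (htri : tri + crossTri P (blockSizes bl) ≤ D) :
    joinArgs.Does B s
      (200 * (P.length + 1 + (listIf f (blockEdges P (bl.map Prod.fst))).length))
      (EvalState w f pos (st ++ [((bl.map Prod.fst).flatten.length,
        (bl.map Prod.snd).sum + (blockEdges P (bl.map Prod.fst)).length)])
        vs (ed ++ listIf f (blockEdges P (bl.map Prod.fst)))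
        (tri + crossTri P (blockSizes bl)) hi) := by
  unfold joinArgs
  refine Does.seq hs (T₁ := 10)
    (T₂ := 180 * P.length + 60 * (listIf f (blockEdges P (bl.map Prod.fst))).length + 40)
    (Q := fun s' => s' = exec _ s) (Ok.does hs (by simp) (Nat.le_of_ble_eq_true rfl) rfl) ?_
    (by omega)
  rintro s₁ hs₁ - rfl
  refine Does.seq hs₁
    (T₁ := 180 * P.length + 60 * (listIf f (blockEdges P (bl.map Prod.fst))).length + 4)
    (T₂ := 20)
    ((Does.loop_list (fun done todo s' => done ++ todo = P ∧ s'.reg 28 = done.length ∧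
      s'.reg 5 = tri + crossTri done (blockSizes bl) ∧
      s'.reg 31 = (bl.map Prod.snd).sum + (blockEdges done (bl.map Prod.fst)).length ∧
      HoldsPairs (s'.mem 4) (s'.mem 5) (ed ++ listIf f (blockEdges done (bl.map Prod.fst))) ∧
      s'.reg 4 = (ed ++ listIf f (blockEdges done (bl.map Prod.fst))).length)
      (fun p => 170 + 60 * (listIf f (blockEdges [p] (bl.map Prod.fst))).length) _ ?_ ?_ hs₁ P
      ?_).mono ?_ fun _ h => h) ?_ (by omega)
  · rintro done p todo s' hs' hfr ⟨hdt, h28, h5, h31, hH, h4⟩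
    have e2 := hfr.1 2 (by simp [appendEdges])
    have e6 := hfr.1 6 (by simp [appendEdges])
    have e21 := hfr.1 21 (by simp [appendEdges])
    have m1 := hfr.2 1 (by simp [appendEdges])
    have m2 := hfr.2 2 (by simp [appendEdges])
    have m3 := hfr.2 3 (by simp [appendEdges])
    have m7 := hfr.2 7 (by simp [appendEdges])
    have m9 := hfr.2 9 (by simp [appendEdges])
    have m10 := hfr.2 10 (by simp [appendEdges])
    simp [h.reg_sp, h.reg_flag, h21] at e2 e6 e21 m1 m2 m3 m7 m9 m10
    have hp : p ∈ P := by rw [← hdt]; simp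
    have hlen : done.length + (todo.length + 1) = P.length := by rw [← hdt]; simp
    obtain ⟨p₁, p₂⟩ := hPbl p hp
    obtain ⟨q₁, q₂⟩ := hP done.length p (by rw [← hdt]; simp)
    obtain ⟨a, ha₁⟩ : ∃ a, bl[p.1]? = some a := ⟨_, List.getElem?_eq_getElem p₁⟩
    obtain ⟨b, hb₁⟩ : ∃ b, bl[p.2]? = some b := ⟨_, List.getElem?_eq_getElem p₂⟩
    obtain ⟨a₁, a₂⟩ := ha.sizes (st.length + p.1) (a.1.length, a.2) (by
      rw [List.getElem?_append_right (by omega)]; simp [blockSizes, ha₁])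
    obtain ⟨b₁, b₂⟩ := ha.sizes (st.length + p.2) (b.1.length, b.2) (by
      rw [List.getElem?_append_right (by omega)]; simp [blockSizes, hb₁])
    obtain ⟨sa, sa'⟩ := ha.starts _ _ ha₁
    obtain ⟨sb, sb'⟩ := ha.starts _ _ hb₁
    have hbe : blockEdges [p] (bl.map Prod.fst) = a.1 ×ˢ b.1 := by
      simp [blockEdges, List.getD_eq_getElem?_getD, ha₁, hb₁]
    have hct : crossTri [p] (blockSizes bl) = a.2 * b.1.length + b.2 * a.1.length := by
      simp [crossTri, blockSizes, List.getD_eq_getElem?_getD, ha₁, hb₁]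
    have hbd : (blockEdges done (bl.map Prod.fst)).length + a.1.length * b.1.length ≤
        (blockEdges P (bl.map Prod.fst)).length := by
      rw [← hdt, List.append_cons, blockEdges_append, blockEdges_append, hbe]
      simp only [List.length_append, List.length_product]
      omega
    have hcd : crossTri done (blockSizes bl) + (a.2 * b.1.length + b.2 * a.1.length) ≤
        crossTri P (blockSizes bl) := by
      rw [← hdt, List.append_cons, crossTri_append, crossTri_append, hct]
      omega
    have hX : (listIf f (a.1 ×ˢ b.1)).length = f * (a.1.length * b.1.length) := by
      rw [length_listIf hf, List.length_product]
    have hfX : f * (a.1.length * b.1.length) ≤ a.1.length * b.1.length := by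
      simpa using Nat.mul_le_mul_right (a.1.length * b.1.length) hf
    have hlf : (listIf f (blockEdges done (bl.map Prod.fst))).length ≤
        (blockEdges done (bl.map Prod.fst)).length := by
      rw [length_listIf hf]
      simpa using Nat.mul_le_mul_right (blockEdges done (bl.map Prod.fst)).length hf
    simp only [List.length_append] at h4
    rw [hbe]
    refine ⟨by simp, by simp [e21, h28]; omega, ?_⟩
    refine Does.seq hs' (T₁ := 90) (T₂ := 60 * (f * (a.1.length * b.1.length)) + 60)
      (Q := fun s'' => s'' = exec _ s') (Ok.does hs' ?_ (Nat.le_of_ble_eq_true rfl) rfl) ?_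
      (by omega)
    · simp [h28, h5, h31, e2, e6, m1, m2, m7, m9, m10, q₁, q₂, a₁, a₂, b₁, b₂]
      omega
    rintro s₂ hs₂ - rfl
    refine ((appendEdges_does hs₂ (a := a.1) (b := b.1) (f := f)
      (ed := ed ++ listIf f (blockEdges done (bl.map Prod.fst))) ?_ ?_ ?_ ?_ ?_ ?_ ?_).strong
        hs₂).mono (by rw [hX]) ?_
    · simpa using hH
    · simpa using h4
    · simpa [m3, m7, m9, h28, q₁] using sa
    · simpa [m3, m7, m10, h28, q₂] using sb
    · simp [h28, m1, m10, q₂, e2, b₁]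
    · rw [hX]
      simp [h28, m1, m9, m10, q₁, q₂, e2, e6, a₁, b₁]
    · rw [hX]
      simp [h28, m7, m9, m10, q₁, q₂]
      omega
    rintro s₃ ⟨hs₃, hfr₃, hH₃, h4₃⟩
    have g5 := hfr₃.1 5 (by simp [appendEdges])
    have g28 := hfr₃.1 28 (by simp [appendEdges])
    have g31 := hfr₃.1 31 (by simp [appendEdges])
    simp [h28, h5, h31, m1, m2, m9, m10, q₁, q₂, e2, a₁, a₂, b₁, b₂] at g5 g28 g31
    rw [blockEdges_append, crossTri_append, hbe, hct, listIf_append, ← List.append_assoc]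
    refine ⟨by simpa using hdt, by simp [g28], by rw [g5]; ring, ?_, hH₃, ?_⟩
    · rw [g31, List.length_append, List.length_product]; ring
    · rw [h4₃]; simp [Nat.add_assoc]
  · rintro done s' hs' hfr ⟨hdt, h28, -⟩
    have e21 := hfr.1 21 (by simp [appendEdges])
    simp at e21
    rw [List.append_nil] at hdt
    simp [e21, h21, h28, hdt]
  · simp [crossTri, blockEdges, h.reg_tri, ha.reg_edges, listIf, h.edges, h.reg_etop]
  · have : ∀ P : List (ℕ × ℕ), (P.map fun a => 170 +
        60 * (listIf f (blockEdges [a] (bl.map Prod.fst))).length + (3 + 1)).sum =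
        174 * P.length + 60 * (listIf f (blockEdges P (bl.map Prod.fst))).length := by
      intro P
      induction P with
      | nil => simp [blockEdges, listIf]
      | cons p P ih =>
        rw [List.map_cons, List.sum_cons, ih, List.length_cons,
          show blockEdges (p :: P) (bl.map Prod.fst) = _ from blockEdges_append [p] P _,
          listIf_append, List.length_append]
        ring
    have h3 : (reg 21 - reg 28).cost = 3 := rfl
    rw [h3, this]
    omega
  · rintro s₂ hs₂ hfr ⟨-, h28, h5, h31, hH, h4⟩
    have e0 := hfr.1 0 (by simp [appendEdges])
    have e1 := hfr.1 1 (by simp [appendEdges])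
    have e2 := hfr.1 2 (by simp [appendEdges])
    have e3 := hfr.1 3 (by simp [appendEdges])
    have e6 := hfr.1 6 (by simp [appendEdges])
    have e7 := hfr.1 7 (by simp [appendEdges])
    have e30 := hfr.1 30 (by simp [appendEdges])
    have m0 := hfr.2 0 (by simp [appendEdges])
    have m1 := hfr.2 1 (by simp [appendEdges])
    have m2 := hfr.2 2 (by simp [appendEdges])
    have m3 := hfr.2 3 (by simp [appendEdges])
    have m6 := hfr.2 6 (by simp [appendEdges])
    simp [h.reg_sp, ha.reg_verts, -List.length_flatten] at e0 e1 e2 e3 e6 e7 e30 m0 m1 m2 m3 m6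
    refine Ok.does hs₂ ?_ (Nat.le_of_ble_eq_true rfl) ?_
    · simp [e2]
      omega
    · have hstk := h.stack.snoc ((bl.map Prod.fst).flatten.length)
        ((bl.map Prod.snd).sum + (blockEdges P (bl.map Prod.fst)).length)
      constructor <;> simp [-List.length_flatten, e0, e1, e2, e3, e6, e7, e30, h31, m0, m1, m2, m3,
        m6, h.reg_length, h.code, h.reg_pos, h.reg_vtop, h.vertices, h.reg_flag, h.reg_inc, h5]
      · exact hstk
      · simpa using h4
      · exact hH
      · exact h.marks

end RamProg

/-! ### Substitution into patterns of bounded tree-depth -/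

theorem EvalState.congr_of_pos_tri {w : List ℕ} {f pos pos' : ℕ} {stk ed : List (ℕ × ℕ)}
    {vs : List ℕ} {tri tri' hi : ℕ} {s s' : RamState} (h : EvalState w f pos stk vs ed tri hi s)
    (hr : ∀ r < 8, r ≠ 1 → r ≠ 5 → s'.reg r = s.reg r) (hm : ∀ a < 7, s'.mem a = s.mem a)
    (h1 : s'.reg 1 = pos') (h5 : s'.reg 5 = tri') : EvalState w f pos' stk vs ed tri' hi s' := by
  obtain ⟨h1, h2, h3, h4, h5, h6, h7, h8, h9, h10, h11, h12, h13⟩ := h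
  constructor <;> simp_all

/-- The number of vertices of an argument. -/
def blockWeight (bl : List (List ℕ × ℕ)) (v : ℕ) : ℕ := ((blockSizes bl).getD v (0, 0)).1

theorem blockWeight_of_lt {bl : List (List ℕ × ℕ)} {v : ℕ} (hv : v < bl.length) :
    blockWeight bl v = bl[v].1.length := by
  simp [blockWeight, blockSizes, List.getD_eq_getElem?_getD, hv]

theorem ArgState.weight {st : List (ℕ × ℕ)} {bl : List (List ℕ × ℕ)} {vn : ℕ} {s : RamState}
    (h : ArgState st bl vn s) {v : ℕ} (hv : v < bl.length) :
    s.mem 1 (st.length + v) = blockWeight bl v := by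
  rw [blockWeight_of_lt hv]
  exact (h.sizes (st.length + v) (bl[v].1.length, bl[v].2) (by
    rw [List.getElem?_append_right (by omega)]; simp [blockSizes, hv])).1

theorem blockWeight_le {bl : List (List ℕ × ℕ)} {E : ℕ} (hE : ∀ a ∈ bl, a.1.length ≤ E) (v : ℕ) :
    blockWeight bl v ≤ E := by
  by_cases hv : v < bl.length
  · rw [blockWeight_of_lt hv]
    exact hE _ (List.getElem_mem _)
  · simp [blockWeight, List.getD_eq_getElem?_getD, length_blockSizes, not_lt.1 hv]

namespace RamProg

open RamTerm

/-- Replaces the topmost operands by their substitution into a pattern that is given by a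
tree-depth expression. -/
def substTdStep : RamProg :=
  popArgs ;;
  (set 23 (reg 1 + 3) ;;
    set 24 (reg 23 + mem 0 (reg 1 + 2)) ;;
    set 25 0 ;;
    set 21 0 ;;
    set 22 0 ;;
    set 14 0) ;;
  loop (reg 27 - reg 14) (
    store 12 (reg 14) 0 ;;
    set 14 (reg 14 + 1)) ;;
  loop (reg 24 - reg 23) patternStep ;;
  (set 5 (reg 5 + reg 22) ;;
    set 1 (reg 24)) ;;
  joinArgs

/-- The inner evaluation computes the weight of the triangles over three arguments and leaves the
pattern edges of nonzero weight in the arrays that `joinArgs` reads. The marks of the pattern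
vertices are cleared beforehand. -/
theorem substTdStep_does {B D E : ℕ} {s : RamState} (hs : s.Fits B) {w pre post : List ℕ} {f : ℕ}
    {st : List (ℕ × ℕ)} {bl : List (List ℕ × ℕ)} {vs : List ℕ} {ed : List (ℕ × ℕ)} {tri hi : ℕ}
    {H : GExpr} (hTd : H.IsTd) (hwf : H.WellFormed) (hH : ∀ v ∈ H.verts, v < bl.length)
    (h : EvalState w f pre.length (st ++ blockSizes bl) (vs ++ (bl.map Prod.fst).flatten) ed tri hi s)
    (hw : w = pre ++ ([6, bl.length, H.code.length] ++ H.code) ++ post) (hf : f ≤ 1)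
    (hB : 4 * D ≤ B) (hwD : w.length + 1 ≤ D) (hE : ∀ a ∈ bl, a.1.length ≤ E)
    (hE₃ : E ^ 3 ≤ D) (hE₂ : E ^ 2 ≤ D) (hst : st.length + bl.length + 1 ≤ D)
    (hvs : vs.length + (bl.map Prod.fst).flatten.length ≤ D)
    (hed : ed.length + (blockEdges (H.fel (blockWeight bl)) (bl.map Prod.fst)).length ≤ D)
    (hm : (bl.map Prod.snd).sum +
      (blockEdges (H.fel (blockWeight bl)) (bl.map Prod.fst)).length ≤ D)
    (htri : tri + H.wt (blockWeight bl) +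
      crossTri (H.fel (blockWeight bl)) (blockSizes bl) ≤ D) :
    substTdStep.Does B s (400 * (bl.length + 1 + H.code.length + H.pct (blockWeight bl) +
        (listIf f (blockEdges (H.fel (blockWeight bl)) (bl.map Prod.fst))).length))
      (EvalState w f (pre.length + (3 + H.code.length))
        (st ++ [((bl.map Prod.fst).flatten.length, (bl.map Prod.snd).sum +
          (blockEdges (H.fel (blockWeight bl)) (bl.map Prod.fst)).length)])
        (vs ++ (bl.map Prod.fst).flatten)
        (ed ++ listIf f (blockEdges (H.fel (blockWeight bl)) (bl.map Prod.fst)))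
        (tri + H.wt (blockWeight bl) + crossTri (H.fel (blockWeight bl)) (blockSizes bl)) hi) := by
  have hwl := congrArg List.length hw
  simp only [List.length_append, List.length_cons, List.length_nil, Nat.zero_add] at hwl
  have hseg := h.code_at hw
  have h1 := hseg 1 _ rfl
  have h2 := hseg 2 _ rfl
  set n := blockWeight bl with hn
  have hfel : (H.fel n).length ≤ H.code.length :=
    (List.length_filter_le _ _).trans hTd.length_el_le
  unfold substTdStep
  refine Does.seq hs (T₁ := 100 * (bl.length + 1))
    (T₂ := 30 * bl.length + 220 * H.code.length + 320 * H.pct n +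
      200 * (listIf f (blockEdges (H.fel n) (bl.map Prod.fst))).length + 290)
    (popArgs_does (D := D) hs h (by rw [hw]; simp) hB (by omega) hst hvs (by omega)) ?_ (by omega)
  rintro s₁ hs₁ - ⟨h₁, a₁⟩
  have c2 := h₁.code_at hw 2 _ rfl
  refine Does.seq hs₁ (T₁ := 40)
    (T₂ := 30 * bl.length + 220 * H.code.length + 320 * H.pct n +
      200 * (listIf f (blockEdges (H.fel n) (bl.map Prod.fst))).length + 250)
    (Q := fun s' => s' = exec _ s₁) (Ok.does hs₁ ?_ (Nat.le_of_ble_eq_true rfl) rfl) ?_ (by omega)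
  · simp [h₁.reg_pos, c2]; omega
  rintro s₂ hs₂ - rfl
  refine Does.seq hs₂ (T₁ := 30 * bl.length + 30)
    (T₂ := 200 * H.code.length + 320 * H.pct n +
      200 * (listIf f (blockEdges (H.fel n) (bl.map Prod.fst))).length + 220)
    ((Does.loop_list_const (c := 20) (k := 30) (hk := Nat.le_of_ble_eq_true rfl)
      (fun done todo s' => done ++ todo = List.range bl.length ∧ s'.reg 14 = done.length ∧
        ∀ v < done.length, s'.mem 12 v = 0) _ ?_ ?_ hs₂ (List.range bl.length) ?_).mono
      (by rw [List.length_range]) fun _ h => h) ?_ (by omega)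
  · rintro done v todo s' hs' hfr ⟨hdt, h14, hz⟩
    have e27 := hfr.1 27 (by simp)
    simp [a₁.reg_count] at e27
    have hlen := congrArg List.length hdt
    simp at hlen
    refine ⟨by simp, by simp [e27, h14]; omega, Ok.does hs' ?_ (Nat.le_of_ble_eq_true rfl) ?_⟩
    · simp [h14]; omega
    · simp [h14]
      refine ⟨hdt, fun u hu => ?_⟩
      by_cases hu' : u = done.length
      · simp [hu']
      · simp [hu', hz u (by omega)]
  · rintro done s' hs' hfr ⟨hdt, h14, -⟩
    have e27 := hfr.1 27 (by simp)
    simp [a₁.reg_count] at e27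
    have hlen := congrArg List.length hdt
    simp at hlen
    simp [e27, h14, hlen]
  · simp
  rintro s₃ hs₃ hfr₃ ⟨-, -, hz⟩
  have e := fun r (hr : r ≠ 14) => hfr₃.1 r (by simpa using hr)
  have m := fun a (ha : a ≠ 12) => hfr₃.2 a (by simpa using ha)
  rw [List.length_range] at hz
  -- The weights are read from the stack entries of the popped arguments, which begin at position
  -- `st.length`.
  have hP : PatternState w st.length bl.length (pre ++ [6, bl.length, H.code.length] ++ H.code).length n
      (pre ++ [6, bl.length, H.code.length]).length [] [] 0 s₃ := by
    constructor
    · rw [m 0 (by simp)]; exact h₁.code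
    · rw [e 2 (by simp)]; simp [h₁.reg_sp]
    · intro v hv
      rw [m 1 (by simp)]; exact a₁.weight hv
    · rw [e 23 (by simp)]; simp [h₁.reg_pos]
    · rw [e 24 (by simp)]; simp [h₁.reg_pos, c2]; omega
    · rw [e 25 (by simp)]; simp
    · intro i x hx; simp at hx
    · rw [e 21 (by simp)]; simp
    · intro i x hx; simp at hx
    · rw [e 22 (by simp)]; simp
    · exact hz
  obtain ⟨T, s₄, hr, hT, hs₄, h₄⟩ := evaluatesPattern (B := B) (D := D)
    (pend := (pre ++ [6, bl.length, H.code.length] ++ H.code).length) (w := w) (n := n) hB (by omega)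
    (fun v _ => blockWeight_le hE v) hE₃ hE₂ (by omega) hTd hwf hH (post := post) (by simpa using hw) hP hs₃
    (le_of_eq (by simp only [List.length_append])) (by simp; omega) (by simp; omega) (by omega)
  refine Does.seq hs₃ (T₁ := 320 * H.pct n + 4)
    (T₂ := 200 * H.code.length +
      200 * (listIf f (blockEdges (H.fel n) (bl.map Prod.fst))).length + 216)
    (hr.does hs₄ (by simp) (by simp [h₄.reg_pos, h₄.reg_end]; omega) (Q := fun s => s = s₄) rfl
      (by have : (reg 24 - reg 23).cost = 3 := rfl
          omega)) ?_ (by omega)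
  intro s' _ _ hs'
  rw [hs']
  have e₄ : ∀ r, (r < 8 ∨ (27 ≤ r ∧ r < 33)) → s₄.reg r = s₁.reg r := by
    intro r hr'
    rw [hr.2.1 r (by simp [patternStep, patternInc, patternUnion, patternEmpty, incLoops]; omega),
      e r (by omega)]
    simp
    repeat rw [Function.update_of_ne (by omega)]
  have m₄ : ∀ a < 9, s₄.mem a = s₁.mem a := by
    intro a ha'
    rw [hr.2.2 a (by simp [patternStep, patternInc, patternUnion, patternEmpty, incLoops]; omega),
      m a (by omega)]
    simp
  refine Does.seq hs₄ (T₁ := 10) (T₂ := 200 * H.code.length +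
      200 * (listIf f (blockEdges (H.fel n) (bl.map Prod.fst))).length + 200)
    (Q := fun s' => s' = exec _ _) (Ok.does hs₄ ?_ (Nat.le_of_ble_eq_true rfl) rfl) ?_ (by omega)
  · simp [h₄.reg_acc, e₄ 5 (by simp), h₁.reg_tri]; omega
  rintro s₅ hs₅ - rfl
  refine (joinArgs_does (D := D) (P := H.fel n) (bl := bl) hs₅ (h₁.congr_of_pos_tri
    (tri' := tri + H.wt n) (pos' := pre.length + (3 + H.code.length)) ?_ ?_ ?_ ?_)
    (a₁.congr ?_ ?_) hf ?_ ?_ ?_ hB (by omega) hst ?_ hed hm htri).mono (by omega) fun _ h => h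
  · intro r hr h1 h5
    simp [h1, h5, e₄ r (by omega)]
  · intro a ha
    simp [m₄ a (by omega)]
  · simp [h₄.reg_end]; omega
  · simp [h₄.reg_acc, e₄ 5 (by simp), h₁.reg_tri]
  · intro r hr h33
    simp [e₄ r (by omega), show r ≠ 1 by omega, show r ≠ 5 by omega]
  · intro a ha
    simp [m₄ a (by omega)]
  · simpa using h₄.reg_top
  · simpa using h₄.edges
  · intro p hp
    have := hwf.isEdgeList.1 p (List.mem_of_mem_filter hp)
    exact ⟨hH _ this.1, hH _ this.2⟩
  · simpa using hvs

end RamProg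

/-! ### Substitution into small patterns -/

/-- The number of nonempty arguments after an argument. -/
def nonemptyAfter (bl : List (List ℕ × ℕ)) (v : ℕ) : ℕ :=
  nonemptyCount (blockSizes (bl.drop (v + 1)))

/-- `σ` inverts the numbering of the nonempty arguments. In the induction a nonempty first argument
receives the largest number, and the others keep theirs. -/
theorem exists_enum (bl : List (List ℕ × ℕ)) : ∃ σ : ℕ → ℕ,
    (∀ i < nonemptyCount (blockSizes bl), σ i < bl.length ∧ blockWeight bl (σ i) ≠ 0 ∧
      nonemptyAfter bl (σ i) = i) ∧
    ∀ v < bl.length, blockWeight bl v ≠ 0 →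
      nonemptyAfter bl v < nonemptyCount (blockSizes bl) ∧ σ (nonemptyAfter bl v) = v := by
  induction bl with
  | nil => exact ⟨id, by simp [nonemptyCount, blockSizes], by simp⟩
  | cons a bl ih =>
    obtain ⟨σ, h₁, h₂⟩ := ih
    have hc : nonemptyCount (blockSizes (a :: bl)) =
        (1 - (1 - a.1.length)) + nonemptyCount (blockSizes bl) := by
      simp [nonemptyCount, blockSizes]
    have hw : ∀ v, blockWeight (a :: bl) (v + 1) = blockWeight bl v := fun v => rfl
    have hw0 : blockWeight (a :: bl) 0 = a.1.length := rfl
    have ha : ∀ v, nonemptyAfter (a :: bl) (v + 1) = nonemptyAfter bl v := fun v => rfl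
    have ha0 : nonemptyAfter (a :: bl) 0 = nonemptyCount (blockSizes bl) := rfl
    refine ⟨fun i => if i < nonemptyCount (blockSizes bl) then σ i + 1 else 0, ?_, ?_⟩
    · intro i hi
      dsimp only
      split_ifs with h
      · obtain ⟨q₁, q₂, q₃⟩ := h₁ i h
        exact ⟨by simpa using q₁, q₂, q₃⟩
      · refine ⟨by simp, ?_, ?_⟩
        · rw [hw0]; omega
        · rw [ha0]; omega
    · rintro (_ | v) hv hv'
      · rw [hw0] at hv'
        rw [ha0]
        exact ⟨by omega, by simp⟩
      · obtain ⟨q₁, q₂⟩ := h₂ v (by simpa using hv) hv'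
        rw [ha]
        exact ⟨by omega, by simp [q₁, q₂]⟩

theorem List.getElem?_flatMap_pair (l : List (ℕ × ℕ)) {i : ℕ} {p : ℕ × ℕ} (h : l[i]? = some p) :
    (l.flatMap fun p => [p.1, p.2])[2 * i]? = some p.1 ∧
      (l.flatMap fun p => [p.1, p.2])[2 * i + 1]? = some p.2 := by
  induction l generalizing i with
  | nil => simp at h
  | cons a l ih =>
    cases i with
    | zero => simp at h; simp [h]
    | succ i =>
      obtain ⟨h₁, h₂⟩ := ih (by simpa using h)
      rw [show 2 * (i + 1) = 2 * i + 1 + 1 by ring]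
      simpa using ⟨h₁, h₂⟩

theorem pairAdj_append_singleton (P : List (ℕ × ℕ)) (p : ℕ × ℕ) (u v : ℕ) :
    pairAdj (P ++ [p]) u v = if (u = p.1 ∧ v = p.2) ∨ (u = p.2 ∧ v = p.1) then 1
      else pairAdj P u v := by
  unfold pairAdj
  obtain ⟨a, b⟩ := p
  simp only [List.mem_append, List.mem_singleton, Prod.mk.injEq]
  split_ifs <;> first | rfl | (exfalso; tauto)

/-- The pattern edges between nonempty arguments. -/
def supportEdges (n : ℕ → ℕ) (P : List (ℕ × ℕ)) : List (ℕ × ℕ) :=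
  P.filter fun p => n p.1 * n p.2 ≠ 0

namespace RamProg

open RamTerm

/-- The program multiplies matrices; `M r` bounds the number of steps for `r × r` matrices. -/
def MultipliesMatrices (P : RamProg) (c : ℕ) (M : ℕ → ℕ) : Prop :=
  ∀ (r A : ℕ) (X Y : Matrix (Fin r) (Fin r) ℕ), (∀ i j, X i j ≤ A ∧ Y i j ≤ A) →
    ∀ (B : ℕ) (s : RamState), (r + A + 2) ^ c ≤ B → s.Fits B → s.reg 0 = r →
      (∀ i j : Fin r, s.mem 0 (i * r + j) = X i j ∧ s.mem 1 (i * r + j) = Y i j) →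
      P.Does B s (M r) fun s' => ∀ i j : Fin r, s'.mem 2 (i * r + j) = (X * Y) i j

/-- Selects the edges of the pattern between nonempty arguments. -/
def selectEdges : RamProg :=
  (set 36 (mem 0 (reg 1 + 2)) ;;
    set 21 0 ;;
    set 14 0) ;;
  loop (reg 36 - reg 14) (
    set 33 (mem 0 (reg 1 + (3 + 2 * reg 14))) ;;
    set 34 (mem 0 (reg 1 + (3 + 2 * reg 14 + 1))) ;;
    store 9 (reg 21) (reg 33) ;;
    store 10 (reg 21) (reg 34) ;;
    set 21 (reg 21 + (1 - (1 - mem 1 (reg 2 + reg 33) * mem 1 (reg 2 + reg 34)))) ;;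
    set 14 (reg 14 + 1))

/-- Writes the factors of the matrix product. -/
def fillMatrices : RamProg :=
  set 14 0 ;;
  loop (reg 32 * reg 32 - reg 14) (
    store 50 (reg 14) 0 ;;
    store 51 (reg 14) 0 ;;
    set 14 (reg 14 + 1)) ;;
  set 14 0 ;;
  loop (reg 21 - reg 14) (
    set 33 (mem 9 (reg 14)) ;;
    set 34 (mem 10 (reg 14)) ;;
    set 12 (mem 8 (reg 33) * reg 32 + mem 8 (reg 34)) ;;
    set 13 (mem 8 (reg 34) * reg 32 + mem 8 (reg 33)) ;;
    store 50 (reg 12) (mem 1 (reg 2 + reg 34)) ;;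
    store 50 (reg 13) (mem 1 (reg 2 + reg 33)) ;;
    store 51 (reg 12) 1 ;;
    store 51 (reg 13) 1 ;;
    set 14 (reg 14 + 1))

/-- Computes the weighted sum of the matrix product over the edges of the pattern. -/
def sumProduct : RamProg :=
  (set 14 0 ;;
    set 22 0) ;;
  loop (reg 21 - reg 14) (
    set 33 (mem 9 (reg 14)) ;;
    set 34 (mem 10 (reg 14)) ;;
    set 22 (reg 22 + mem 1 (reg 2 + reg 33) * mem 1 (reg 2 + reg 34) *
      mem 52 (mem 8 (reg 33) * reg 32 + mem 8 (reg 34))) ;;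
    set 14 (reg 14 + 1))

/-- Every pair is written to the end of the list, and the end moves only if both weights are
nonzero, so a rejected pair is overwritten. -/
theorem selectEdges_does {B D : ℕ} {s : RamState} (hs : s.Fits B) {pos b t : ℕ}
    {n : ℕ → ℕ} {P : List (ℕ × ℕ)} (h1 : s.reg 1 = pos) (h2 : s.reg 2 = b)
    (hq : s.mem 0 (pos + 2) = P.length)
    (hcode : HoldsAt (s.mem 0) (pos + 3) (P.flatMap fun p => [p.1, p.2]))
    (hn : ∀ v < t, s.mem 1 (b + v) = n v) (hP : ∀ p ∈ P, p.1 < t ∧ p.2 < t)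
    (hnn : ∀ p ∈ P, n p.1 * n p.2 ≤ D) (hB : 4 * D ≤ B) (hpos : pos + 3 + 2 * P.length + 1 ≤ D)
    (hbt : b + t ≤ D) :
    selectEdges.Does B s (100 * (P.length + 1)) fun s' => s'.reg 36 = P.length ∧
      s'.reg 21 = (supportEdges n P).length ∧
      HoldsPairs (s'.mem 9) (s'.mem 10) (supportEdges n P) := by
  unfold selectEdges
  refine Does.seq hs (T₁ := 20) (T₂ := 80 * P.length + 80)
    (Q := fun s' => s' = exec _ s) (Ok.does hs ?_ (Nat.le_of_ble_eq_true rfl) rfl) ?_ (by omega)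
  · simp [h1]; omega
  rintro s₁ hs₁ - rfl
  refine ((Does.loop_list_const (c := 70) (k := 80) (hk := Nat.le_of_ble_eq_true rfl)
    (fun done todo s' => done ++ todo = P ∧ s'.reg 14 = done.length ∧
      s'.reg 21 = (supportEdges n done).length ∧
      HoldsPairs (s'.mem 9) (s'.mem 10) (supportEdges n done)) _ ?_ ?_ hs₁ P ?_).strong hs₁).mono
    le_rfl ?_
  · rintro done p todo s' hs' hfr ⟨hdt, h14, h21, hH⟩
    have e1 := hfr.1 1 (by simp)
    have e2 := hfr.1 2 (by simp)
    have e36 := hfr.1 36 (by simp)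
    have m0 := hfr.2 0 (by simp)
    have m1 := hfr.2 1 (by simp)
    simp [h1, h2, hq] at e1 e2 e36 m0 m1
    have hlen : done.length + (todo.length + 1) = P.length := by rw [← hdt]; simp
    have hp : p ∈ P := by rw [← hdt]; simp
    obtain ⟨c₁, c₂⟩ := List.getElem?_flatMap_pair P (i := done.length) (p := p)
      (by rw [← hdt]; simp)
    have c₁ := hcode _ _ c₁
    have c₂ := hcode _ _ c₂
    rw [Nat.add_assoc] at c₁ c₂
    rw [← Nat.add_assoc 3] at c₂
    obtain ⟨p₁, p₂⟩ := hP p hp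
    have n₁ := hn _ p₁
    have n₂ := hn _ p₂
    have hnp := hnn p hp
    have hle : (supportEdges n done).length ≤ done.length := List.length_filter_le _ _
    refine ⟨by simp, by simp [e36, h14]; omega, Ok.does hs' ?_ (Nat.le_of_ble_eq_true rfl) ?_⟩
    · simp [h14, e1, e2, m0, m1, c₁, c₂, n₁, n₂, h21]
      omega
    · simp [h14, e1, e2, m0, m1, c₁, c₂, n₁, n₂, h21]
      by_cases hz : n p.1 * n p.2 = 0
      · have : supportEdges n (done ++ [p]) = supportEdges n done := by
          simp [supportEdges, List.filter_append, -mul_eq_zero, hz]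
        rw [this]
        exact ⟨hdt, by simp [hz], hH.update le_rfl _ _⟩
      · have : supportEdges n (done ++ [p]) = supportEdges n done ++ [p] := by
          simp [supportEdges, List.filter_append, -mul_eq_zero, hz]
        rw [this]
        refine ⟨hdt, by simp; omega, hH.snoc _ _⟩
  · rintro done s' hs' hfr ⟨hdt, h14, -⟩
    have e36 := hfr.1 36 (by simp)
    simp [h1, hq] at e36
    rw [List.append_nil] at hdt
    simp [e36, h14, hdt]
  · refine ⟨rfl, by simp, by simp [supportEdges], ?_⟩
    intro i p hp
    simp [supportEdges] at hp
  · rintro s' ⟨-, hfr, -, -, h₁, h₂⟩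
    have e36 := hfr.1 36 (by simp)
    simp [h1, hq] at e36
    exact ⟨e36, h₁, h₂⟩

theorem mul_add_inj {r a b c d : ℕ} (hb : b < r) (hd : d < r) :
    a * r + b = c * r + d ↔ a = c ∧ b = d := by
  constructor
  · intro h
    have hr : 0 < r := by omega
    have h₁ := congrArg (· / r) h
    simp only [Nat.mul_comm _ r, Nat.mul_add_div hr, Nat.div_eq_of_lt hb, Nat.div_eq_of_lt hd] at h₁
    have hac : a = c := by simpa using h₁
    subst hac
    exact ⟨rfl, by omega⟩
  · rintro ⟨rfl, rfl⟩; rfl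

theorem mul_add_lt {r a b : ℕ} (ha : a < r) (hb : b < r) : a * r + b < r * r := by
  calc a * r + b < a * r + r := by omega
    _ = (a + 1) * r := by ring
    _ ≤ r * r := Nat.mul_le_mul_right _ ha

/-- Rows and columns are indexed by nonempty arguments only, so the `r * r` cells are affordable
even if many arguments are empty. The columns of the first factor carry the weights; hence the
product sums the weights of common neighbours. -/
theorem fillMatrices_does {B D : ℕ} {s : RamState} (hs : s.Fits B) {b t r : ℕ}
    {n id σ : ℕ → ℕ} {P : List (ℕ × ℕ)} (h2 : s.reg 2 = b) (h32 : s.reg 32 = r)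
    (hid : ∀ v < t, s.mem 8 v = id v) (hn : ∀ v < t, s.mem 1 (b + v) = n v)
    (hσ : ∀ v < t, n v ≠ 0 → id v < r ∧ σ (id v) = v)
    (h21 : s.reg 21 = P.length) (hP : HoldsPairs (s.mem 9) (s.mem 10) P)
    (hPt : ∀ p ∈ P, p.1 < t ∧ p.2 < t ∧ n p.1 ≠ 0 ∧ n p.2 ≠ 0) (hPD : P.length + 1 ≤ D)
    (hr : r * r + 1 ≤ D) (hB : 4 * D ≤ B) (hbt : b + t ≤ D) :
    fillMatrices.Does B s (120 * (P.length + r * r + 1)) fun s' =>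
      ∀ u < t, ∀ v < t, n u ≠ 0 → n v ≠ 0 →
        s'.mem 50 (id u * r + id v) = pairAdj P u v * n v ∧
        s'.mem 51 (id u * r + id v) = pairAdj P u v := by
  unfold fillMatrices
  refine Does.seq hs (T₁ := 5) (T₂ := 40 * (r * r) + 100 * P.length + 115)
    (Q := fun s' => s' = exec _ s) (Ok.does hs (by simp) (Nat.le_of_ble_eq_true rfl) rfl) ?_
    (by omega)
  rintro s₁ hs₁ - rfl
  refine Does.seq hs₁ (T₁ := 25 * (r * r) + 25) (T₂ := 100 * P.length + 85)
    ((Does.loop_list_const (c := 16) (k := 25) (hk := Nat.le_of_ble_eq_true rfl)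
      (fun done todo s' => done ++ todo = List.range (r * r) ∧ s'.reg 14 = done.length ∧
        ∀ v < done.length, s'.mem 50 v = 0 ∧ s'.mem 51 v = 0) _ ?_ ?_ hs₁ (List.range (r * r))
        ?_).mono (by rw [List.length_range]) fun _ h => h) ?_ (by omega)
  · rintro done v todo s' hs' hfr ⟨hdt, h14, hz⟩
    have e32 := hfr.1 32 (by simp)
    simp [h32] at e32
    have hlen := congrArg List.length hdt
    simp at hlen
    refine ⟨by simp [e32]; omega, by simp [e32, h14]; omega,
      Ok.does hs' ?_ (Nat.le_of_ble_eq_true rfl) ?_⟩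
    · simp [h14]; omega
    · simp [h14]
      refine ⟨hdt, fun u hu => ?_⟩
      by_cases hu' : u = done.length
      · simp [hu']
      · simp [hu', hz u (by omega)]
  · rintro done s' hs' hfr ⟨hdt, h14, -⟩
    have e32 := hfr.1 32 (by simp)
    simp [h32] at e32
    have hlen := congrArg List.length hdt
    simp at hlen
    simp [e32, h14, hlen]
    omega
  · simp
  rintro s₂ hs₂ hfr₂ ⟨-, -, hz⟩
  have e := fun a (ha : a ≠ 14) => hfr₂.1 a (by simpa using ha)
  have m := fun a (ha : a < 50) => hfr₂.2 a (by simp; omega)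
  rw [List.length_range] at hz
  refine Does.seq hs₂ (T₁ := 5) (T₂ := 100 * P.length + 80)
    (Q := fun s' => s' = exec _ s₂) (Ok.does hs₂ (by simp) (Nat.le_of_ble_eq_true rfl) rfl) ?_
    (by omega)
  rintro s₃ hs₃ - rfl
  refine (Does.loop_list_const (c := 75) (k := 80) (hk := Nat.le_of_ble_eq_true rfl)
    (fun done todo s' => done ++ todo = P ∧ s'.reg 14 = done.length ∧
      ∀ u < t, ∀ v < t, n u ≠ 0 → n v ≠ 0 →
        s'.mem 50 (id u * r + id v) = pairAdj done u v * n v ∧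
        s'.mem 51 (id u * r + id v) = pairAdj done u v) _ ?_ ?_ hs₃ P ?_).mono
    (by omega) fun _ h => h.2.2
  · rintro done p todo s' hs' hfr ⟨hdt, h14, hX⟩
    have e2 := hfr.1 2 (by simp)
    have e21 := hfr.1 21 (by simp)
    have e32 := hfr.1 32 (by simp)
    have m1 := hfr.2 1 (by simp)
    have m8 := hfr.2 8 (by simp)
    have m9 := hfr.2 9 (by simp)
    have m10 := hfr.2 10 (by simp)
    simp [e, m, h2, h21, h32] at e2 e21 e32 m1 m8 m9 m10
    have hlen : done.length + (todo.length + 1) = P.length := by rw [← hdt]; simp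
    have hp : p ∈ P := by rw [← hdt]; simp
    obtain ⟨q₁, q₂⟩ := hP done.length p (by rw [← hdt]; simp)
    obtain ⟨p₁, p₂, z₁, z₂⟩ := hPt p hp
    have n₁ := hn _ p₁
    have n₂ := hn _ p₂
    have i₁ := hid _ p₁
    have i₂ := hid _ p₂
    obtain ⟨l₁, σ₁⟩ := hσ _ p₁ z₁
    obtain ⟨l₂, σ₂⟩ := hσ _ p₂ z₂
    have b₁ := mul_add_lt l₁ l₂
    have b₂ := mul_add_lt l₂ l₁
    refine ⟨by simp, by simp [e21, h14]; omega, Ok.does hs' ?_ (Nat.le_of_ble_eq_true rfl) ?_⟩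
    · simp [h14, e2, e32, m1, m8, m9, m10, q₁, q₂, i₁, i₂, n₁, n₂]
      omega
    · simp only [exec]
      simp [h14, e2, e32, m1, m8, m9, m10, q₁, q₂, i₁, i₂, n₁, n₂]
      refine ⟨hdt, fun u hu v hv zu zv => ?_⟩
      obtain ⟨lu, σu⟩ := hσ _ hu zu
      obtain ⟨lv, σv⟩ := hσ _ hv zv
      -- Different pairs of nonempty arguments belong to different cells, so an assignment changes
      -- exactly the entry of its own pair.
      have inj : ∀ {a c : ℕ}, σ (id a) = a → σ (id c) = c → (id a = id c ↔ a = c) :=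
        fun ha hc => ⟨fun h => by rw [← ha, ← hc, h], fun h => by rw [h]⟩
      have k₁ : id u * r + id v = id p.1 * r + id p.2 ↔ u = p.1 ∧ v = p.2 := by
        rw [mul_add_inj lv l₂, inj σu σ₁, inj σv σ₂]
      have k₂ : id u * r + id v = id p.2 * r + id p.1 ↔ u = p.2 ∧ v = p.1 := by
        rw [mul_add_inj lv l₁, inj σu σ₂, inj σv σ₁]
      have old := hX u hu v hv zu zv
      rw [pairAdj_append_singleton]
      simp only [Function.update_apply, k₁, k₂]
      by_cases c₁ : u = p.1 ∧ v = p.2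
      · by_cases c₂ : u = p.2 ∧ v = p.1
        · rw [if_pos c₂]
          have h₁₂ : p.1 = p.2 := c₁.1.symm.trans c₂.1
          simp [c₁, h₁₂]
        · rw [if_neg c₂]
          simp [c₁]
      · by_cases c₂ : u = p.2 ∧ v = p.1
        · rw [if_pos c₂]
          simp [c₂]
        · simp only [c₁, c₂, if_false, or_self]
          exact old
  · rintro done s' hs' hfr ⟨hdt, h14, -⟩
    have e21 := hfr.1 21 (by simp)
    simp [e, h21] at e21
    rw [List.append_nil] at hdt
    simp [e21, h14, hdt]
  · refine ⟨rfl, by simp, fun u hu v hv zu zv => ?_⟩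
    have := hz _ (mul_add_lt (hσ u hu zu).1 (hσ v hv zv).1)
    simpa [pairAdj] using this

theorem sumProduct_does {B D : ℕ} {s : RamState} (hs : s.Fits B) {b t r : ℕ}
    {n id σ : ℕ → ℕ} {Z : ℕ → ℕ → ℕ} {P : List (ℕ × ℕ)} (h2 : s.reg 2 = b) (h32 : s.reg 32 = r)
    (hid : ∀ v < t, s.mem 8 v = id v) (hn : ∀ v < t, s.mem 1 (b + v) = n v)
    (hσ : ∀ v < t, n v ≠ 0 → id v < r ∧ σ (id v) = v)
    (h21 : s.reg 21 = P.length) (hP : HoldsPairs (s.mem 9) (s.mem 10) P)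
    (hPt : ∀ p ∈ P, p.1 < t ∧ p.2 < t ∧ n p.1 ≠ 0 ∧ n p.2 ≠ 0) (hPD : P.length + 1 ≤ D)
    (hr : r * r + 1 ≤ D) (hB : 4 * D ≤ B) (hbt : b + t ≤ D) (hnn : ∀ p ∈ P, n p.1 * n p.2 ≤ D)
    (hZ : ∀ p ∈ P, s.mem 52 (id p.1 * r + id p.2) = Z p.1 p.2)
    (hsum : (P.map fun p => n p.1 * n p.2 * Z p.1 p.2).sum ≤ D) :
    sumProduct.Does B s (100 * (P.length + 1)) fun s' =>
      s'.reg 22 = (P.map fun p => n p.1 * n p.2 * Z p.1 p.2).sum := by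
  unfold sumProduct
  refine Does.seq hs (T₁ := 5) (T₂ := 80 * P.length + 80)
    (Q := fun s' => s' = exec _ s) (Ok.does hs (by simp) (Nat.le_of_ble_eq_true rfl) rfl) ?_
    (by omega)
  rintro s₁ hs₁ - rfl
  refine (Does.loop_list_const (c := 70) (k := 80) (hk := Nat.le_of_ble_eq_true rfl)
    (fun done todo s' => done ++ todo = P ∧ s'.reg 14 = done.length ∧
      s'.reg 22 = (done.map fun p => n p.1 * n p.2 * Z p.1 p.2).sum) _ ?_ ?_ hs₁ P ?_).mono
    le_rfl fun _ h => h.2.2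
  · rintro done p todo s' hs' hfr ⟨hdt, h14, h22⟩
    have e2 := hfr.1 2 (by simp)
    have e21 := hfr.1 21 (by simp)
    have e32 := hfr.1 32 (by simp)
    have m := fun a => hfr.2 a (by simp)
    simp [h2, h21, h32] at e2 e21 e32 m
    have hlen : done.length + (todo.length + 1) = P.length := by rw [← hdt]; simp
    have hp : p ∈ P := by rw [← hdt]; simp
    obtain ⟨q₁, q₂⟩ := hP done.length p (by rw [← hdt]; simp)
    obtain ⟨p₁, p₂, z₁, z₂⟩ := hPt p hp
    have n₁ := hn _ p₁
    have n₂ := hn _ p₂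
    have i₁ := hid _ p₁
    have i₂ := hid _ p₂
    have b₁ := mul_add_lt (hσ _ p₁ z₁).1 (hσ _ p₂ z₂).1
    have hnp := hnn p hp
    have hZp := hZ p hp
    have hle : (done.map fun p => n p.1 * n p.2 * Z p.1 p.2).sum + n p.1 * n p.2 * Z p.1 p.2 ≤
        (P.map fun p => n p.1 * n p.2 * Z p.1 p.2).sum := by
      rw [← hdt]; simp
    refine ⟨by simp, by simp [e21, h14]; omega, Ok.does hs' ?_ (Nat.le_of_ble_eq_true rfl) ?_⟩
    · simp [h14, e2, e32, m, q₁, q₂, i₁, i₂, n₁, n₂, hZp, h22]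
      omega
    · simp [h14, e2, e32, m, q₁, q₂, i₁, i₂, n₁, n₂, hZp, h22, hdt]
  · rintro done s' hs' hfr ⟨hdt, h14, -⟩
    have e21 := hfr.1 21 (by simp)
    simp [h21] at e21
    rw [List.append_nil] at hdt
    simp [e21, h14, hdt]
  · simp

end RamProg

namespace RamProg

open RamTerm

/-- Replaces the topmost operands by their substitution into a pattern that is given by an edge
list; `P` is a program for matrix multiplication. -/
def substSmallStep (P : RamProg) : RamProg :=
  popArgs ;;
  selectEdges ;;
  fillMatrices ;;
  set 50 (reg 32) ;;
  P.shift 50 ;;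
  sumProduct ;;
  (set 5 (reg 5 + reg 22 / 3) ;;
    set 1 (reg 1 + (3 + 2 * reg 36))) ;;
  joinArgs

/-- Empty arguments contribute nothing, so the sum over the `r` matrix indices agrees with the sum
over all pattern vertices in `pairTri`. -/
theorem sum_range_eq_sum_enum {r t : ℕ} {n idx σ : ℕ → ℕ} {F : ℕ → ℕ}
    (h₁ : ∀ i < r, σ i < t ∧ n (σ i) ≠ 0 ∧ idx (σ i) = i)
    (h₂ : ∀ v < t, n v ≠ 0 → idx v < r ∧ σ (idx v) = v) (hF : ∀ v, n v = 0 → F v = 0) :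
    ∑ k : Fin r, F (σ k) = ∑ v ∈ Finset.range t, F v := by
  rw [Fin.sum_univ_eq_sum_range (fun k => F (σ k)) r,
    ← Finset.sum_filter_of_ne (p := fun v => n v ≠ 0) fun v _ hv hn => hv (hF v hn)]
  refine Finset.sum_nbij' σ idx ?_ ?_ ?_ ?_ ?_
  · intro i hi
    have := h₁ i (Finset.mem_range.1 hi)
    simp [this]
  · intro v hv
    simp only [Finset.mem_filter, Finset.mem_range] at hv
    exact Finset.mem_range.2 (h₂ v hv.1 hv.2).1
  · intro i hi
    exact (h₁ i (Finset.mem_range.1 hi)).2.2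
  · intro v hv
    simp only [Finset.mem_filter, Finset.mem_range] at hv
    exact (h₂ v hv.1 hv.2).2
  · intro i _
    rfl

/-- After the shift by 50 the order stands in register 50, the factors in arrays 50 and 51 and the
product in array 52; everything that the evaluation uses lies below. -/
theorem MultipliesMatrices.shift_does {P : RamProg} {c : ℕ} {M : ℕ → ℕ}
    (hP : MultipliesMatrices P c M) {r A B : ℕ} {X Y : Matrix (Fin r) (Fin r) ℕ}
    (hA : ∀ i j, X i j ≤ A ∧ Y i j ≤ A) {s : RamState} (hB : (r + A + 2) ^ c ≤ B)
    (hs : s.Fits B) (hr : s.reg 50 = r)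
    (hX : ∀ i j : Fin r, s.mem 50 (i * r + j) = X i j ∧ s.mem 51 (i * r + j) = Y i j) :
    (P.shift 50).Does B s (M r) fun s' => ∀ i j : Fin r, s'.mem 52 (i * r + j) = (X * Y) i j := by
  obtain ⟨T, s', h, hT, hQ⟩ := hP r A X Y hA B (s.drop 50) hB
    ⟨fun x => hs.1 _, fun a i => hs.2 _ _⟩ hr hX
  obtain ⟨t₀, rfl, h'⟩ := h.shift s rfl
  exact ⟨T, t₀, h', hT, hQ⟩

theorem substSmallStep_does {P : RamProg} {c : ℕ} {M : ℕ → ℕ} (hMul : MultipliesMatrices P c M)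
    {B D E : ℕ} {s : RamState} (hs : s.Fits B) {w pre post : List ℕ} {f : ℕ}
    {st : List (ℕ × ℕ)} {bl : List (List ℕ × ℕ)} {vs : List ℕ} {ed Q : List (ℕ × ℕ)} {tri hi : ℕ}
    (hQ : ∀ p ∈ Q, p.1 < bl.length ∧ p.2 < bl.length)
    (h : EvalState w f pre.length (st ++ blockSizes bl) (vs ++ (bl.map Prod.fst).flatten) ed tri hi s)
    (hw : w = pre ++ ([5, bl.length, Q.length] ++ Q.flatMap fun p => [p.1, p.2]) ++ post)
    (hf : f ≤ 1) (hB : 4 * D ≤ B) (hwD : w.length + 1 ≤ D) (hE : ∀ a ∈ bl, a.1.length ≤ E)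
    (hE₂ : E ^ 2 ≤ D) (hBc : (bl.length + (E + 1) + 2) ^ c ≤ B) (hr : bl.length * bl.length + 1 ≤ D)
    (hst : st.length + bl.length + 1 ≤ D)
    (hvs : vs.length + (bl.map Prod.fst).flatten.length ≤ D)
    (hed : ed.length + (blockEdges (supportEdges (blockWeight bl) Q) (bl.map Prod.fst)).length ≤ D)
    (hm : (bl.map Prod.snd).sum +
      (blockEdges (supportEdges (blockWeight bl) Q) (bl.map Prod.fst)).length ≤ D)
    (hpt : pairTri bl.length (supportEdges (blockWeight bl) Q) (blockWeight bl) ≤ D)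
    (htri : tri + pairTri bl.length (supportEdges (blockWeight bl) Q) (blockWeight bl) / 3 +
      crossTri (supportEdges (blockWeight bl) Q) (blockSizes bl) ≤ D) :
    (substSmallStep P).Does B s (800 * (bl.length + 1 + Q.length +
        (nonemptyCount (blockSizes bl) * nonemptyCount (blockSizes bl) +
          M (nonemptyCount (blockSizes bl))) +
        (listIf f (blockEdges (supportEdges (blockWeight bl) Q) (bl.map Prod.fst))).length))
      (EvalState w f (pre.length + (3 + 2 * Q.length))
        (st ++ [((bl.map Prod.fst).flatten.length, (bl.map Prod.snd).sum +
          (blockEdges (supportEdges (blockWeight bl) Q) (bl.map Prod.fst)).length)])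
        (vs ++ (bl.map Prod.fst).flatten)
        (ed ++ listIf f (blockEdges (supportEdges (blockWeight bl) Q) (bl.map Prod.fst)))
        (tri + pairTri bl.length (supportEdges (blockWeight bl) Q) (blockWeight bl) / 3 +
          crossTri (supportEdges (blockWeight bl) Q) (blockSizes bl)) hi) := by
  have hwl := congrArg List.length hw
  have hfm : (Q.flatMap fun p => [p.1, p.2]).length = 2 * Q.length := by
    rw [List.length_flatMap]; simp [mul_comm]
  simp only [List.length_append, List.length_cons, List.length_nil, Nat.zero_add, hfm] at hwl
  set n := blockWeight bl with hn
  set F := supportEdges n Q with hF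
  set r := nonemptyCount (blockSizes bl) with hr'
  set t := bl.length with ht
  obtain ⟨σ, hσ₁, hσ₂⟩ := exists_enum bl
  have hrt : r ≤ t := (nonemptyCount_le _).trans_eq (length_blockSizes _)
  have hrr : r * r ≤ t * t := Nat.mul_le_mul hrt hrt
  have hFQ : F.length ≤ Q.length := List.length_filter_le _ _
  have hFt : ∀ p ∈ F, p.1 < t ∧ p.2 < t ∧ n p.1 ≠ 0 ∧ n p.2 ≠ 0 := by
    intro p hp
    have h₁ := hQ p (List.mem_of_mem_filter hp)
    have h₂ := of_decide_eq_true (List.of_mem_filter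
      (p := fun p : ℕ × ℕ => decide (n p.1 * n p.2 ≠ 0)) hp)
    exact ⟨h₁.1, h₁.2, left_ne_zero_of_mul h₂, right_ne_zero_of_mul h₂⟩
  have hnE : ∀ v, n v ≤ E := blockWeight_le hE
  have hnn : ∀ u v, n u * n v ≤ D := fun u v =>
    (Nat.mul_le_mul (hnE u) (hnE v)).trans ((by ring : E * E = E ^ 2).trans_le hE₂)
  unfold substSmallStep
  refine Does.seq hs (T₁ := 100 * (t + 1))
    (T₂ := 520 * Q.length + 120 * (r * r) + M r + 200 * (listIf f (blockEdges F (bl.map Prod.fst))).length + 550)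
    (popArgs_does (D := D) hs h (by rw [hw]; simp [ht]) hB (by omega) hst hvs (by omega)) ?_ (by omega)
  rintro s₁ hs₁ - ⟨h₁, a₁⟩
  have hseg := h₁.code_at hw
  refine Does.seq hs₁ (T₁ := 100 * (Q.length + 1))
    (T₂ := 420 * Q.length + 120 * (r * r) + M r + 200 * (listIf f (blockEdges F (bl.map Prod.fst))).length + 450)
    ((selectEdges_does (D := D) (n := n) (t := t) (P := Q) hs₁ h₁.reg_pos h₁.reg_sp
      (hseg 2 _ rfl) hseg.append.2 (fun v hv => a₁.weight hv) hQ (fun p _ => hnn _ _) hB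
      (by omega) (by omega))) ?_ (by omega)
  rintro s₂ hs₂ f₂ ⟨c36, c21, cP⟩
  have h₂ : EvalState w f pre.length st (vs ++ (bl.map Prod.fst).flatten) ed tri hi s₂ :=
    h₁.congr (fun r hr => f₂.1 r (by simp [selectEdges]; omega))
      fun a ha => f₂.2 a (by simp [selectEdges]; omega)
  have a₂ : ArgState st bl (vs ++ (bl.map Prod.fst).flatten).length s₂ :=
    a₁.congr (fun r hr hr' => f₂.1 r (by simp [selectEdges]; omega))
      fun a ha => f₂.2 a (by simp [selectEdges]; omega)
  refine Does.seq hs₂ (T₁ := 120 * (F.length + r * r + 1))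
    (T₂ := 300 * Q.length + M r + 200 * (listIf f (blockEdges F (bl.map Prod.fst))).length + 330)
    (fillMatrices_does (D := D) (n := n) (r := r) (t := t) (P := F) (σ := σ) (id := nonemptyAfter bl) hs₂
      h₂.reg_sp a₂.reg_nonempty a₂.ids (fun v hv => a₂.weight hv) hσ₂ c21 cP hFt (by omega)
      (by omega) hB (by omega)) ?_ (by omega)
  rintro s₃ hs₃ f₃ hX
  have e₃ : ∀ r, r ≠ 12 → r ≠ 13 → r ≠ 14 → r ≠ 33 → r ≠ 34 → s₃.reg r = s₂.reg r :=
    fun r _ _ _ _ _ => f₃.1 r (by simp [fillMatrices]; omega)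
  have m₃ : ∀ a < 50, s₃.mem a = s₂.mem a := fun a _ => f₃.2 a (by simp [fillMatrices]; omega)
  refine Does.seq hs₃ (T₁ := 5)
    (T₂ := 300 * Q.length + M r + 200 * (listIf f (blockEdges F (bl.map Prod.fst))).length + 325)
    (Q := fun s' => s' = exec _ s₃) (Ok.does hs₃ (by simp) (Nat.le_of_ble_eq_true rfl) rfl) ?_
    (by omega)
  rintro s₄ hs₄ - hs₄e
  have hpA : ∀ u v, pairAdj F u v ≤ 1 := fun u v => by unfold pairAdj; split_ifs <;> simp
  -- The entries are at most `E` in the first factor and at most 1 in the second; `E + 1` bounds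
  -- both.
  refine Does.seq hs₄ (T₁ := M r)
    (T₂ := 300 * Q.length + 200 * (listIf f (blockEdges F (bl.map Prod.fst))).length + 325)
    (hMul.shift_does (r := r) (A := E + 1) (X := fun i j => pairAdj F (σ i) (σ j) * n (σ j))
      (Y := fun i j => pairAdj F (σ i) (σ j)) ?_ ?_ hs₄ ?_ ?_) ?_ (by omega)
  · intro i j
    have := Nat.mul_le_mul (hpA (σ i) (σ j)) (hnE (σ j))
    exact ⟨by omega, (hpA _ _).trans (by omega)⟩
  · exact (Nat.pow_le_pow_left (by omega) _).trans hBc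
  · rw [hs₄e]
    simp [e₃, a₂.reg_nonempty, hr']
  · intro i j
    obtain ⟨i₁, i₂, i₃⟩ := hσ₁ i i.2
    obtain ⟨j₁, j₂, j₃⟩ := hσ₁ j j.2
    have := hX _ i₁ _ j₁ i₂ j₂
    rw [i₃, j₃] at this
    rw [hs₄e]
    simpa using this
  rintro s₅ hs₅ f₅ hZ
  have e₅ : ∀ r < 50, s₅.reg r = s₃.reg r := fun r hr => by
    rw [f₅.1 r (not_writesReg_shift hr P), hs₄e]
    simp [show r ≠ 50 by omega]
  have m₅ : ∀ a < 50, s₅.mem a = s₃.mem a := fun a ha => by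
    rw [f₅.2 a (not_writesMem_shift ha P), hs₄e]
    simp
  have h₅ : EvalState w f pre.length st (vs ++ (bl.map Prod.fst).flatten) ed tri hi s₅ :=
    h₂.congr (fun r hr => by rw [e₅ r (by omega), e₃] <;> omega)
      fun a ha => by rw [m₅ a (by omega), m₃ a (by omega)]
  have a₅ : ArgState st bl (vs ++ (bl.map Prod.fst).flatten).length s₅ :=
    a₂.congr (fun r hr hr' => by rw [e₅ r (by omega), e₃] <;> omega)
      fun a ha => by rw [m₅ a (by omega), m₃ a (by omega)]
  have c21₅ : s₅.reg 21 = F.length := by rw [e₅ 21 (by simp), e₃ 21] <;> simp [c21]; rfl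
  have c36₅ : s₅.reg 36 = Q.length := by rw [e₅ 36 (by simp), e₃ 36] <;> simp [c36]
  have cP₅ : HoldsPairs (s₅.mem 9) (s₅.mem 10) F := by
    rw [m₅ 9 (by simp), m₅ 10 (by simp), m₃ 9 (by simp), m₃ 10 (by simp)]; exact cP
  refine Does.seq hs₅ (T₁ := 100 * (F.length + 1))
    (T₂ := 200 * Q.length + 200 * (listIf f (blockEdges F (bl.map Prod.fst))).length + 225)
    (sumProduct_does (D := D) (n := n) (r := r) (t := t) (P := F) (σ := σ) (id := nonemptyAfter bl)
      (Z := fun u v => ∑ k ∈ Finset.range t, pairAdj F u k * n k * pairAdj F k v) hs₅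
      h₅.reg_sp a₅.reg_nonempty a₅.ids (fun v hv => a₅.weight hv) hσ₂ c21₅ cP₅ hFt (by omega)
      (by omega) hB (by omega) (fun p _ => hnn _ _) ?_ hpt) ?_ (by omega)
  · intro p hp
    obtain ⟨p₁, p₂, z₁, z₂⟩ := hFt p hp
    obtain ⟨u₁, u₂⟩ := hσ₂ _ p₁ z₁
    obtain ⟨v₁, v₂⟩ := hσ₂ _ p₂ z₂
    refine ((hZ ⟨_, u₁⟩ ⟨_, v₁⟩).trans Matrix.mul_apply).trans ?_
    simp only [u₂, v₂]
    exact sum_range_eq_sum_enum (n := n) (F := fun k => pairAdj F p.1 k * n k * pairAdj F k p.2) hσ₁ hσ₂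
      fun v hv => by simp only [hv]; simp
  rintro s₆ hs₆ f₆ c22
  have h₆ : EvalState w f pre.length st (vs ++ (bl.map Prod.fst).flatten) ed tri hi s₆ :=
    h₅.congr (fun r hr => f₆.1 r (by simp [sumProduct]; omega))
      fun a ha => f₆.2 a (by simp [sumProduct])
  have a₆ : ArgState st bl (vs ++ (bl.map Prod.fst).flatten).length s₆ :=
    a₅.congr (fun r hr hr' => f₆.1 r (by simp [sumProduct]; omega))
      fun a ha => f₆.2 a (by simp [sumProduct])
  have c36₆ : s₆.reg 36 = Q.length := by rw [f₆.1 36 (by simp [sumProduct]), c36₅]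
  have c21₆ : s₆.reg 21 = F.length := by rw [f₆.1 21 (by simp [sumProduct]), c21₅]
  have m₆ : s₆.mem = s₅.mem := funext fun a => f₆.2 a (by simp [sumProduct])
  have c22' : s₆.reg 22 = pairTri t F n := c22
  refine Does.seq hs₆ (T₁ := 20) (T₂ := 200 * Q.length +
      200 * (listIf f (blockEdges F (bl.map Prod.fst))).length + 205)
    (Q := fun s' => s' = exec _ _) (Ok.does hs₆ ?_ (Nat.le_of_ble_eq_true rfl) rfl) ?_ (by omega)
  · simp [c22', c36₆, h₆.reg_tri, h₆.reg_pos]; omega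
  rintro s₇ hs₇ - rfl
  refine (joinArgs_does (D := D) (P := F) (bl := bl) hs₇ (h₆.congr_of_pos_tri
    (tri' := tri + pairTri t F n / 3) (pos' := pre.length + (3 + 2 * Q.length)) ?_ ?_ ?_ ?_)
    (a₆.congr ?_ ?_) hf ?_ ?_ ?_ hB (by omega) hst ?_ hed hm htri).mono ?_ fun _ h => h
  · intro r hr h1 h5
    simp [h1, h5]
  · intro a ha
    simp
  · simp [h₆.reg_pos, c36₆]
  · simp [c22', h₆.reg_tri]
  · intro r hr h33
    simp [show r ≠ 1 by omega, show r ≠ 5 by omega]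
  · intro a ha
    simp
  · simpa using c21₆
  · simpa [m₆] using cP₅
  · intro p hp
    exact ⟨(hFt p hp).1, (hFt p hp).2.1⟩
  · simpa using hvs
  · omega

end RamProg

/-! ### Blocks of vertices and pattern edges -/

/-- The vertices and the number of edges of each expression. -/
def argBlocks (es : List GExpr) : List (List ℕ × ℕ) := es.map fun e => (e.vl, e.el.length)

theorem length_argBlocks (es : List GExpr) : (argBlocks es).length = es.length := List.length_map _

theorem map_fst_argBlocks (es : List GExpr) : (argBlocks es).map Prod.fst = es.map GExpr.vl := by
  rw [argBlocks, List.map_map]; rfl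

theorem sum_snd_argBlocks (es : List GExpr) :
    ((argBlocks es).map Prod.snd).sum = (es.map GExpr.el).flatten.length := by
  rw [argBlocks, List.map_map, List.length_flatten, List.map_map]; rfl

theorem blockSizes_argBlocks (es : List GExpr) : blockSizes (argBlocks es) = es.map GExpr.size := by
  rw [argBlocks, blockSizes, List.map_map]; rfl

theorem length_getD_map_fst (bl : List (List ℕ × ℕ)) (v : ℕ) :
    ((bl.map Prod.fst).getD v []).length = blockWeight bl v := by
  simp only [blockWeight, blockSizes, List.getD_eq_getElem?_getD, List.getElem?_map]
  cases bl[v]? <;> rfl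

/-- A dropped pattern edge has an empty block at one end and produces no pair. -/
theorem blockEdges_supportEdges (bl : List (List ℕ × ℕ)) (P : List (ℕ × ℕ)) :
    blockEdges (supportEdges (blockWeight bl) P) (bl.map Prod.fst) =
      blockEdges P (bl.map Prod.fst) := by
  induction P with
  | nil => rfl
  | cons p P ih =>
    have h₁ : blockEdges (p :: P) (bl.map Prod.fst) =
        (bl.map Prod.fst).getD p.1 [] ×ˢ (bl.map Prod.fst).getD p.2 [] ++
          blockEdges P (bl.map Prod.fst) := by simp [blockEdges]
    by_cases hp : blockWeight bl p.1 * blockWeight bl p.2 = 0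
    · have h₂ : supportEdges (blockWeight bl) (p :: P) = supportEdges (blockWeight bl) P :=
        List.filter_cons_of_neg (by simp only [hp]; simp)
      have h₃ : (bl.map Prod.fst).getD p.1 [] ×ˢ (bl.map Prod.fst).getD p.2 [] = [] := by
        rw [← List.length_eq_zero_iff, List.length_product, length_getD_map_fst,
          length_getD_map_fst, hp]
      rw [h₁, h₂, h₃, ih, List.nil_append]
    · have h₂ : supportEdges (blockWeight bl) (p :: P) = p :: supportEdges (blockWeight bl) P :=
        List.filter_cons_of_pos (by simpa using hp)
      rw [h₁, h₂, ← ih]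
      simp [blockEdges]

/-- Edge numbers of the blocks enter here too, so it matters that a block without vertices has no
edges. -/
theorem crossTri_supportEdges {bl : List (List ℕ × ℕ)} (hbl : ∀ a ∈ bl, a.1 = [] → a.2 = 0)
    (P : List (ℕ × ℕ)) :
    crossTri (supportEdges (blockWeight bl) P) (blockSizes bl) = crossTri P (blockSizes bl) := by
  have key : ∀ v, blockWeight bl v = 0 →
      ((blockSizes bl).getD v (0, 0)).1 = 0 ∧ ((blockSizes bl).getD v (0, 0)).2 = 0 := by
    intro v hv
    refine ⟨hv, ?_⟩
    by_cases hvl : v < bl.length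
    · rw [blockWeight_of_lt hvl] at hv
      have := hbl _ (List.getElem_mem hvl) (List.length_eq_zero_iff.1 hv)
      simpa [blockSizes, List.getD_eq_getElem?_getD, hvl] using this
    · simp [List.getD_eq_getElem?_getD, length_blockSizes, not_lt.1 hvl]
  refine List.sum_map_filter_of_eq_zero fun p _ hp => ?_
  have hp : blockWeight bl p.1 * blockWeight bl p.2 = 0 := of_not_not (of_decide_eq_false hp)
  rcases mul_eq_zero.1 hp with h | h <;> simp only [key _ h] <;> simp

/-- Vertices of weight zero drop out both as ends and as third vertices; on the remaining vertices
both lists have the same adjacency. -/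
theorem pairTri_supportEdges (t : ℕ) (P : List (ℕ × ℕ)) (n : ℕ → ℕ) :
    pairTri t (supportEdges n P) n = pairTri t P n := by
  have hA : ∀ u v, n u ≠ 0 → n v ≠ 0 → pairAdj (supportEdges n P) u v = pairAdj P u v := by
    intro u v hu hv
    unfold pairAdj supportEdges
    simp [List.mem_filter, hu, hv]
  have h₁ : pairTri t (supportEdges n P) n = ((supportEdges n P).map fun p => n p.1 * n p.2 *
      ∑ k ∈ Finset.range t, pairAdj P p.1 k * n k * pairAdj P k p.2).sum := by
    unfold pairTri
    congr 1
    refine List.map_congr_left fun p hp => ?_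
    have hp : n p.1 * n p.2 ≠ 0 :=
      of_decide_eq_true (List.of_mem_filter (p := fun p : ℕ × ℕ => decide (n p.1 * n p.2 ≠ 0)) hp)
    congr 1
    refine Finset.sum_congr rfl fun k _ => ?_
    by_cases hk : n k = 0
    · simp [hk]
    · rw [hA _ _ (left_ne_zero_of_mul hp) hk, hA _ _ hk (right_ne_zero_of_mul hp)]
  rw [h₁]
  refine List.sum_map_filter_of_eq_zero fun p _ hp => ?_
  have hp : n p.1 * n p.2 = 0 := of_not_not (of_decide_eq_false hp)
  rw [hp, zero_mul]

namespace GExpr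

/-- The number of increments. -/
def incs : GExpr → ℕ
  | empty => 0
  | single _ => 0
  | union _ args => (List.ofFn fun i => (args i).incs).sum
  | join _ args => (List.ofFn fun i => (args i).incs).sum
  | inc _ _ e => e.incs + 1
  | substSmall _ _ args => (List.ofFn fun i => (args i).incs).sum
  | substTd _ _ args => (List.ofFn fun i => (args i).incs).sum

theorem incs_eq_zero_iff (e : GExpr) : e.incs = 0 ↔ ¬ e.HasInc := by
  have hs : ∀ {t : ℕ} {args : Fin t → GExpr}, (∀ i, (args i).incs = 0 ↔ ¬ (args i).HasInc) →
      ((List.ofFn fun i => (args i).incs).sum = 0 ↔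
        ¬ 1 ≤ Finset.univ.sup fun i => (args i).incDepth) := by
    intro t args h
    simp only [HasInc, not_le, Nat.lt_one_iff] at h ⊢
    rw [List.sum_ofFn, Finset.sum_eq_zero_iff]
    simp only [← bot_eq_zero', Finset.sup_eq_bot_iff]
    exact forall_congr' fun i => by simpa using h i
  induction e with
  | empty => simp [incs, HasInc, incDepth]
  | single v => simp [incs, HasInc, incDepth]
  | union t args ih => exact hs ih
  | join t args ih => exact hs ih
  | inc x N e ih => simp [incs, HasInc, incDepth]
  | substSmall t E args ih => exact hs ih
  | substTd t H args _ ih => exact hs ih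

theorem incs_le (e : GExpr) : e.incs ≤ e.code.length := by
  have hs : ∀ {t : ℕ} {args : Fin t → GExpr}, (∀ i, (args i).incs ≤ (args i).code.length) →
      (List.ofFn fun i => (args i).incs).sum ≤
        (List.ofFn fun i => (args i).code).flatten.length := by
    intro t args h
    rw [List.sum_ofFn, length_flatten_ofFn]
    exact Finset.sum_le_sum fun i _ => h i
  induction e with
  | empty => simp [incs]
  | single v => simp [incs]
  | union t args ih =>
    simp only [code, List.length_append]
    exact (hs ih).trans (Nat.le_add_right _ _)
  | join t args ih =>
    simp only [code, List.length_append]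
    exact (hs ih).trans (Nat.le_add_right _ _)
  | inc x N e ih => simp [incs, code]; omega
  | substSmall t E args ih =>
    simp only [code, List.length_append, Nat.add_assoc]
    exact (hs ih).trans (Nat.le_add_right _ _)
  | substTd t H args _ ih =>
    simp only [code, List.length_append, Nat.add_assoc]
    exact (hs ih).trans (Nat.le_add_right _ _)

end GExpr

/-! ### One step of the evaluation -/

namespace RamProg

open RamTerm

/-- The program for the operation with the given code number. -/
def opStep (P : RamProg) : ℕ → RamProg
  | 0 => emptyStep
  | 1 => singleStep
  | 2 => joinStep
  | 3 => joinStep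
  | 4 => incStep
  | 5 => substSmallStep P
  | _ => substTdStep

/-- One step of the evaluation of the code of an expression. -/
def evalStep (P : RamProg) : RamProg :=
  set 8 (mem 0 (reg 1)) ;;
  cond (reg 8) (cond (reg 8 - 1) (cond (reg 8 - 3) (cond (reg 8 - 4) (cond (reg 8 - 5)
    substTdStep (substSmallStep P)) incStep) joinStep) singleStep) emptyStep

/-- The nested conditionals use truncated subtraction as a comparison: `reg 8 - i` is nonzero
exactly if the operation number exceeds `i`. -/
theorem evalStep_does {P : RamProg} {B : ℕ} {s : RamState} (hs : s.Fits B) (hB : 8 ≤ B) {op : ℕ}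
    (hop : s.mem 0 (s.reg 1) = op) (h6 : op ≤ 6) {T : ℕ} {Q : RamState → Prop}
    (h : ∀ s', s'.Fits B → s'.reg 8 = op → (∀ r, r ≠ 8 → s'.reg r = s.reg r) → s'.mem = s.mem →
      (opStep P op).Does B s' T Q) : (evalStep P).Does B s (T + 30) Q := by
  unfold evalStep
  refine Does.seq hs (T₁ := 5) (T₂ := T + 20) (Q := fun s' => s' = exec _ s)
    (Ok.does hs (by simp) (Nat.le_of_ble_eq_true rfl) rfl) ?_ (by omega)
  rintro s₁ hs₁ - hs₁e
  have e8 : s₁.reg 8 = op := by rw [hs₁e]; simpa using hop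
  have := h s₁ hs₁ e8 (by rintro r hr; rw [hs₁e]; simp [hr]) (by rw [hs₁e]; simp)
  have c1 : (reg 8 - 1).cost = 3 := rfl
  have c3 : (reg 8 - 3).cost = 3 := rfl
  have c4 : (reg 8 - 4).cost = 3 := rfl
  have c5 : (reg 8 - 5).cost = 3 := rfl
  have c8 : (reg 8).cost = 1 := rfl
  by_cases h0 : op = 0
  · subst h0
    exact Does.cond_neg hs₁ (by simp) (by simp [e8]) this (by omega)
  refine Does.cond_pos hs₁ (by simp) (by simpa [e8] using h0) (T := T + 18) ?_ (by omega)
  by_cases h1 : op = 1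
  · subst h1
    exact Does.cond_neg hs₁ (by simp; omega) (by simp [e8]) this (by omega)
  refine Does.cond_pos hs₁ (by simp; omega) (by simp [e8]; omega) (T := T + 14) ?_ (by omega)
  by_cases h3 : op ≤ 3
  · have : joinStep.Does B s₁ T Q := by
      obtain rfl | rfl : op = 2 ∨ op = 3 := by omega
      · exact this
      · exact this
    exact Does.cond_neg hs₁ (by simp; omega) (by simp [e8]; omega) this (by omega)
  refine Does.cond_pos hs₁ (by simp; omega) (by simp [e8]; omega) (T := T + 10) ?_ (by omega)
  by_cases h4 : op = 4
  · subst h4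
    exact Does.cond_neg hs₁ (by simp; omega) (by simp [e8]) this (by omega)
  refine Does.cond_pos hs₁ (by simp; omega) (by simp [e8]; omega) (T := T + 6) ?_ (by omega)
  by_cases h5 : op = 5
  · subst h5
    exact Does.cond_neg hs₁ (by simp; omega) (by simp [e8]) this (by omega)
  · obtain rfl : op = 6 := by omega
    exact Does.cond_pos hs₁ (by simp; omega) (by simp [e8]) this (by omega)

end RamProg

/-! ### Evaluation of expressions -/

theorem pow_two_add_le (a b : ℕ) : a ^ 2 + b ^ 2 ≤ (a + b) ^ 2 := by nlinarith [Nat.zero_le (a * b)]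

theorem pow_three_add_le (a b : ℕ) : a ^ 3 + b ^ 3 ≤ (a + b) ^ 3 := by
  have : (a + b) ^ 3 = a ^ 3 + b ^ 3 + (3 * (a * a * b) + 3 * (a * b * b)) := by ring
  omega

theorem length_listIf_le {α : Type*} (f : ℕ) (l : List α) : (listIf f l).length ≤ l.length := by
  unfold listIf; split_ifs <;> simp

/-- Bounds for the numbers that occur in the evaluation of a code of length `L`, where matrix
multiplication is possible with words of exponent `c`. -/
structure WordBounds (L D B c : ℕ) : Prop where
  linear : 8 * L + 8 ≤ D
  square : 2 * L ^ 2 + 1 ≤ D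
  cube : 3 * L ^ 3 + 2 ≤ D
  word : 8 * (D * D) ≤ B
  matrix : (2 * L + 3) ^ c ≤ B

/-- The state is a possible one after the evaluation of a code of length `p`. -/
structure SizeBounds (p : ℕ) (st : List (ℕ × ℕ)) (vs : List ℕ) (ed : List (ℕ × ℕ)) (tri hi : ℕ) :
    Prop where
  stack : st.length ≤ p
  vertices : vs.length ≤ p
  edges : ed.length ≤ p ^ 2
  triangles : tri ≤ p ^ 3
  incs : hi ≤ p

namespace RamProg

open RamTerm

/-- The cost of the steps for matrix multiplication. -/
def matSteps (M : ℕ → ℕ) (r : ℕ) : ℕ := r * r + M r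

/-- The loop evaluates the expression wherever it occurs in the code `w`. -/
def Evaluates (P : RamProg) (M : ℕ → ℕ) (B : ℕ) (w : List ℕ) (f : ℕ) (e : GExpr) : Prop :=
  ∀ ⦃pre post : List ℕ⦄ ⦃st : List (ℕ × ℕ)⦄ ⦃vs : List ℕ⦄ ⦃ed : List (ℕ × ℕ)⦄ ⦃tri hi : ℕ⦄
    ⦃s : RamState⦄, w = pre ++ e.code ++ post →
    EvalState w f pre.length st vs ed tri hi s → s.Fits B →
    SizeBounds pre.length st vs ed tri hi →
    ∃ T s', Reach B (reg 0 - reg 1) (evalStep P) s T s' ∧ T ≤ 1000 * e.ct (matSteps M) f ∧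
      s'.Fits B ∧ EvalState w f (pre.length + e.code.length) (st ++ [e.size]) (vs ++ e.vl)
        (ed ++ listIf f e.el) (tri + e.tr f) (hi + e.incs) s'

/-- Squares and cubes are superadditive, so bounds in terms of the length of the code read so far
persist when a further expression is evaluated. -/
theorem _root_.SizeBounds.append {p f : ℕ} {st : List (ℕ × ℕ)} {vs : List ℕ} {ed : List (ℕ × ℕ)}
    {tri hi : ℕ} (h : SizeBounds p st vs ed tri hi) {e : GExpr} (he : e.WellFormed) (hf : f ≤ 1) :
    SizeBounds (p + e.code.length) (st ++ [e.size]) (vs ++ e.vl) (ed ++ listIf f e.el)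
      (tri + e.tr f) (hi + e.incs) := by
  have h₁ := e.length_vl_le
  have h₂ := length_listIf_le f e.el
  have h₃ := he.length_el_le
  have h₄ := (GExpr.tr_le_tr_one hf e).trans he.tr_le
  have h₅ := e.code_length_pos
  have h₆ := Nat.pow_le_pow_left h₁ 2
  have h₇ := Nat.pow_le_pow_left h₁ 3
  have h₈ := pow_two_add_le p e.code.length
  have h₉ := pow_three_add_le p e.code.length
  have h₀ := e.incs_le
  have := h.stack
  have := h.vertices
  have := h.edges
  have := h.triangles
  have := h.incs
  constructor <;> (try simp only [List.length_append, List.length_singleton]) <;> omega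

theorem Evaluates.list {P : RamProg} {M : ℕ → ℕ} {B : ℕ} {w : List ℕ} {f : ℕ} (hf : f ≤ 1)
    {es : List GExpr} (hes : ∀ e ∈ es, e.WellFormed ∧ Evaluates P M B w f e)
    {pre post : List ℕ} {st : List (ℕ × ℕ)} {vs : List ℕ} {ed : List (ℕ × ℕ)} {tri hi : ℕ}
    {s : RamState} (hw : w = pre ++ (es.map GExpr.code).flatten ++ post)
    (h : EvalState w f pre.length st vs ed tri hi s) (hs : s.Fits B)
    (hb : SizeBounds pre.length st vs ed tri hi) :
    ∃ T s', Reach B (reg 0 - reg 1) (evalStep P) s T s' ∧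
      T ≤ 1000 * (es.map (GExpr.ct (matSteps M) f)).sum ∧ s'.Fits B ∧
      EvalState w f (pre.length + (es.map GExpr.code).flatten.length) (st ++ es.map GExpr.size)
        (vs ++ (es.map GExpr.vl).flatten) (ed ++ listIf f (es.map GExpr.el).flatten)
        (tri + (es.map (GExpr.tr f)).sum) (hi + (es.map GExpr.incs).sum) s' ∧
      SizeBounds (pre.length + (es.map GExpr.code).flatten.length) (st ++ es.map GExpr.size)
        (vs ++ (es.map GExpr.vl).flatten) (ed ++ listIf f (es.map GExpr.el).flatten)
        (tri + (es.map (GExpr.tr f)).sum) (hi + (es.map GExpr.incs).sum) := by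
  induction es generalizing pre st vs ed tri hi s with
  | nil =>
    have hnil : listIf f ([] : List (ℕ × ℕ)) = [] := by unfold listIf; split_ifs <;> rfl
    exact ⟨0, s, Reach.refl _ _ _ _, le_rfl, hs, by simpa [hnil] using h, by simpa [hnil] using hb⟩
  | cons e es ih =>
    obtain ⟨he₁, he₂⟩ := hes e (by simp)
    obtain ⟨T₁, s₁, r₁, hT₁, hs₁, h₁⟩ := he₂ (post := (es.map GExpr.code).flatten ++ post)
      (by simpa using hw) h hs hb
    have hb₁ := hb.append he₁ hf
    rw [← List.length_append] at h₁ hb₁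
    obtain ⟨T₂, s₂, r₂, hT₂, hs₂, h₂, hb₂⟩ := ih (fun e he => hes e (by simp [he]))
      (by simpa using hw) h₁ hs₁ hb₁
    refine ⟨_, s₂, r₁.trans r₂, ?_, hs₂, ?_, ?_⟩
    · rw [List.map_cons, List.sum_cons]; omega
    · simpa [Nat.add_assoc, listIf_append, -List.length_flatten] using h₂
    · simpa [Nat.add_assoc, listIf_append, -List.length_flatten] using hb₂

/-- One round of the interpreter. The overhead of 34 steps consists of 30 for the dispatch and 4 for
the loop condition. -/
theorem reach_step {P : RamProg} {B : ℕ} {w pre seg post : List ℕ} {f : ℕ} {st : List (ℕ × ℕ)}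
    {vs : List ℕ} {ed : List (ℕ × ℕ)} {tri hi : ℕ} {s : RamState} (hs : s.Fits B) (hB : 8 ≤ B)
    (h : EvalState w f pre.length st vs ed tri hi s) {op : ℕ} (hw : w = pre ++ op :: seg ++ post)
    (h6 : op ≤ 6) {T : ℕ} {Q : RamState → Prop}
    (hop : ∀ s', s'.Fits B → s'.reg 8 = op → EvalState w f pre.length st vs ed tri hi s' →
      (opStep P op).Does B s' T Q) :
    ∃ T' s', Reach B (reg 0 - reg 1) (evalStep P) s T' s' ∧ T' ≤ T + 34 ∧ s'.Fits B ∧ Q s' := by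
  have h0 := h.code_at hw 0 op rfl
  obtain ⟨T', s', hr, hT', hs', hQ⟩ := (evalStep_does hs hB (by rw [h.reg_pos]; exact h0) h6
    fun s' hs' h8 hr hm => hop s' hs' h8
      (h.congr (fun r hr' => hr r (by omega)) fun a _ => by rw [hm])).reach (g := reg 0 - reg 1) hs
    (by simp) (by simp [h.reg_length, h.reg_pos, hw])
  exact ⟨T', s', hr, hT', hs', hQ⟩

variable {P : RamProg} {c : ℕ} {M : ℕ → ℕ} {B D : ℕ} {w : List ℕ} {f : ℕ} {t : ℕ}
  {args : Fin t → GExpr}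

/-- Unions and joins have the same conditions of well-formedness, so the bounds for the join of the
arguments control the numbers in both cases. -/
theorem evaluates_join (hf : f ≤ 1) (hD : WordBounds w.length D B c) {j : ℕ} (hj : j ≤ 1)
    (hwf : (GExpr.join t args).WellFormed) (ih : ∀ i, Evaluates P M B w f (args i))
    {pre post : List ℕ} {st : List (ℕ × ℕ)} {vs : List ℕ} {ed : List (ℕ × ℕ)} {tri hi : ℕ}
    {s : RamState} (hw : w = pre ++ ((List.ofFn args).map GExpr.code).flatten ++ [j + 2, t] ++ post)
    (h : EvalState w f pre.length st vs ed tri hi s) (hs : s.Fits B)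
    (hb : SizeBounds pre.length st vs ed tri hi) :
    ∃ T s', Reach B (reg 0 - reg 1) (evalStep P) s T s' ∧
      T ≤ 1000 * (((List.ofFn args).map (GExpr.ct (matSteps M) f)).sum +
        (t + 1 + f * (j * (joinEdges ((List.ofFn args).map GExpr.vl)).length))) ∧ s'.Fits B ∧
      EvalState w f (pre.length + (((List.ofFn args).map GExpr.code).flatten.length + 2))
        (st ++ [(((List.ofFn args).map GExpr.vl).flatten.length,
          ((List.ofFn args).map GExpr.el).flatten.length +
            j * (joinEdges ((List.ofFn args).map GExpr.vl)).length)])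
        (vs ++ ((List.ofFn args).map GExpr.vl).flatten)
        (ed ++ (listIf f ((List.ofFn args).map GExpr.el).flatten ++
          listIf (f * j) (joinEdges ((List.ofFn args).map GExpr.vl))))
        (tri + (((List.ofFn args).map (GExpr.tr f)).sum +
          j * joinTri ((List.ofFn args).map GExpr.size)))
        (hi + ((List.ofFn args).map GExpr.incs).sum) s' := by
  have hel := hwf.length_el_le
  have htr := (GExpr.tr_le_tr_one hf _).trans hwf.tr_le
  have hvl := (GExpr.join t args).length_vl_le
  simp only [GExpr.el, GExpr.vl, GExpr.tr, GExpr.code, List.ofFn_comp] at hel htr hvl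
  obtain ⟨hD₁, hD₂, hD₃, hD₄, hD₅⟩ := hD
  set es := List.ofFn args with hes
  have hlen : es.length = t := by simp [hes]
  obtain ⟨T₁, s₁, r₁, hT₁, hs₁, h₁, hb₁⟩ := Evaluates.list hf (es := es) (fun e he => by
      obtain ⟨i, rfl⟩ := (List.mem_ofFn' _ _).1 he
      exact ⟨hwf.2.1 i, ih i⟩) (post := [j + 2, t] ++ post) (by simpa using hw) h hs hb
  have hwl := congrArg List.length hw
  simp only [List.length_append, List.length_cons, List.length_nil, Nat.zero_add,
    Nat.reduceAdd] at hwl hvl hel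
  rw [← List.length_append] at h₁ hb₁
  rw [← blockSizes_argBlocks, ← map_fst_argBlocks] at h₁ hb₁
  have hB : 8 ≤ B := by nlinarith
  have htc : t ≤ (es.map GExpr.code).flatten.length := by
    rw [hes, ← List.ofFn_comp, length_flatten_ofFn]
    exact GExpr.le_sum_code args
  have hp2 := Nat.pow_le_pow_left (show pre.length + ((es.map GExpr.code).flatten.length + 2) ≤ w.length by omega) 2
  have hp3 := Nat.pow_le_pow_left (show pre.length + ((es.map GExpr.code).flatten.length + 2) ≤ w.length by omega) 3
  have hq2 := pow_two_add_le pre.length ((es.map GExpr.code).flatten.length + 2)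
  have hq3 := pow_three_add_le pre.length ((es.map GExpr.code).flatten.length + 2)
  have hv2 := Nat.pow_le_pow_left hvl 2
  have hv3 := Nat.pow_le_pow_left hvl 3
  have hle := length_listIf_le f (es.map GExpr.el).flatten
  obtain ⟨b₁, b₂, b₃, b₄, b₅⟩ := hb
  obtain ⟨T₂, s₂, r₂, hT₂, hs₂, h₂⟩ := reach_step (P := P) (op := j + 2) (seg := [t]) (post := post)
    (pre := pre ++ (es.map GExpr.code).flatten) hs₁ hB h₁ (by simpa using hw) (by omega)
    (fun s' hs' h8 h' => by
      have : opStep P (j + 2) = joinStep := by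
        obtain rfl | rfl : j = 0 ∨ j = 1 := by omega
        all_goals rfl
      rw [this]
      refine joinStep_does (D := D) hs' h' hf hj h8 ?_ hD₄ ?_ ?_ ?_ ?_ ?_ ?_
      · rw [hw, length_argBlocks, hlen, List.getElem?_append_left (by simp [-List.length_flatten]; omega),
          List.getElem?_append_right (by omega)]
        simp
      · rw [List.length_append]; omega
      · rw [length_argBlocks, hlen]; omega
      · rw [map_fst_argBlocks]; omega
      · rw [map_fst_argBlocks, List.length_append]; omega
      · rw [map_fst_argBlocks, sum_snd_argBlocks]; omega
      · rw [blockSizes_argBlocks]; omega)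
  rw [length_argBlocks, hlen, map_fst_argBlocks] at hT₂
  rw [map_fst_argBlocks, sum_snd_argBlocks, blockSizes_argBlocks] at h₂
  refine ⟨_, s₂, r₁.trans r₂, ?_, hs₂, ?_⟩
  · rw [length_listIf (Nat.mul_le_mul hf hj), mul_assoc f] at hT₂
    omega
  · simpa [Nat.add_assoc, -List.length_flatten] using h₂

end RamProg

/-! ### Substitutions as rounds of the evaluation. -/

namespace RamProg

open RamTerm

variable {P : RamProg} {c : ℕ} {M : ℕ → ℕ} {B D : ℕ} {w : List ℕ} {f : ℕ} {t : ℕ}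
  {args : Fin t → GExpr}

theorem blockWeight_argBlocks : blockWeight (argBlocks (List.ofFn args)) = GExpr.blockSize args := by
  funext v
  rw [blockWeight, blockSizes_argBlocks, ← List.ofFn_comp]
  rfl

theorem argBlocks_eq_zero (hwf : ∀ i, (args i).WellFormed) :
    ∀ a ∈ argBlocks (List.ofFn args), a.1 = [] → a.2 = 0 := by
  intro a ha h
  simp only [argBlocks, List.mem_map] at ha
  obtain ⟨e, he, rfl⟩ := ha
  obtain ⟨i, rfl⟩ := (List.mem_ofFn' _ _).1 he
  have := (hwf i).length_el_le
  have h : (args i).vl = [] := h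
  rw [h] at this
  simpa using this

/-- The program works with the pattern edges of nonzero weight, whereas `el` and `tr` refer to all
of them; the lemmas on `supportEdges` identify the results. All intermediate numbers are bounded by
those of the finished value. -/
theorem evaluates_substTd (hf : f ≤ 1) (hD : WordBounds w.length D B c) {H : GExpr}
    (hwf : (GExpr.substTd t H args).WellFormed) (ih : ∀ i, Evaluates P M B w f (args i)) :
    Evaluates P M B w f (GExpr.substTd t H args) := by
  intro pre post st vs ed tri hi s hw h hs hb
  have hel := hwf.length_el_le
  have htr := (GExpr.tr_le_tr_one hf _).trans hwf.tr_le
  have hvl := (GExpr.substTd t H args).length_vl_le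
  have hsz : (GExpr.substTd t H args).size = (List.length (GExpr.vl _), List.length (GExpr.el _)) := rfl
  obtain ⟨⟨hHwf, hTd, hHt⟩, hargs, -⟩ := hwf
  simp only [GExpr.el, GExpr.vl, GExpr.tr, GExpr.code, GExpr.ct, GExpr.incs,
    List.ofFn_comp] at *
  obtain ⟨hD₁, hD₂, hD₃, hD₄, hD₅⟩ := hD
  have hbe := blockEdges_supportEdges (argBlocks (List.ofFn args)) H.el
  have hct := crossTri_supportEdges (argBlocks_eq_zero hargs) H.el
  have hn : blockWeight (argBlocks (List.ofFn args)) = GExpr.blockSize args := blockWeight_argBlocks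
  set es := List.ofFn args with hes
  have hlen : es.length = t := by simp [hes]
  have hfel : H.fel (blockWeight (argBlocks es)) = supportEdges (blockWeight (argBlocks es)) H.el := rfl
  rw [map_fst_argBlocks] at hbe
  rw [blockSizes_argBlocks] at hct
  obtain ⟨T₁, s₁, r₁, hT₁, hs₁, h₁, hb₁⟩ := Evaluates.list hf (es := es) (fun e he => by
      obtain ⟨i, rfl⟩ := (List.mem_ofFn' _ _).1 he
      exact ⟨hargs i, ih i⟩) (post := [6, t, H.code.length] ++ H.code ++ post)
      (by simpa using hw) h hs hb
  have hwl := congrArg List.length hw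
  simp only [List.length_append, List.length_cons, List.length_nil, Nat.zero_add,
    Nat.reduceAdd] at hwl hvl hel
  rw [← List.length_append] at h₁ hb₁
  rw [← blockSizes_argBlocks, ← map_fst_argBlocks] at h₁ hb₁
  have hDD := Nat.le_mul_self D
  have hB : 8 ≤ B := by omega
  have htc : t ≤ (es.map GExpr.code).flatten.length := by
    rw [hes, ← List.ofFn_comp, length_flatten_ofFn]
    exact GExpr.le_sum_code args
  set C := (es.map GExpr.code).flatten.length with hC
  have hp2 := Nat.pow_le_pow_left (show pre.length + (C + 3 + H.code.length) ≤ w.length by omega) 2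
  have hp3 := Nat.pow_le_pow_left (show pre.length + (C + 3 + H.code.length) ≤ w.length by omega) 3
  have hq2 := pow_two_add_le pre.length (C + 3 + H.code.length)
  have hq3 := pow_three_add_le pre.length (C + 3 + H.code.length)
  have hv2 := Nat.pow_le_pow_left hvl 2
  have hv3 := Nat.pow_le_pow_left hvl 3
  have hle := length_listIf_le f (es.map GExpr.el).flatten
  obtain ⟨b₁, b₂, b₃, b₄, b₅⟩ := hb
  obtain ⟨T₂, s₂, r₂, hT₂, hs₂, h₂⟩ := reach_step (P := P) (op := 6)
    (seg := t :: H.code.length :: H.code) (post := post)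
    (pre := pre ++ (es.map GExpr.code).flatten) hs₁ hB h₁ (by simpa using hw) (by omega)
    (fun s' hs' h8 h' => by
      refine substTdStep_does (D := D) (E := w.length) (post := post) hs' hTd hHwf ?_ h' ?_ hf
        (by omega) (by omega) ?_ (by omega) (by omega) ?_ ?_ ?_ ?_ ?_
      · rw [hHt, length_argBlocks, hlen]
        exact fun v hv => Finset.mem_range.1 hv
      · rw [length_argBlocks, hlen]; simpa using hw
      · intro a ha
        simp only [argBlocks, List.mem_map] at ha
        obtain ⟨e, he, rfl⟩ := ha
        have h₁ : e.code.length ≤ C := by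
          rw [hC]
          exact (List.sublist_flatten_of_mem (List.mem_map_of_mem he)).length_le
        have := e.length_vl_le
        simp only
        omega
      · rw [length_argBlocks, hlen]; omega
      · rw [map_fst_argBlocks]; omega
      · rw [map_fst_argBlocks, hfel, hbe, List.length_append]; omega
      · rw [map_fst_argBlocks, sum_snd_argBlocks, hfel, hbe]; omega
      · rw [blockSizes_argBlocks, hfel, hct, hn]; omega)
  rw [length_argBlocks, hlen, map_fst_argBlocks, hfel, hbe, hn] at hT₂
  rw [map_fst_argBlocks, sum_snd_argBlocks, blockSizes_argBlocks, hfel, hbe, hct, hn] at h₂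
  refine ⟨_, s₂, r₁.trans r₂, ?_, hs₂, ?_⟩
  · rw [length_listIf hf] at hT₂
    omega
  · rw [listIf_append]
    convert h₂ using 1
    · simp only [List.length_append, List.length_cons, List.length_nil]; omega
    · rw [hsz, List.length_append]
    · simp
    · omega

theorem evaluates_substSmall (hMul : MultipliesMatrices P c M) (hf : f ≤ 1)
    (hD : WordBounds w.length D B c) {E : List (Fin t × Fin t)}
    (hwf : (GExpr.substSmall t E args).WellFormed) (ih : ∀ i, Evaluates P M B w f (args i)) :
    Evaluates P M B w f (GExpr.substSmall t E args) := by
  intro pre post st vs ed tri hi s hw h hs hb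
  have hel := hwf.length_el_le
  have htr := (GExpr.tr_le_tr_one hf _).trans hwf.tr_le
  have hvl := (GExpr.substSmall t E args).length_vl_le
  have hsz : (GExpr.substSmall t E args).size = (List.length (GExpr.vl _), List.length (GExpr.el _)) := rfl
  obtain ⟨-, hargs, -⟩ := hwf
  have hcode : (E.flatMap fun p => [(p.1 : ℕ), (p.2 : ℕ)]) =
      (E.map fun p => ((p.1 : ℕ), (p.2 : ℕ))).flatMap fun p => [p.1, p.2] := by
    rw [List.flatMap_map]
  simp only [GExpr.el, GExpr.vl, GExpr.tr, GExpr.code, GExpr.ct, GExpr.incs,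
    List.ofFn_comp, hcode] at *
  have hQl : E.length = (E.map fun p => ((p.1 : ℕ), (p.2 : ℕ))).length := by simp
  have hQt : ∀ p ∈ E.map fun p => ((p.1 : ℕ), (p.2 : ℕ)), p.1 < t ∧ p.2 < t := by
    intro p hp
    obtain ⟨q, -, rfl⟩ := List.mem_map.1 hp
    exact ⟨q.1.2, q.2.2⟩
  rw [hQl] at hw hvl ⊢
  -- From here on only the bound `t` on the entries matters, so the pattern is an arbitrary list of
  -- pairs of numbers.
  generalize (E.map fun p => ((p.1 : ℕ), (p.2 : ℕ))) = Q at *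
  have hfm : (Q.flatMap fun p => [p.1, p.2]).length = 2 * Q.length := by
    rw [List.length_flatMap]; simp [mul_comm]
  obtain ⟨hD₁, hD₂, hD₃, hD₄, hD₅⟩ := hD
  have hbe := blockEdges_supportEdges (argBlocks (List.ofFn args)) Q
  have hct := crossTri_supportEdges (argBlocks_eq_zero hargs) Q
  have hpt := pairTri_supportEdges t Q (GExpr.blockSize args)
  have hn : blockWeight (argBlocks (List.ofFn args)) = GExpr.blockSize args := blockWeight_argBlocks
  have hac : nonemptyCount (blockSizes (argBlocks (List.ofFn args))) = GExpr.argCount args := by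
    rw [blockSizes_argBlocks, ← List.ofFn_comp]; rfl
  set es := List.ofFn args with hes
  have hlen : es.length = t := by simp [hes]
  rw [map_fst_argBlocks] at hbe
  rw [blockSizes_argBlocks] at hct
  obtain ⟨T₁, s₁, r₁, hT₁, hs₁, h₁, hb₁⟩ := Evaluates.list hf (es := es) (fun e he => by
      obtain ⟨i, rfl⟩ := (List.mem_ofFn' _ _).1 he
      exact ⟨hargs i, ih i⟩) (post := [5, t, Q.length] ++ (Q.flatMap fun p => [p.1, p.2]) ++ post)
      (by simpa using hw) h hs hb
  have hwl := congrArg List.length hw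
  simp only [List.length_append, List.length_cons, List.length_nil, Nat.zero_add,
    Nat.reduceAdd, hfm] at hwl hvl hel
  rw [← List.length_append] at h₁ hb₁
  rw [← blockSizes_argBlocks, ← map_fst_argBlocks] at h₁ hb₁
  have hDD := Nat.le_mul_self D
  have hB : 8 ≤ B := by omega
  have htc : t ≤ (es.map GExpr.code).flatten.length := by
    rw [hes, ← List.ofFn_comp, length_flatten_ofFn]
    exact GExpr.le_sum_code args
  set C := (es.map GExpr.code).flatten.length with hC
  have hp2 := Nat.pow_le_pow_left (show pre.length + (C + 3 + 2 * Q.length) ≤ w.length by omega) 2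
  have hp3 := Nat.pow_le_pow_left (show pre.length + (C + 3 + 2 * Q.length) ≤ w.length by omega) 3
  have hq2 := pow_two_add_le pre.length (C + 3 + 2 * Q.length)
  have hq3 := pow_three_add_le pre.length (C + 3 + 2 * Q.length)
  have hv2 := Nat.pow_le_pow_left hvl 2
  have hv3 := Nat.pow_le_pow_left hvl 3
  have hle := length_listIf_le f (es.map GExpr.el).flatten
  have htL := Nat.mul_le_mul (show t ≤ w.length by omega) (show t ≤ w.length by omega)
  rw [← sq w.length] at htL
  obtain ⟨b₁, b₂, b₃, b₄, b₅⟩ := hb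
  obtain ⟨T₂, s₂, r₂, hT₂, hs₂, h₂⟩ := reach_step (P := P) (op := 5)
    (seg := t :: Q.length :: (Q.flatMap fun p => [p.1, p.2])) (post := post)
    (pre := pre ++ (es.map GExpr.code).flatten) hs₁ hB h₁ (by simpa using hw) (by omega)
    (fun s' hs' h8 h' => by
      refine substSmallStep_does hMul (D := D) (E := w.length) (post := post) (Q := Q) hs' ?_ h' ?_
        hf (by omega) (by omega) ?_ (by omega) ?_ ?_ ?_ ?_ ?_ ?_ ?_ ?_
      · rw [length_argBlocks, hlen]
        exact hQt
      · rw [length_argBlocks, hlen]; simpa using hw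
      · intro a ha
        simp only [argBlocks, List.mem_map] at ha
        obtain ⟨e, he, rfl⟩ := ha
        have h₁ : e.code.length ≤ C := by
          rw [hC]
          exact (List.sublist_flatten_of_mem (List.mem_map_of_mem he)).length_le
        have := e.length_vl_le
        simp only
        omega
      · rw [length_argBlocks, hlen]
        exact (Nat.pow_le_pow_left (by omega) c).trans hD₅
      · rw [length_argBlocks, hlen]; omega
      · rw [length_argBlocks, hlen]; omega
      · rw [map_fst_argBlocks]; omega
      · rw [map_fst_argBlocks, hbe, List.length_append]; omega
      · rw [map_fst_argBlocks, sum_snd_argBlocks, hbe]; omega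
      · rw [length_argBlocks, hlen, hn, hpt]; omega
      · rw [blockSizes_argBlocks, length_argBlocks, hlen, hct, hn, hpt]; omega)
  rw [hac, length_argBlocks, hlen, map_fst_argBlocks, hbe] at hT₂
  rw [map_fst_argBlocks, sum_snd_argBlocks, blockSizes_argBlocks, length_argBlocks, hlen, hbe, hct,
    hn, hpt] at h₂
  refine ⟨_, s₂, r₁.trans r₂, ?_, hs₂, ?_⟩
  · rw [length_listIf hf] at hT₂
    simp only [matSteps] at *
    omega
  · rw [listIf_append]
    convert h₂ using 1
    · simp only [List.length_append, List.length_cons, List.length_nil, hfm]; omega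
    · rw [hsz, List.length_append]
    · simp
    · omega

end RamProg

/-! ### The complete algorithm. -/

namespace RamProg

open RamTerm

/-- Structural induction over all occurrences in the code. The factor 1000 covers the constants of
all single steps together with the dispatch. -/
theorem evaluates {P : RamProg} {c : ℕ} {M : ℕ → ℕ} {B D : ℕ} {w : List ℕ} {f : ℕ}
    (hMul : MultipliesMatrices P c M) (hf : f ≤ 1) (hD : WordBounds w.length D B c) (e : GExpr)
    (he : e.WellFormed) : Evaluates P M B w f e := by
  have hDD := Nat.le_mul_self D
  have hD₁ := hD.linear
  have hD₂ := hD.square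
  have hD₃ := hD.cube
  have hD₄ := hD.word
  have hnil : listIf f ([] : List (ℕ × ℕ)) = [] := by unfold listIf; split_ifs <;> rfl
  induction e with
  | empty =>
    intro pre post st vs ed tri hi s hw h hs hb
    have hwl := congrArg List.length hw
    simp only [GExpr.code, List.length_append, List.length_cons, List.length_nil] at hwl
    have hst := hb.stack
    obtain ⟨T, s', r, hT, hs', h'⟩ := reach_step (P := P) (op := 0) (seg := []) (post := post)
      hs (by omega) h (by simpa [GExpr.code] using hw) (by omega) (fun s' hs' _ h' =>
        emptyStep_does (D := D) hs' h' (by omega) (by omega) (by omega))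
    exact ⟨T, s', r, hT.trans (by simp [GExpr.ct]), hs', by
      simpa [GExpr.code, GExpr.size, GExpr.vl, GExpr.el, GExpr.tr, GExpr.incs, hnil] using h'⟩
  | single v =>
    intro pre post st vs ed tri hi s hw h hs hb
    have hwl := congrArg List.length hw
    simp only [GExpr.code, List.length_append, List.length_cons, List.length_nil] at hwl
    have hst := hb.stack
    have hvs := hb.vertices
    obtain ⟨T, s', r, hT, hs', h'⟩ := reach_step (P := P) (op := 1) (seg := [v]) (post := post)
      hs (by omega) h (by simpa [GExpr.code] using hw) (by omega) (fun s' hs' _ h' =>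
        singleStep_does (D := D) (post := post) hs' h' hw (by omega) (by omega) (by omega)
          (by omega))
    exact ⟨T, s', r, hT.trans (by simp [GExpr.ct]), hs', by
      simpa [GExpr.code, GExpr.size, GExpr.vl, GExpr.el, GExpr.tr, GExpr.incs, hnil] using h'⟩
  | union t args ih =>
    intro pre post st vs ed tri hi s hw h hs hb
    have hwf : (GExpr.join t args).WellFormed := he
    obtain ⟨T, s', r, hT, hs', h'⟩ := evaluates_join (post := post) hf hD (j := 0) (by omega) hwf
      (fun i => ih i (he.2.1 i)) (by simpa [GExpr.code, List.ofFn_comp] using hw) h hs hb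
    refine ⟨T, s', r, hT.trans ?_, hs', ?_⟩
    · simp [GExpr.ct, List.ofFn_comp]
    · have h0 : ∀ l : List (ℕ × ℕ), listIf (f * 0) l = [] := fun l => by simp [listIf]
      simp only [h0, Nat.zero_mul, Nat.add_zero, List.append_nil] at h'
      simpa only [GExpr.code, GExpr.size, GExpr.vl, GExpr.el, GExpr.tr, GExpr.incs,
        List.ofFn_comp, List.length_append, List.length_cons, List.length_nil, Nat.zero_add,
        Nat.reduceAdd] using h'
  | join t args ih =>
    intro pre post st vs ed tri hi s hw h hs hb
    obtain ⟨T, s', r, hT, hs', h'⟩ := evaluates_join (post := post) hf hD (j := 1) (by omega) he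
      (fun i => ih i (he.2.1 i)) (by simpa [GExpr.code, List.ofFn_comp] using hw) h hs hb
    refine ⟨T, s', r, hT.trans ?_, hs', ?_⟩
    · simp [GExpr.ct, List.ofFn_comp]
    · simp only [Nat.one_mul, Nat.mul_one, ← listIf_append] at h'
      have hsz : (GExpr.join t args).size = (List.length (GExpr.vl _), List.length (GExpr.el _)) := rfl
      rw [hsz]
      simpa only [GExpr.code, GExpr.vl, GExpr.el, GExpr.tr, GExpr.incs,
        List.ofFn_comp, List.length_append, List.length_cons, List.length_nil, Nat.zero_add,
        Nat.reduceAdd] using h'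
  | inc x N e ih =>
    intro pre post st vs ed tri hi s hw h hs hb
    have htr := (GExpr.tr_le_tr_one hf _).trans he.tr_le
    have hel := he.length_el_le
    have hvl := (GExpr.inc x N e).length_vl_le
    have hee := he.1.isEdgeList.1
    have hev := e.length_vl_le
    simp only [GExpr.code, List.append_assoc] at hw
    obtain ⟨T₁, s₁, r₁, hT₁, hs₁, h₁⟩ := ih he.1
      (post := [4, x, N.length] ++ (N ++ post)) (by simpa using hw) h hs hb
    obtain ⟨b₁, b₂, b₃, b₄, b₅⟩ := hb.append he.1 hf
    have hwl := congrArg List.length hw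
    simp only [GExpr.code, GExpr.vl, GExpr.el, GExpr.tr, List.length_append, List.length_cons,
      List.length_nil, List.length_map, Nat.zero_add, Nat.reduceAdd] at *
    rw [← List.length_append] at h₁
    have hp2 := Nat.pow_le_pow_left
      (show pre.length + (e.code.length + (3 + N.length)) ≤ w.length by omega) 2
    have hp3 := Nat.pow_le_pow_left
      (show pre.length + (e.code.length + (3 + N.length)) ≤ w.length by omega) 3
    have hq2 := pow_two_add_le pre.length (e.code.length + (3 + N.length))
    have hq3 := pow_three_add_le pre.length (e.code.length + (3 + N.length))
    have hv2 := Nat.pow_le_pow_left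
      (show e.vl.length + 1 ≤ e.code.length + (3 + N.length) by omega) 2
    have hv3 := Nat.pow_le_pow_left
      (show e.vl.length + 1 ≤ e.code.length + (3 + N.length) by omega) 3
    have hb₃ := hb.edges
    have hb₄ := hb.triangles
    obtain ⟨T₂, s₂, r₂, hT₂, hs₂, h₂⟩ := reach_step (P := P) (op := 4)
      (seg := x :: N.length :: N) (post := post) (pre := pre ++ e.code)
      hs₁ (by omega) h₁ (by simpa using hw) (by omega) (fun s' hs' _ h' =>
        incStep_does (D := D) (w := w) (pre := pre ++ e.code) (post := post) (N := N) (x := x) (st := st)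
          (vs := vs ++ e.vl) (ed := ed) (n := e.vl.length) (ee := e.el) hs' hf
          (by simpa [GExpr.size] using h') (by simpa using hw)
          (fun p hp => ⟨List.mem_append_right _ ((e.mem_vl _).2 (hee p hp).1),
            List.mem_append_right _ ((e.mem_vl _).2 (hee p hp).2)⟩) (by omega)
          (by rw [List.length_append]; omega) (by omega) (by rw [List.length_append]; omega)
          (by omega) (by omega) (by omega) (by omega))
    refine ⟨_, s₂, r₁.trans r₂, ?_, hs₂, ?_⟩
    · simp only [GExpr.ct]; omega
    · simpa only [GExpr.size, GExpr.vl, GExpr.el, GExpr.incs, List.length_append,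
        List.length_singleton, List.length_map, Nat.add_assoc, List.append_assoc] using h₂
  | substSmall t E args ih =>
    exact evaluates_substSmall hMul hf hD he fun i => ih i (he.2.1 i)
  | substTd t H args _ ih =>
    exact evaluates_substTd hf hD he fun i => ih i (he.2.1 i)

/-- The registers for the evaluation of an expression are initialised. -/
def initStep (f : RamTerm) : RamProg :=
  set 1 0 ;; set 2 0 ;; set 3 0 ;; set 4 0 ;; set 5 0 ;; set 6 f ;; set 7 0

/-- The code in the array `0` is evaluated. -/
def evalCode (P : RamProg) (f : RamTerm) : RamProg :=
  initStep f ;; loop (reg 0 - reg 1) (evalStep P)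

/-- No array has to be cleared: for empty lists the conditions on the stack, the vertices, the edges
and the marks are vacuous. So the second evaluation may also start with the memory left by the first
one. -/
theorem initStep_does {B : ℕ} {s : RamState} (hs : s.Fits B) {w : List ℕ} {f : ℕ} (hf : f ≤ B)
    (h0 : s.reg 0 = w.length) (hm : HoldsAt (s.mem 0) 0 w) :
    (initStep (.lit f)).Does B s 50 (EvalState w f 0 [] [] [] 0 0) := by
  refine Ok.does hs ?_ (Nat.le_of_ble_eq_true rfl) ?_
  · simpa [initStep, RamTerm.Safe] using hf
  · constructor <;> simp [initStep, h0, HoldsAt, HoldsPairs, RamTerm.val]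
    exact fun i x h => by simpa using hm i x h

theorem evalCode_does {P : RamProg} {c : ℕ} {M : ℕ → ℕ} {B D : ℕ} {s : RamState} (hs : s.Fits B)
    {f : ℕ} (hMul : MultipliesMatrices P c M) (hf : f ≤ 1) {e : GExpr}
    (hD : WordBounds e.code.length D B c) (he : e.WellFormed)
    (h0 : s.reg 0 = e.code.length) (hm : HoldsAt (s.mem 0) 0 e.code) :
    (evalCode P (.lit f)).Does B s (1000 * e.ct (matSteps M) f + 60) fun s' =>
      s'.reg 0 = e.code.length ∧ HoldsAt (s'.mem 0) 0 e.code ∧ s'.reg 5 = e.tr f ∧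
        s'.reg 7 = e.incs := by
  have hDD := Nat.le_mul_self D
  have hD₁ := hD.linear
  have hD₄ := hD.word
  refine Does.seq hs (initStep_does hs (by omega) h0 hm)
    (T₂ := 1000 * e.ct (matSteps M) f + 10) ?_ (by omega)
  rintro s₁ hs₁ - h₁
  obtain ⟨T, s₂, r, hT, hs₂, h₂⟩ := evaluates hMul hf hD e he (pre := []) (post := [])
    (by simp) h₁ hs₁ (by constructor <;> simp)
  have hc : (reg 0 - reg 1).cost = 3 := rfl
  refine r.does hs₂ (by simp) (by simp [h₂.reg_length, h₂.reg_pos]) ⟨h₂.reg_length, h₂.code,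
    by simpa using h₂.reg_tri, by simpa using h₂.reg_inc⟩ (by omega)

/-- Counts the triangles of the value of the expression in the array `0`. -/
def countTriangles (P : RamProg) : RamProg :=
  evalCode P (.lit 0) ;; cond (reg 7) (evalCode P (.lit 1)) skip ;; set 0 (reg 5)

/-- The second evaluation runs only if the first one has counted an increment. Hence the cost with
`f = 1` needs a bound only for expressions with `HasInc`. -/
theorem countTriangles_does {P : RamProg} {c : ℕ} {M : ℕ → ℕ} {B D : ℕ} {s : RamState}
    (hs : s.Fits B) (hMul : MultipliesMatrices P c M) {e : GExpr}
    (hD : WordBounds e.code.length D B c) (he : e.WellFormed) (hin : s.HoldsInput e.code) {d : ℕ}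
    (hd : ∀ f ≤ 1, (f = 0 ∨ e.HasInc) → e.ct (matSteps M) f ≤ d) :
    (countTriangles P).Does B s (2000 * d + 130) fun s' => s'.reg 0 = e.tr 1 := by
  have hm : HoldsAt (s.mem 0) 0 e.code := fun i x hx => by
    obtain ⟨hi, rfl⟩ := List.getElem?_eq_some_iff.1 hx
    simpa using hin.2 i hi
  have hd₀ := hd 0 (Nat.zero_le 1) (Or.inl rfl)
  refine Does.seq hs (evalCode_does hs hMul (Nat.zero_le 1) hD he hin.1 hm)
    (T₂ := 1000 * d + 70) ?_ (by omega)
  rintro s₁ hs₁ - ⟨h0, hm₁, h5, h7⟩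
  refine Does.seq hs₁ (T₁ := 1000 * d + 64) (T₂ := 4) (Q := fun s' => s'.reg 5 = e.tr 1) ?_ ?_
    (by omega)
  · have hc : (reg 7).cost = 1 := rfl
    by_cases hinc : e.HasInc
    · have hd₁ := hd 1 le_rfl (Or.inr hinc)
      refine Does.cond_pos hs₁ (by simp) ?_ (evalCode_does hs₁ hMul le_rfl hD he h0 hm₁ |>.mono
        le_rfl fun s' h => h.2.2.1) (by omega)
      simp only [val_reg, h7]
      exact fun h => (GExpr.incs_eq_zero_iff e).1 h hinc
    · refine Does.cond_neg hs₁ (by simp) ?_ (T := 1) (Ok.does hs₁ (by simp) le_rfl ?_) (by omega)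
      · simpa only [val_reg, h7] using (GExpr.incs_eq_zero_iff e).2 hinc
      · simpa using h5.trans (GExpr.tr_eq_of_not_hasInc hinc 0)
  · rintro s₂ hs₂ - h₂
    exact Ok.does hs₂ (by simp) (Nat.le_of_ble_eq_true rfl) (by simpa using h₂)

end RamProg

/-! ### The running time -/

/-- The fourth power dominates all polynomial bounds on the counts. Its square together with `8 ≤ (L
+ 2) ^ 3` needs exponent 11, and `2 * L + 3 ≤ (L + 2) ^ 2` leads to `2 * c` for the matrix program.
-/
theorem wordBounds {L B c : ℕ} (h : (L + 2) ^ (11 + 2 * c) ≤ B) :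
    WordBounds L ((L + 2) ^ 4) B c := by
  have hL : 2 ≤ L + 2 := Nat.le_add_left 2 L
  have h4 : (L + 2) ^ 4 = L ^ 4 + 8 * L ^ 3 + 24 * L ^ 2 + 32 * L + 16 := by ring
  have hB : ∀ j ≤ 11 + 2 * c, (L + 2) ^ j ≤ B := fun j hj =>
    (Nat.pow_le_pow_right (by omega) hj).trans h
  refine ⟨by omega, by omega, by omega, ?_, ?_⟩
  · calc 8 * ((L + 2) ^ 4 * (L + 2) ^ 4) = 2 ^ 3 * (L + 2) ^ 8 := by ring
      _ ≤ (L + 2) ^ 3 * (L + 2) ^ 8 := Nat.mul_le_mul_right _ (Nat.pow_le_pow_left hL 3)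
      _ = (L + 2) ^ 11 := by ring
      _ ≤ B := hB _ (by omega)
  · calc (2 * L + 3) ^ c ≤ ((L + 2) ^ 2) ^ c := Nat.pow_le_pow_left (by nlinarith) c
      _ = (L + 2) ^ (2 * c) := (pow_mul _ _ _).symm
      _ ≤ B := hB _ (by omega)

/-- Step numbers are natural, so the real bound may be rounded down; `|C|` replaces `C` to have a
nonnegative constant. -/
theorem IsMatMulExponent.exists_multipliesMatrices {ω : ℝ} (h : IsMatMulExponent ω) :
    ∃ (P : RamProg) (c : ℕ) (C : ℝ), 0 ≤ C ∧
      RamProg.MultipliesMatrices P c fun r => ⌊C * ((r : ℝ) ^ ω + 1)⌋₊ := by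
  obtain ⟨P, c, C, hP⟩ := h
  refine ⟨P, c, |C|, abs_nonneg C, fun r A X Y hXY B s hB hs h0 hin => ?_⟩
  obtain ⟨T, s', hr, hZ, hT⟩ := hP r A X Y hXY B s hB hs h0 hin
  refine ⟨T, s', hr, Nat.le_floor (hT.trans ?_), hZ⟩
  exact mul_le_mul_of_nonneg_right (le_abs_self C) (by positivity)

/-- For `r ≥ 2` one factor `r` is split off from `r ^ ω` and the rest is bounded by `h ^ (ω - 1)`;
`ω ≥ 2` absorbs the `r * r` steps that write the factors. -/
theorem matSteps_le {ω C : ℝ} (hω : 2 ≤ ω) (hC : 0 ≤ C) {h r : ℕ} (hr : r ≤ h) :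
    (RamProg.matSteps (fun r => ⌊C * ((r : ℝ) ^ ω + 1)⌋₊) r : ℝ) ≤ (2 * C + 1) *
      (((max h 1 : ℕ) : ℝ) ^ (ω - 1) * (if 2 ≤ r then r else 0 : ℕ) + 1) := by
  have h₁ : (⌊C * ((r : ℝ) ^ ω + 1)⌋₊ : ℝ) ≤ C * ((r : ℝ) ^ ω + 1) :=
    Nat.floor_le (by positivity)
  simp only [RamProg.matSteps]
  push_cast
  split_ifs with h2
  · have hr1 : (1 : ℝ) ≤ r := by exact_mod_cast (by omega : 1 ≤ r)
    have h₂ : (r : ℝ) * r ≤ (r : ℝ) ^ ω := by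
      calc (r : ℝ) * r = (r : ℝ) ^ (2 : ℝ) := by rw [Real.rpow_two, sq]
        _ ≤ _ := Real.rpow_le_rpow_of_exponent_le hr1 hω
    have h₃ : (r : ℝ) ^ ω ≤ (max (h : ℝ) 1) ^ (ω - 1) * r := by
      calc (r : ℝ) ^ ω = (r : ℝ) ^ (ω - 1) * r := by
            rw [← Real.rpow_add_one (by positivity)]; ring_nf
        _ ≤ _ := by
          gcongr
          · linarith
          · exact le_max_of_le_left (by exact_mod_cast hr)
    have h₄ : 0 ≤ (max (h : ℝ) 1) ^ (ω - 1) * r := by positivity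
    nlinarith [mul_le_mul_of_nonneg_left h₃ hC, mul_nonneg hC h₄]
  · obtain rfl | rfl : r = 0 ∨ r = 1 := by omega
    · simp only [Nat.cast_zero, Real.zero_rpow (by linarith : ω ≠ 0)] at h₁ ⊢
      linarith
    -- The case `r = 1` determines the constant: one cell and at most `2 * C` steps of the matrix
    -- program.
    · simp only [Nat.cast_one, Real.one_rpow] at h₁ ⊢
      linarith

namespace GExpr

variable {e : GExpr} {k h l : ℕ}

/-- If an increment is present, then `incDepth + 1 ≤ 2 * k`; if `f = 0`, this term vanishes. In
either case no separate summand `m` remains. -/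
theorem ct_le_of_hasInc (hw : e.WellFormed) (hk : e.incDepth ≤ k) (hp : e.PatternsBounded h l)
    (M : ℕ → ℕ) {f : ℕ} (hf : f ≤ 1) (hi : f = 0 ∨ e.HasInc) :
    e.ct M f ≤ 5 * e.code.length + e.matCost M + 2 * ((k + l) * e.el.length) := by
  have h₁ := ct_le hw hp M f
  have h₂ : (e.incDepth + 1) * (f * e.el.length) ≤ 2 * (k * e.el.length) := by
    obtain rfl | hi := hi
    · simp
    · have hi : 1 ≤ e.incDepth := hi
      calc (e.incDepth + 1) * (f * e.el.length) ≤ (2 * k) * (1 * e.el.length) :=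
            Nat.mul_le_mul (by omega) (Nat.mul_le_mul_right _ hf)
        _ = _ := by ring
  have h₃ : (k + l) * e.el.length = k * e.el.length + l * e.el.length := Nat.add_mul _ _ _
  omega

/-- Since `ω ≥ 2`, the maximum of `h` and 1 is at most its power with exponent `ω - 1`. The constant
is `7 + 9 * 2`, from `2 * h + 7 ≤ 9 * max h 1` and `branching ≤ 2 * n`. -/
theorem Reduced.length_code_le_rpow {ω : ℝ} (hω : 2 ≤ ω) (hr : e.Reduced) (hw : e.WellFormed)
    (hk : e.incDepth ≤ k) (hp : e.PatternsBounded h l) :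
    (e.code.length : ℝ) ≤ 25 * (((max h 1 : ℕ) : ℝ) ^ (ω - 1) * e.vl.length +
      (k + l) * e.el.length + 1) := by
  have hH : ((max h 1 : ℕ) : ℝ) ≤ ((max h 1 : ℕ) : ℝ) ^ (ω - 1) := by
    conv_lhs => rw [← Real.rpow_one ((max h 1 : ℕ) : ℝ)]
    exact Real.rpow_le_rpow_of_exponent_le (by exact_mod_cast le_max_right h 1) (by linarith)
  set D := ((max h 1 : ℕ) : ℝ) ^ (ω - 1)
  have h₀ : 0 ≤ ((k : ℝ) + l) * e.el.length := by positivity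
  obtain hn | hn := Nat.eq_zero_or_pos e.vl.length
  · obtain rfl := hr.eq_empty hw hn
    simp [code, vl, el]
  · have h₁ := hr.length_code_le hw hp hn
    have h₂ := e.branching_le
    have h₃ : (e.incDepth + l) * e.el.length ≤ (k + l) * e.el.length :=
      Nat.mul_le_mul_right _ (by omega)
    have h₄ : (2 * h + 7) * e.branching ≤ (9 * max h 1) * (2 * e.vl.length) :=
      Nat.mul_le_mul (by omega) (by omega)
    have h₅ : e.code.length ≤ 7 * e.vl.length + (9 * max h 1) * (2 * e.vl.length) +
        (k + l) * e.el.length := by omega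
    have h₆ : (e.code.length : ℝ) ≤ 7 * e.vl.length + (9 * (max h 1 : ℕ)) * (2 * e.vl.length) +
        (k + l) * e.el.length := by exact_mod_cast h₅
    have h₇ : (1 : ℝ) ≤ (max h 1 : ℕ) := by exact_mod_cast le_max_right h 1
    have h₈ := mul_le_mul_of_nonneg_right hH (Nat.cast_nonneg (α := ℝ) e.vl.length)
    have h₉ := mul_le_mul_of_nonneg_right (h₇.trans hH) (Nat.cast_nonneg (α := ℝ) e.vl.length)
    linarith

end GExpr

theorem theorem2 (ω : ℝ) (hω : IsMatMulExponent ω) :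
    ∃ (P : RamProg) (c : ℕ) (C : ℝ),
      ∀ (k h l : ℕ) (V : Type*) [Fintype V] [DecidableEq V] (G : SimpleGraph V)
        [DecidableRel G.Adj] (e : GExpr), e.IsTdMwMtdExprOf k h l G →
      ∀ (B : ℕ) (s : RamState), (e.code.length + 2) ^ c ≤ B → s.Fits B → s.HoldsInput e.code →
        ∃ (T : ℕ) (s' : RamState), P.Runs B s T s' ∧
          s'.reg 0 = (G.cliqueFinset 3).card ∧
          (T : ℝ) ≤ C * (((max h 1 : ℕ) : ℝ) ^ (ω - 1) * (Fintype.card V : ℝ)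
            + ((k : ℝ) + (l : ℝ)) * (G.edgeFinset.card : ℝ) + (e.code.length : ℝ) + 1) ∧
          (e.Reduced →
            (T : ℝ) ≤ C * (((max h 1 : ℕ) : ℝ) ^ (ω - 1) * (Fintype.card V : ℝ)
              + ((k : ℝ) + (l : ℝ)) * (G.edgeFinset.card : ℝ) + 1)) := by

  have h2 := hω.two_le
  obtain ⟨P, c, C, hC, hP⟩ := hω.exists_multipliesMatrices
  -- Two evaluations of 1000 steps per unit of cost give 2000, and 130 is the overhead. The factor
  -- 26 is `25 + 1`: for reduced expressions the code length is replaced by its bound with constant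
  -- 25.
  refine ⟨P.countTriangles, 11 + 2 * c, (2000 * (5 + 2 * (2 * C + 1)) + 130) * 26, ?_⟩
  rintro k h l V _ _ G _ e ⟨hw, hk, hp, ⟨φ⟩⟩ B s hB hs hin
  obtain ⟨T, s', hr, hT, h0⟩ := RamProg.countTriangles_does hs hP (wordBounds hB) hw hin
    fun f hf hi => GExpr.ct_le_of_hasInc hw hk hp _ hf hi
  have hmat := GExpr.matCost_le (l := l) (by linarith : 0 ≤ 2 * C + 1)
    (fun r hr => matSteps_le h2 hC hr) (by positivity) hp
  have hbr : (e.branching : ℝ) ≤ 2 * e.vl.length := by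
    exact_mod_cast (Nat.le_add_right _ _).trans e.branching_le
  rw [GExpr.card_cliqueFinset_eq_of_iso φ hw, GExpr.card_edgeFinset_eq_of_iso (h := hw) (φ := φ),
    GExpr.card_eq_of_iso φ hw]
  have hred := fun hr : e.Reduced => hr.length_code_le_rpow h2 hw hk hp
  set D := ((max h 1 : ℕ) : ℝ) ^ (ω - 1) with hD
  have hD0 : 0 ≤ D := by positivity
  set X := D * e.vl.length
  have hX : 0 ≤ X := by positivity
  have hm : 0 ≤ ((k : ℝ) + l) * e.el.length := by positivity
  have hL : (0 : ℝ) ≤ e.code.length := by positivity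
  have hDb : D * e.branching ≤ 2 * X := by
    calc D * e.branching ≤ D * (2 * e.vl.length) := mul_le_mul_of_nonneg_left hbr hD0
      _ = 2 * X := by ring
  have hT' : (T : ℝ) ≤ 2000 * (5 * e.code.length + (2 * C + 1) * (2 * X + e.code.length) +
      2 * (((k : ℝ) + l) * e.el.length)) + 130 := by
    have h₁ : (T : ℝ) ≤ 2000 * (5 * e.code.length + e.matCost (RamProg.matSteps fun r =>
        ⌊C * ((r : ℝ) ^ ω + 1)⌋₊) + 2 * ((k + l) * e.el.length)) + 130 := by exact_mod_cast hT
    have h₂ := mul_le_mul_of_nonneg_left (add_le_add_left hDb e.code.length)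
      (by linarith : 0 ≤ 2 * C + 1)
    linarith
  have key : (T : ℝ) ≤ (2000 * (5 + 2 * (2 * C + 1)) + 130) *
      (X + ((k : ℝ) + l) * e.el.length + e.code.length + 1) := by
    nlinarith [mul_nonneg hC hX, mul_nonneg hC hm, mul_nonneg hC hL]
  have hK : 0 ≤ 2000 * (5 + 2 * (2 * C + 1)) + 130 := by linarith
  refine ⟨T, s', hr, h0, key.trans ?_, fun hr => key.trans ?_⟩
  · rw [mul_assoc]
    exact mul_le_mul_of_nonneg_left (by linarith) hK
  · rw [mul_assoc]
    have := hred hr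
    exact mul_le_mul_of_nonneg_left (by linarith) hK
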